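/- Consider the symmetric two-queue fluid polling model with a single server: fluid enters each of the two queues at constant rate $\lambda>0$; the server alternates between the queues, with independent exponentially distributed residence times of rate $c>0$ (mean $1/c$) that do not depend on the workloads, and switches instantaneously; while the server is at a queue, that queue is served at rate $\mu>0$, so that its workload changes at rate $\lambda-\mu$ as long as it is positive and stays at $0$ once it is empty, and the other workload grows at rate $\lambda$. Let $\rho=\lambda/\mu$, let $0<\rho<\tfrac12$ (stability), and let $(V_1,V_2)=(V_1^{(\rho)},V_2^{(\rho)})$ be the stationary workloads, either at an arbitrary epoch or at the epochs at which the server arrives at queue 1. Then, with $\mu$ and $c$ fixed, there is a random vector $(Z_1,Z_2)$, the same for both choices of epochs, such that $$\bigl((\tfrac12-\rho)V_1,(\tfrac12-\rho)V_2\bigr)\xrightarrow{d}(Z_1,Z_2)\qquad(\rho\uparrow\tfrac12),$$ $Z_1,Z_2$ are square integrable, and for $j=1,2$ $$\mathbb E[Z_j]=\frac{\mu}{8c},\qquad \mathbb E[Z_j^2]=\frac{\mu^2}{32c^2},\qquad \mathbb E[Z_1Z_2]=\frac{\mu^2}{32c^2}\,\frac{\pi^2-9}{3},$$ and the correlation coefficient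 of $Z_1$ and $Z_2$ is $\tfrac23\pi^2-7\approx-0.4203$ (correct to four decimals). -/

import Mathlib

open MeasureTheory ProbabilityTheory Filter Topology

namespace FluidPolling

/-- State of the symmetric two-queue fluid polling model: the workloads `(v₁, v₂)` of the two
queues together with the position of the server (`0`: at queue 1, `1`: at queue 2). -/
abbrev State : Type := (ℝ × ℝ) × Fin 2

/-- Evolution of the workload of the served queue over a period of length `t` without a switch:
inflow at rate `lam`, service at rate `mu`, and the workload stays `0` once it has hit `0`. -/
noncomputable def drain (lam mu t v : ℝ) : ℝ := max 0 (v + (lam - mu) * t)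

/-- Evolution of the workload of the other queue over a period of length `t` without a switch. -/
noncomputable def fill (lam t v : ℝ) : ℝ := v + lam * t

/-- Workloads after a period of length `t` during which the server stays at queue 1. -/
noncomputable def serveFirst (lam mu t : ℝ) (v : ℝ × ℝ) : ℝ × ℝ :=
  (drain lam mu t v.1, fill lam t v.2)

/-- Workloads after a period of length `t` during which the server stays at queue 2. -/
noncomputable def serveSecond (lam mu t : ℝ) (v : ℝ × ℝ) : ℝ × ℝ :=
  (fill lam t v.1, drain lam mu t v.2)

/-- State after a period of length `t` without a switch of the server. -/
noncomputable def flow (lam mu t : ℝ) (x : State) : State :=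
  (if x.2 = 0 then serveFirst lam mu t x.1 else serveSecond lam mu t x.1, x.2)

/-- The server moves instantaneously to the other queue. -/
def switchServer (x : State) : State := (x.1, 1 - x.2)

/-- Time of the `n`-th switch of the server, when the successive residence times are
`τ 0, τ 1, …` (with `switchTime τ 0 = 0`, the starting time). -/
noncomputable def switchTime (τ : ℕ → ℝ) (n : ℕ) : ℝ := ∑ k ∈ Finset.range n, τ k

/-- State immediately after the `n`-th switch, when the initial state is `x`. -/
noncomputable def stateAtSwitch (lam mu : ℝ) (x : State) (τ : ℕ → ℝ) : ℕ → State
  | 0 => x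
  | n + 1 => switchServer (flow lam mu (τ n) (stateAtSwitch lam mu x τ n))

/-- Number of switches of the server in the time interval `(0, t]`. -/
noncomputable def switchCount (τ : ℕ → ℝ) (t : ℝ) : ℕ := {n : ℕ | switchTime τ (n + 1) ≤ t}.ncard

/-- State at time `t`, when the initial state is `x` and the residence times are `τ 0, τ 1, …`. -/
noncomputable def stateAt (lam mu : ℝ) (x : State) (τ : ℕ → ℝ) (t : ℝ) : State :=
  flow lam mu (t - switchTime τ (switchCount τ t)) (stateAtSwitch lam mu x τ (switchCount τ t))

/-- Law of the sequence of residence times: independent, exponential with rate `c`. -/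
noncomputable def residenceLaw (c : ℝ) : Measure (ℕ → ℝ) :=
  Measure.infinitePi fun _ : ℕ => expMeasure c

/-- `π` is a stationary law, at arbitrary epochs, of the Markov process (workloads, server
position): if the initial state has law `π` and is independent of the i.i.d. exponential residence
times, then the state has law `π` at every time `t ≥ 0`. The workloads are nonnegative. -/
structure IsTimeStationary (lam mu c : ℝ) (π : Measure State) : Prop where
  nonneg : ∀ᵐ x ∂π, 0 ≤ x.1.1 ∧ 0 ≤ x.1.2
  stationary : ∀ t : ℝ, 0 ≤ t →
    (π.prod (residenceLaw c)).map (fun p => stateAt lam mu p.1 p.2 t) = π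

/-- `ν` is a stationary law of the workloads at the epochs at which the server arrives at
queue 1: if `(V₁(0), V₂(0))` has law `ν` and the server stays an exponential time `T₁` at queue 1
and then an exponential time `T₂` at queue 2 (all independent), then
`(V₁(T₁ + T₂), V₂(T₁ + T₂))` has law `ν` as well. The workloads are nonnegative. -/
structure IsCycleStationary (lam mu c : ℝ) (ν : Measure (ℝ × ℝ)) : Prop where
  nonneg : ∀ᵐ v ∂ν, 0 ≤ v.1 ∧ 0 ≤ v.2
  stationary :
    (ν.prod ((expMeasure c).prod (expMeasure c))).map
      (fun p => serveSecond lam mu p.2.2 (serveFirst lam mu p.2.1 p.1)) = ν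

/-- Correlation coefficient of two square-integrable random variables. -/
noncomputable def correlation {Ω : Type*} [MeasurableSpace Ω] (X Y : Ω → ℝ) (P : Measure Ω) : ℝ :=
  covariance X Y P / (Real.sqrt (variance X P) * Real.sqrt (variance Y P))

end FluidPolling

/-! Write `ε = 1/2 - ρ`. Let `M` and `N` be the workload laws while the server is at queue 1 and at
queue 2 (arbitrary epochs), or at the ends of visits to queue 1 and to queue 2. Since residence
times are memoryless, both readings satisfy the same two balance equations for Laplace transforms
(`IsCycleStationary.balance`, `IsTimeStationary.balance`), in which the unknown terms are the
transforms of the parts of `M` and `N` on the axes.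

The marginal transforms are explicit, and after scaling by `ε` they give tightness. Moreover `M` and
`N` differ by `O(ε)` at scaled arguments, so every choice of epochs has the same subsequential
limits. Eliminating `N` (`Balance.kernel_eq`), dividing by `ε²` and letting `ε → 0` shows that each
limit `Q` solves `(α + β + m (α - β)²) Q(α, β) = α g₁(β) + β g₂(α)` with `m = μ / (8c)`
(`exists_limitEquation`).

This equation has at most one solution. Its kernel vanishes at `α = p(z)`, `β = p(-z)` with `p(z) =
z (1 - z) / (2m)`, and `p(-z) = p(1 + z)`. With `S(z) = sin (πz) / (z (1 - z))` and `F_j(z) = S(z)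
g_j(p(z))`, the vanishing of the right-hand side on the imaginary axis becomes `F₁(1 + z) = F₂(z)`
and, by symmetry, `F₂(1 + z) = F₁(z)` (`boundary_relation`). The `F_j` are analytic in the strip `0
< Re z < 1` and `O(exp (π |Im z|) / (Im z)²)`. A Liouville argument for periodic functions
(`periodic_strip_eq_integral`) gives first `F₁ = F₂` and then `F₁ = π`. So `g₁(p(z)) = g₂(p(z)) = πz
(1 - z) / sin (πz)`, which determines `Q` (`measure_unique`).

The moments come from the same formulas. The marginals have transform `1 / (1 + mt)`, hence are
exponential with mean `m`; on the diagonal `Q(t, t) = g₁(t)`, and the expansion of `πx / sin (πx)`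
at `0` yields `E[Z₁Z₂] = 2m² (π²/3 - 3)`.

Finally the limit law has to be exhibited, which needs actual stationary laws close to `ρ = 1/2`.
They are built by a Krylov–Bogoliubov argument with exponential moment bounds
(`exists_isCycleStationary`). -/

namespace FluidPolling

/-! ### Liouville theorem for periodic functions in a vertical strip -/

section Strip

open Complex Set

/-- Cauchy's theorem on a rectangle of width one: the integrals over the two vertical sides cancel
by periodicity. -/
theorem integral_horizontal_eq_of_periodic_strip {F : ℂ → ℂ}
    (hc : ContinuousOn F {z | 0 ≤ z.re ∧ z.re ≤ 1})
    (hd : DifferentiableOn ℂ F {z | 0 < z.re ∧ z.re < 1})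
    (hper : ∀ b : ℝ, F (1 + b * I) = F (b * I)) (b₁ b₂ : ℝ) :
    ∫ a : ℝ in (0 : ℝ)..1, F (a + b₁ * I) = ∫ a : ℝ in (0 : ℝ)..1, F (a + b₂ * I) := by
  have h := Complex.integral_boundary_rect_eq_zero_of_continuousOn_of_differentiableOn F
    (b₁ * I) (1 + b₂ * I) ?_ ?_
  · simp only [mul_re, ofReal_re, I_re, mul_zero, ofReal_im, I_im, mul_one, sub_self, add_re,
      one_re, add_zero, mul_im, zero_add, add_im, one_im, ofReal_one, ofReal_zero] at h
    simp only [hper, add_sub_cancel_right] at h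
    exact sub_eq_zero.1 h
  · refine hc.mono fun z hz => ?_
    have := (Complex.mem_reProdIm.1 hz).1
    simpa [uIcc_of_le] using this
  · refine hd.mono fun z hz => ?_
    have := (Complex.mem_reProdIm.1 hz).1
    simpa using this

/-- With a single nonzero Fourier coefficient the series is trivially summable, so it converges
pointwise to the continuous function `f` on the circle, and `f` is its own mean. -/
theorem eq_zero_of_fourier_coeff {f : ℝ → ℂ} (hf : ContinuousOn f (Icc 0 1)) (h01 : f 0 = f 1)
    (hcoef : ∀ n : ℤ, n ≠ 0 → ∫ a : ℝ in (0 : ℝ)..1, exp (-(2 * Real.pi * I * n * a)) * f a = 0) :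
    ∀ a ∈ Icc (0 : ℝ) 1, f a = ∫ a : ℝ in (0 : ℝ)..1, f a := by
  have : Fact ((0 : ℝ) < 1) := ⟨one_pos⟩
  let g : C(AddCircle (1 : ℝ), ℂ) :=
    ⟨AddCircle.liftIco 1 0 f, AddCircle.liftIco_zero_continuous h01 hf⟩
  have hg : ∀ n, fourierCoeff g n = ∫ a : ℝ in (0 : ℝ)..1, exp (-(2 * Real.pi * I * n * a)) * f a := by
    intro n
    change fourierCoeff (AddCircle.liftIco 1 0 f) n = _
    rw [fourierCoeff_liftIco_eq, fourierCoeffOn_eq_integral]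
    simp only [zero_add, sub_zero, div_one, one_smul]
    refine intervalIntegral.integral_congr fun a _ => ?_
    simp only [smul_eq_mul]
    congr 1
    rw [fourier_coe_apply]
    congr 1
    push_cast
    ring
  have hg0 : ∀ n : ℤ, n ≠ 0 → fourierCoeff g n = 0 := fun n hn => by rw [hg, hcoef n hn]
  have hsum : Summable (fourierCoeff g) :=
    summable_of_ne_finset_zero (s := {0}) fun n hn => hg0 n (by simpa using hn)
  have key : ∀ a ∈ Ico (0 : ℝ) 1, f a = ∫ a : ℝ in (0 : ℝ)..1, f a := by
    intro a ha
    have h1 := has_pointwise_sum_fourier_series_of_summable hsum (a : AddCircle (1 : ℝ))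
    have h2 : HasSum (fun i : ℤ => fourierCoeff g i • fourier i (a : AddCircle (1 : ℝ)))
        (fourierCoeff g 0 • fourier 0 (a : AddCircle (1 : ℝ))) :=
      hasSum_single 0 fun n hn => by rw [hg0 n hn, zero_smul]
    have h3 := h1.unique h2
    have h4 : g (a : AddCircle (1 : ℝ)) = f a := by
      change AddCircle.liftIco 1 0 f a = f a
      exact AddCircle.liftIco_coe_apply (by simpa using ha)
    rw [h4, hg] at h3
    simpa using h3
  intro a ha
  rcases ha.2.lt_or_eq with h | h
  · exact key a ⟨ha.1, h⟩
  · rw [h, ← h01]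
    exact key 0 (by simp)

/-- The `n`-th Fourier coefficient on a horizontal line, weighted by the analytic factor `exp
(-2πinz)`, does not depend on the height. Moving the line to the end where this factor decays
compensates `exp (2π |Im z|)` for every `n ≠ 0`; for `n = ±1` it only just does, and the denominator
`(Im z)²` makes the coefficient vanish. -/
theorem periodic_strip_eq_integral {F : ℂ → ℂ} {C : ℝ}
    (hc : ContinuousOn F {z | 0 ≤ z.re ∧ z.re ≤ 1})
    (hd : DifferentiableOn ℂ F {z | 0 < z.re ∧ z.re < 1})
    (hper : ∀ b : ℝ, F (1 + b * I) = F (b * I))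
    (hb : ∀ z : ℂ, 0 ≤ z.re → z.re ≤ 1 → 1 ≤ |z.im| →
      ‖F z‖ ≤ C * Real.exp (2 * Real.pi * |z.im|) / z.im ^ 2)
    {z : ℂ} (hz0 : 0 ≤ z.re) (hz1 : z.re ≤ 1) :
    F z = ∫ a : ℝ in (0 : ℝ)..1, F a := by
  have hzero : ∀ n : ℤ, n ≠ 0 → ∀ b : ℝ,
      ∫ a : ℝ in (0 : ℝ)..1, exp (-(2 * Real.pi * I * n * (a + b * I))) * F (a + b * I) = 0 := by
    intro n hn
    set G : ℂ → ℂ := fun z => exp (-(2 * Real.pi * I * n * z)) * F z with hG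
    have hGc : ContinuousOn G {z | 0 ≤ z.re ∧ z.re ≤ 1} :=
      (by fun_prop : Continuous fun z : ℂ => exp (-(2 * Real.pi * I * n * z))).continuousOn.mul hc
    have hGd : DifferentiableOn ℂ G {z | 0 < z.re ∧ z.re < 1} :=
      (by fun_prop : Differentiable ℂ fun z : ℂ =>
        exp (-(2 * Real.pi * I * n * z))).differentiableOn.mul hd
    have hGper : ∀ b : ℝ, G (1 + b * I) = G (b * I) := by
      intro b
      simp only [hG, hper]
      congr 1
      rw [Complex.exp_eq_exp_iff_exists_int]
      exact ⟨-n, by push_cast; ring⟩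
    have hconst := integral_horizontal_eq_of_periodic_strip hGc hGd hGper
    have hnorm : ∀ z : ℂ, ‖G z‖ = Real.exp (2 * Real.pi * n * z.im) * ‖F z‖ := by
      intro z
      simp only [hG, norm_mul, Complex.norm_exp]
      congr 2
      simp
    have hC : 0 ≤ C := by
      have h := (norm_nonneg _).trans (hb I (by simp) (by simp) (by simp))
      simp only [I_im, abs_one, mul_one, one_pow, div_one] at h
      exact nonneg_of_mul_nonneg_left h (Real.exp_pos _)
    have hbound : ∀ B : ℝ, 1 ≤ B → ∃ b : ℝ, ‖∫ a : ℝ in (0 : ℝ)..1, G (a + b * I)‖ ≤ C / B ^ 2 := by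
      intro B hB
      -- The sign `σ` selects the end of the strip, `Im z → +∞` or `-∞`, at which `exp (2πn Im z)`
      -- decays.
      have hσ : ∃ σ : ℝ, |σ| = 1 ∧ n * σ ≤ -1 := by
        rcases lt_or_gt_of_ne hn with h | h
        · refine ⟨1, by simp, ?_⟩
          have : (n : ℝ) ≤ -1 := by exact_mod_cast (by omega : n ≤ -1)
          linarith
        · refine ⟨-1, by simp, ?_⟩
          have : (1 : ℝ) ≤ n := by exact_mod_cast (by omega : 1 ≤ n)
          linarith
      obtain ⟨σ, hσ1, hσn⟩ := hσ
      refine ⟨σ * B, ?_⟩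
      have hle : ∀ a ∈ Set.uIoc (0 : ℝ) 1, ‖G (a + ((σ * B : ℝ) : ℂ) * I)‖ ≤ C / B ^ 2 := by
        intro a ha
        rw [uIoc_of_le zero_le_one] at ha
        have him : ((a : ℂ) + ((σ * B : ℝ) : ℂ) * I).im = σ * B := by simp
        have hre : ((a : ℂ) + ((σ * B : ℝ) : ℂ) * I).re = a := by simp
        have habs : |σ * B| = B := by rw [abs_mul, hσ1, one_mul, abs_of_nonneg (by linarith)]
        have hsq : (σ * B) ^ 2 = B ^ 2 := by rw [← sq_abs, habs]
        have h := hb (a + ((σ * B : ℝ) : ℂ) * I) (by rw [hre]; exact ha.1.le) (by rw [hre]; exact ha.2)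
          (by rw [him, habs]; exact hB)
        rw [him, habs, hsq] at h
        rw [hnorm, him]
        calc _ ≤ Real.exp (2 * Real.pi * n * (σ * B)) *
              (C * Real.exp (2 * Real.pi * B) / B ^ 2) := by gcongr
          _ = Real.exp (2 * Real.pi * n * (σ * B) + 2 * Real.pi * B) * (C / B ^ 2) := by
              rw [Real.exp_add]; ring
          _ ≤ 1 * (C / B ^ 2) := by
              gcongr
              rw [Real.exp_le_one_iff]
              have : 0 ≤ 2 * Real.pi * B := by positivity
              nlinarith
          _ = _ := one_mul _
      simpa using intervalIntegral.norm_integral_le_of_norm_le_const hle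
    intro b
    have hlim : Tendsto (fun B : ℝ => C / B ^ 2) atTop (𝓝 0) :=
      tendsto_const_nhds.div_atTop (tendsto_pow_atTop two_ne_zero)
    have hle : ‖∫ a : ℝ in (0 : ℝ)..1, G (a + b * I)‖ ≤ 0 := by
      refine ge_of_tendsto hlim ?_
      filter_upwards [eventually_ge_atTop 1] with B hB
      obtain ⟨b', hb'⟩ := hbound B hB
      rwa [hconst b b']
    exact norm_le_zero_iff.1 hle
  have hz : z = (z.re : ℂ) + z.im * I := (re_add_im z).symm
  have hcont : ContinuousOn (fun a : ℝ => F (a + z.im * I)) (Icc 0 1) := by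
    refine hc.comp (by fun_prop) fun a ha => ?_
    simpa using ha
  have h := eq_zero_of_fourier_coeff hcont (by simp [hper]) ?_ z.re ⟨hz0, hz1⟩
  · have h0 := integral_horizontal_eq_of_periodic_strip hc hd hper z.im 0
    rw [← hz] at h
    rw [h, h0]
    simp
  · intro n hn
    have h := hzero n hn z.im
    have : ∀ a : ℝ, exp (-(2 * Real.pi * I * n * (a + z.im * I))) * F (a + z.im * I) =
        exp (-(2 * Real.pi * I * n * (z.im * I))) *
          (exp (-(2 * Real.pi * I * n * a)) * F (a + z.im * I)) := by
      intro a
      rw [← mul_assoc, ← Complex.exp_add]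
      congr 2
      ring
    simp_rw [this] at h
    rw [intervalIntegral.integral_const_mul] at h
    exact (mul_eq_zero.1 h).resolve_left (Complex.exp_ne_zero _)

end Strip

/-! ### Two-dimensional Laplace transforms on the quadrant -/

section Transform

open Complex

/-- Two-dimensional Laplace transform of a measure on the plane. -/
noncomputable def lap (M : Measure (ℝ × ℝ)) (α β : ℂ) : ℂ :=
  ∫ v : ℝ × ℝ, exp (-(α * v.1 + β * v.2)) ∂M

theorem norm_exp_neg_le_one {α β : ℂ} (hα : 0 ≤ α.re) (hβ : 0 ≤ β.re) {v : ℝ × ℝ}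
    (hv : 0 ≤ v.1 ∧ 0 ≤ v.2) : ‖exp (-(α * v.1 + β * v.2))‖ ≤ 1 := by
  rw [Complex.norm_exp, Real.exp_le_one_iff]
  have h1 := mul_nonneg hα hv.1
  have h2 := mul_nonneg hβ hv.2
  simp
  linarith

variable {M : Measure (ℝ × ℝ)}

theorem integrable_exp_neg [IsFiniteMeasure M] (hM : ∀ᵐ v ∂M, 0 ≤ v.1 ∧ 0 ≤ v.2) {α β : ℂ}
    (hα : 0 ≤ α.re) (hβ : 0 ≤ β.re) :
    Integrable (fun v : ℝ × ℝ => exp (-(α * v.1 + β * v.2))) M := by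
  refine Integrable.mono' (integrable_const 1) (by fun_prop) ?_
  filter_upwards [hM] with v hv using norm_exp_neg_le_one hα hβ hv

theorem norm_lap_le_one [IsProbabilityMeasure M] (hM : ∀ᵐ v ∂M, 0 ≤ v.1 ∧ 0 ≤ v.2) {α β : ℂ}
    (hα : 0 ≤ α.re) (hβ : 0 ≤ β.re) : ‖lap M α β‖ ≤ 1 := by
  have h : ∀ᵐ v ∂M, ‖exp (-(α * v.1 + β * v.2))‖ ≤ 1 := by
    filter_upwards [hM] with v hv using norm_exp_neg_le_one hα hβ hv
  have h1 := norm_integral_le_of_norm_le_const h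
  rwa [probReal_univ, mul_one] at h1

theorem lap_zero_zero [IsProbabilityMeasure M] : lap M 0 0 = 1 := by
  simp [lap]

theorem continuousOn_lap [IsFiniteMeasure M] (hM : ∀ᵐ v ∂M, 0 ≤ v.1 ∧ 0 ≤ v.2) :
    ContinuousOn (fun p : ℂ × ℂ => lap M p.1 p.2) {p | 0 ≤ p.1.re ∧ 0 ≤ p.2.re} := by
  refine continuousOn_of_dominated (bound := fun _ => 1) (fun _ _ => by fun_prop) (fun p hp => ?_)
    (integrable_const 1) (Eventually.of_forall fun v => by fun_prop)
  filter_upwards [hM] with v hv using norm_exp_neg_le_one hp.1 hp.2 hv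

theorem lap_map_swap (M : Measure (ℝ × ℝ)) (α β : ℂ) : lap (M.map Prod.swap) α β = lap M β α := by
  rw [lap, integral_map measurable_swap.aemeasurable (by fun_prop), lap]
  simp [add_comm]

theorem nonneg_map_swap (hM : ∀ᵐ v ∂M, 0 ≤ v.1 ∧ 0 ≤ v.2) :
    ∀ᵐ v ∂(M.map Prod.swap), 0 ≤ v.1 ∧ 0 ≤ v.2 := by
  rw [ae_map_iff measurable_swap.aemeasurable]
  · filter_upwards [hM] with v hv using ⟨hv.2, hv.1⟩
  · exact (measurableSet_le measurable_const measurable_fst).inter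
      (measurableSet_le measurable_const measurable_snd)

/-- Differentiation under the integral. On the disc of radius `r = Re β₀ / 2` around `β₀` the
derivative is dominated by `v₂ exp (-r v₂) ≤ 1 / r`, so no moment assumption is needed. -/
theorem differentiableOn_lap_right [IsFiniteMeasure M] (hM : ∀ᵐ v ∂M, 0 ≤ v.1 ∧ 0 ≤ v.2) {α : ℂ}
    (hα : 0 ≤ α.re) : DifferentiableOn ℂ (fun β => lap M α β) {β | 0 < β.re} := by
  intro β₀ hβ₀
  have hr : 0 < β₀.re / 2 := half_pos hβ₀
  have hball : ∀ β ∈ Metric.ball β₀ (β₀.re / 2), β₀.re / 2 ≤ β.re := by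
    intro β hβ
    have h1 : ‖β - β₀‖ < β₀.re / 2 := by simpa [dist_eq_norm] using hβ
    have h2 := (abs_le.1 ((Complex.abs_re_le_norm (β - β₀)).trans h1.le)).1
    rw [sub_re] at h2
    linarith
  refine DifferentiableAt.differentiableWithinAt ?_
  refine (hasDerivAt_integral_of_dominated_loc_of_deriv_le
    (F := fun (β : ℂ) (v : ℝ × ℝ) => exp (-(α * v.1 + β * v.2)))
    (F' := fun (β : ℂ) (v : ℝ × ℝ) => exp (-(α * v.1 + β * v.2)) * (-(v.2 : ℂ)))
    (bound := fun _ => 1 / (β₀.re / 2)) (Metric.ball_mem_nhds β₀ hr)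
    (Eventually.of_forall fun β => by fun_prop) (integrable_exp_neg hM hα (le_of_lt hβ₀))
    (by fun_prop) ?_ (integrable_const _) ?_).2.differentiableAt
  · filter_upwards [hM] with v hv β hβ
    have hb := hball β hβ
    rw [norm_mul, norm_neg, Complex.norm_real, Real.norm_of_nonneg hv.2, Complex.norm_exp]
    have h1 : (-(α * v.1 + β * v.2)).re ≤ -(β₀.re / 2 * v.2) := by
      have := mul_nonneg hα hv.1
      have := mul_le_mul_of_nonneg_right hb hv.2
      simp
      linarith
    have h2 : β₀.re / 2 * v.2 * Real.exp (-(β₀.re / 2 * v.2)) ≤ 1 := by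
      rw [Real.exp_neg, ← div_eq_mul_inv, div_le_one (Real.exp_pos _)]
      linarith [Real.add_one_le_exp (β₀.re / 2 * v.2)]
    calc _ ≤ Real.exp (-(β₀.re / 2 * v.2)) * v.2 := by
            gcongr
            exact hv.2
      _ = (β₀.re / 2 * v.2 * Real.exp (-(β₀.re / 2 * v.2))) / (β₀.re / 2) := by
            rw [eq_div_iff hr.ne']
            ring
      _ ≤ _ := by gcongr
  · refine Eventually.of_forall fun v β _ => ?_
    have h : HasDerivAt (fun β : ℂ => -(α * v.1 + β * v.2)) (-(v.2 : ℂ)) β := by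
      have := (((hasDerivAt_id β).mul_const (v.2 : ℂ)).const_add (α * v.1)).neg
      rw [one_mul] at this
      exact this
    exact h.cexp

theorem lap_ofReal (M : Measure (ℝ × ℝ)) (s t : ℝ) :
    lap M s t = ((∫ v : ℝ × ℝ, Real.exp (-(s * v.1 + t * v.2)) ∂M : ℝ) : ℂ) := by
  rw [lap, ← integral_complex_ofReal]
  simp

end Transform

/-! ### The limit equation, its uniformization and the boundary relation -/

section LimitEquation

open Complex

/-- Equation for the Laplace transform of the stationary law of the heavy-traffic limit: `g₁` and
`g₂` are, up to a constant, the transforms of the boundary measures on the two axes. -/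
structure LimitEquation (m : ℝ) (Q : Measure (ℝ × ℝ)) (g₁ g₂ : ℂ → ℂ) : Prop where
  nonneg : ∀ᵐ v ∂Q, 0 ≤ v.1 ∧ 0 ≤ v.2
  bounded_left : ∃ B : ℝ, ∀ z : ℂ, 0 ≤ z.re → ‖g₁ z‖ ≤ B
  bounded_right : ∃ B : ℝ, ∀ z : ℂ, 0 ≤ z.re → ‖g₂ z‖ ≤ B
  eq : ∀ α β : ℂ, 0 ≤ α.re → 0 ≤ β.re →
    (α + β + m * (α - β) ^ 2) * lap Q α β = α * g₁ β + β * g₂ α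

namespace LimitEquation

variable {m : ℝ} {Q : Measure (ℝ × ℝ)} {g₁ g₂ : ℂ → ℂ}

theorem swap (h : LimitEquation m Q g₁ g₂) : LimitEquation m (Q.map Prod.swap) g₂ g₁ where
  nonneg := nonneg_map_swap h.nonneg
  bounded_left := h.bounded_right
  bounded_right := h.bounded_left
  eq α β hα hβ := by
    rw [lap_map_swap]
    linear_combination h.eq β α hβ hα

/-- Fixing `α = 1` expresses `g₁` through the transform of `Q`; this is how `g₁`, only assumed
bounded, inherits continuity and analyticity. -/
theorem left_eq (h : LimitEquation m Q g₁ g₂) {β : ℂ} (hβ : 0 ≤ β.re) :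
    g₁ β = (1 + β + m * (1 - β) ^ 2) * lap Q 1 β - β * g₂ 1 := by
  linear_combination -h.eq 1 β (by simp) hβ

theorem continuousOn_left [IsFiniteMeasure Q] (h : LimitEquation m Q g₁ g₂) :
    ContinuousOn g₁ {z | 0 ≤ z.re} := by
  have h1 : ContinuousOn (fun β : ℂ => lap Q 1 β) {z | 0 ≤ z.re} :=
    (continuousOn_lap h.nonneg).comp (f := fun β : ℂ => ((1 : ℂ), β)) (by fun_prop)
      fun β hβ => ⟨by simp, hβ⟩
  refine ContinuousOn.congr (f := fun β => (1 + β + m * (1 - β) ^ 2) * lap Q 1 β - β * g₂ 1) ?_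
    fun β hβ => h.left_eq hβ
  fun_prop

theorem differentiableOn_left [IsFiniteMeasure Q] (h : LimitEquation m Q g₁ g₂) :
    DifferentiableOn ℂ g₁ {z | 0 < z.re} := by
  have h1 : DifferentiableOn ℂ (fun β : ℂ => lap Q 1 β) {z | 0 < z.re} :=
    differentiableOn_lap_right h.nonneg (by simp)
  refine DifferentiableOn.congr (f := fun β => (1 + β + m * (1 - β) ^ 2) * lap Q 1 β - β * g₂ 1) ?_
    fun β hβ => h.left_eq (le_of_lt hβ)
  fun_prop

theorem mul_lap_left [IsProbabilityMeasure Q] (h : LimitEquation m Q g₁ g₂) {t : ℝ} (ht : 0 < t) :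
    (1 + m * t) * lap Q t 0 = g₁ 0 := by
  have ht' : (t : ℂ) ≠ 0 := by exact_mod_cast ht.ne'
  have h1 := h.eq t 0 (by simpa using ht.le) (by simp)
  refine mul_left_cancel₀ ht' ?_
  linear_combination h1

/-- The equation at `(t, 0)` reads `(1 + mt) Q(t, 0) = g₁(0)` after division by `t`; let `t → 0`. -/
theorem left_zero [IsProbabilityMeasure Q] (h : LimitEquation m Q g₁ g₂) : g₁ 0 = 1 := by
  have h1 : ContinuousOn (fun t : ℝ => lap Q t 0) (Set.Ici 0) :=
    (continuousOn_lap h.nonneg).comp (f := fun t : ℝ => ((t : ℂ), (0 : ℂ))) (by fun_prop)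
      fun t ht => ⟨by simpa using ht, by simp⟩
  have h2 : Tendsto (fun t : ℝ => (1 + m * t) * lap Q t 0) (𝓝[>] 0) (𝓝 ((1 + m * (0 : ℝ)) * lap Q (0 : ℝ) 0)) := by
    refine Tendsto.mul ?_ ((h1 0 (by simp)).mono_left (nhdsWithin_mono _ Set.Ioi_subset_Ici_self))
    exact (by fun_prop : Continuous fun t : ℝ => (1 + m * t : ℂ)).continuousAt.tendsto.mono_left
      nhdsWithin_le_nhds
  have h3 : Tendsto (fun t : ℝ => (1 + m * t) * lap Q t 0) (𝓝[>] 0) (𝓝 (g₁ 0)) :=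
    tendsto_const_nhds.congr' (by
      filter_upwards [self_mem_nhdsWithin] with t ht using (h.mul_lap_left ht).symm)
  rw [tendsto_nhds_unique h3 h2]
  simp [lap_zero_zero]

end LimitEquation

/-- The entire function `z ↦ sin (π z) / (z (1 - z))`. -/
noncomputable def sinRatio (z : ℂ) : ℂ :=
  dslope (fun w : ℂ => sin (Real.pi * w)) 0 z + dslope (fun w : ℂ => sin (Real.pi * w)) 0 (1 - z)

/-- Partial fractions: `1 / (z (1 - z)) = 1 / z + 1 / (1 - z)`, combined with `sin (π (1 - z)) = sin
(πz)`. Each summand is a difference quotient of the sine with a removable singularity. -/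
theorem mul_sinRatio (z : ℂ) : z * (1 - z) * sinRatio z = sin (Real.pi * z) := by
  have h : ∀ w : ℂ, w * dslope (fun w : ℂ => sin (Real.pi * w)) 0 w = sin (Real.pi * w) := by
    intro w
    have := sub_smul_dslope (fun w : ℂ => sin (Real.pi * w)) 0 w
    simpa using this
  have h1 := h z
  have h2 := h (1 - z)
  have h3 : sin (Real.pi * (1 - z)) = sin (Real.pi * z) := by
    rw [mul_sub, mul_one, Complex.sin_pi_sub]
  rw [sinRatio]
  linear_combination (1 - z) * h1 + z * h2 + z * h3

theorem sinRatio_one_sub (z : ℂ) : sinRatio (1 - z) = sinRatio z := by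
  rw [sinRatio, sinRatio, sub_sub_cancel, add_comm]

theorem sinRatio_zero : sinRatio 0 = Real.pi := by
  have h : HasDerivAt (fun w : ℂ => sin (Real.pi * w)) Real.pi 0 := by
    have := ((hasDerivAt_id (0 : ℂ)).const_mul (Real.pi : ℂ)).csin
    simpa using this
  rw [sinRatio, dslope_same, h.deriv, sub_zero, dslope_of_ne _ one_ne_zero, slope_def_field]
  simp

theorem differentiable_sinRatio : Differentiable ℂ sinRatio := by
  have h : Differentiable ℂ (dslope (fun w : ℂ => sin (Real.pi * w)) 0) := by
    rw [← differentiableOn_univ, Complex.differentiableOn_dslope univ_mem]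
    fun_prop
  exact h.add (h.comp (by fun_prop))

theorem norm_sin_le (z : ℂ) : ‖sin z‖ ≤ Real.exp |z.im| := by
  rw [Complex.sin]
  have h1 : ‖exp (-z * I)‖ ≤ Real.exp |z.im| := by
    rw [Complex.norm_exp]
    simpa using le_abs_self z.im
  have h2 : ‖exp (z * I)‖ ≤ Real.exp |z.im| := by
    rw [Complex.norm_exp]
    simpa using neg_le_abs z.im
  have h3 := norm_sub_le (exp (-z * I)) (exp (z * I))
  rw [norm_div, norm_mul, norm_I, mul_one, Complex.norm_ofNat]
  linarith

/-- The factor `1 / (Im z)²` comes from the denominator `z (1 - z)`; it is exactly the extra decay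
that `periodic_strip_eq_integral` requires. -/
theorem norm_sinRatio_le {z : ℂ} (hz : 1 ≤ |z.im|) :
    ‖sinRatio z‖ ≤ Real.exp (Real.pi * |z.im|) / z.im ^ 2 := by
  have h := congrArg norm (mul_sinRatio z)
  rw [norm_mul, norm_mul] at h
  have h1 : ‖sin (Real.pi * z)‖ ≤ Real.exp (Real.pi * |z.im|) := by
    refine (norm_sin_le _).trans_eq ?_
    simp [abs_mul, abs_of_pos Real.pi_pos]
  have h2 := Complex.abs_im_le_norm z
  have h3 : |z.im| ≤ ‖1 - z‖ := by simpa using Complex.abs_im_le_norm (1 - z)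
  have hsq : 0 < z.im ^ 2 := by rw [← sq_abs]; positivity
  rw [le_div_iff₀ hsq, ← sq_abs]
  calc ‖sinRatio z‖ * |z.im| ^ 2 = |z.im| * |z.im| * ‖sinRatio z‖ := by ring
    _ ≤ ‖z‖ * ‖1 - z‖ * ‖sinRatio z‖ := by gcongr
    _ ≤ _ := h.le.trans h1

/-- The parametrization that makes the kernel of the limit equation vanish at
`(param m z, param m (-z))`. -/
noncomputable def param (m : ℝ) (z : ℂ) : ℂ := z * (1 - z) / (2 * m)

theorem param_re {m : ℝ} (z : ℂ) :
    (param m z).re = (z.re * (1 - z.re) + z.im ^ 2) / (2 * m) := by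
  have : param m z = z * (1 - z) / ((2 * m : ℝ) : ℂ) := by rw [param]; push_cast; rfl
  rw [this, Complex.div_ofReal_re]
  congr 1
  simp
  ring

theorem param_one_sub (m : ℝ) (z : ℂ) : param m (1 - z) = param m z := by
  rw [param, param]; ring

theorem param_re_nonneg {m : ℝ} (hm : 0 < m) {z : ℂ} (h0 : 0 ≤ z.re) (h1 : z.re ≤ 1) :
    0 ≤ (param m z).re := by
  rw [param_re]
  have := mul_nonneg h0 (sub_nonneg.2 h1)
  positivity

theorem param_re_pos {m : ℝ} (hm : 0 < m) {z : ℂ} (h0 : 0 < z.re) (h1 : z.re < 1) :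
    0 < (param m z).re := by
  rw [param_re]
  have := mul_pos h0 (sub_pos.2 h1)
  positivity

namespace LimitEquation

variable {m : ℝ} {Q : Measure (ℝ × ℝ)} {g₁ g₂ : ℂ → ℂ}

theorem left_zero' [IsProbabilityMeasure Q] (h : LimitEquation m Q g₁ g₂) : g₂ 0 = 1 :=
  have : IsProbabilityMeasure (Q.map Prod.swap) :=
    Measure.isProbabilityMeasure_map measurable_swap.aemeasurable
  h.swap.left_zero

/-- At `z = ib` both `param m z` and `param m (-z)` lie in the closed right half-plane and
annihilate the kernel, so `(1 - z) g₁(param m (-z)) = (1 + z) g₂(param m z)`. Here `param m (-z) =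
param m (1 + z)`, and the factor `sinRatio` is chosen so that `(1 + z) sinRatio (1 + z) = (1 - z)
sinRatio z` absorbs the rational factors. -/
theorem boundary_relation [IsProbabilityMeasure Q] (hm : 0 < m) (h : LimitEquation m Q g₁ g₂)
    (b : ℝ) : sinRatio (1 + b * I) * g₁ (param m (1 + b * I)) =
      sinRatio (b * I) * g₂ (param m (b * I)) := by
  -- The kernel argument divides by `ib`; at `b = 0` both sides are `sinRatio 0`, because `g₁(0) =
  -- g₂(0) = 1`.
  rcases eq_or_ne b 0 with rfl | hb
  · have h1 := sinRatio_one_sub 0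
    rw [sub_zero] at h1
    simp [param, h.left_zero, h.left_zero', h1]
  have hm' : (m : ℂ) ≠ 0 := by exact_mod_cast hm.ne'
  have hb' : (b : ℂ) ≠ 0 := by exact_mod_cast hb
  have hp : param m (1 + b * I) = param m (-(b * I)) := by
    rw [← param_one_sub]; congr 1; ring
  have hre1 : 0 ≤ (param m (b * I)).re := param_re_nonneg hm (by simp) (by simp)
  have hre2 : 0 ≤ (param m (-(b * I))).re := by
    rw [← hp]; exact param_re_nonneg hm (by simp) (by simp)
  have h1 := h.eq _ _ hre1 hre2
  have hker : param m (b * I) + param m (-(b * I)) +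
      m * (param m (b * I) - param m (-(b * I))) ^ 2 = 0 := by
    rw [param, param]
    field_simp
    ring_nf
  rw [hker, zero_mul] at h1
  have h2 : (1 - b * I) * g₁ (param m (-(b * I))) = (1 + b * I) * g₂ (param m (b * I)) := by
    have h3 : (b * I) / (2 * m) * ((1 - b * I) * g₁ (param m (-(b * I)))) =
        (b * I) / (2 * m) * ((1 + b * I) * g₂ (param m (b * I))) := by
      have e1 : param m (b * I) = b * I * (1 - b * I) / (2 * m) := rfl
      have e2 : param m (-(b * I)) = -(b * I) * (1 - -(b * I)) / (2 * m) := rfl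
      linear_combination -h1 - e1 * g₁ (param m (-(b * I))) - e2 * g₂ (param m (b * I))
    exact mul_left_cancel₀ (by simp [hb', hm']) h3
  have hsin1 := mul_sinRatio (1 + b * I)
  have hsin2 := mul_sinRatio (b * I)
  have hsin3 : sin (Real.pi * (1 + b * I)) = -sin (Real.pi * (b * I)) := by
    rw [mul_add, mul_one, add_comm, Complex.sin_add_pi]
  have h4 : (1 + b * I) * sinRatio (1 + b * I) = (1 - b * I) * sinRatio (b * I) := by
    refine mul_left_cancel₀ (a := -(b * I)) (by simp [hb']) ?_
    linear_combination hsin1 + hsin3 + hsin2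
  have hn1 : (1 + b * I : ℂ) ≠ 0 := fun h => by simpa using congrArg re h
  have hn2 : (1 - b * I : ℂ) ≠ 0 := fun h => by simpa using congrArg re h
  rw [hp]
  refine mul_left_cancel₀ (mul_ne_zero hn1 hn2) ?_
  linear_combination (1 - b * I) * g₁ (param m (-(b * I))) * h4 + (1 - b * I) * sinRatio (b * I) * h2

theorem continuousOn_strip [IsProbabilityMeasure Q] (hm : 0 < m) (h : LimitEquation m Q g₁ g₂) :
    ContinuousOn (fun z => sinRatio z * g₁ (param m z)) {z | 0 ≤ z.re ∧ z.re ≤ 1} := by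
  refine differentiable_sinRatio.continuous.continuousOn.mul
    (h.continuousOn_left.comp ?_ fun z hz => param_re_nonneg hm hz.1 hz.2)
  unfold param
  fun_prop

theorem differentiableOn_strip [IsProbabilityMeasure Q] (hm : 0 < m)
    (h : LimitEquation m Q g₁ g₂) :
    DifferentiableOn ℂ (fun z => sinRatio z * g₁ (param m z)) {z | 0 < z.re ∧ z.re < 1} := by
  refine differentiable_sinRatio.differentiableOn.mul
    (h.differentiableOn_left.comp ?_ fun z hz => param_re_pos hm hz.1 hz.2)
  unfold param
  fun_prop

theorem exists_bound_strip (hm : 0 < m) (h : LimitEquation m Q g₁ g₂) :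
    ∃ B : ℝ, 0 ≤ B ∧ ∀ z : ℂ, 0 ≤ z.re → z.re ≤ 1 → 1 ≤ |z.im| →
      ‖sinRatio z * g₁ (param m z)‖ ≤ B * Real.exp (Real.pi * |z.im|) / z.im ^ 2 := by
  obtain ⟨B, hB⟩ := h.bounded_left
  refine ⟨B, (norm_nonneg _).trans (hB 0 (by simp)), fun z h0 h1 hz => ?_⟩
  rw [norm_mul]
  calc _ ≤ Real.exp (Real.pi * |z.im|) / z.im ^ 2 * B := by
        gcongr
        · exact norm_sinRatio_le hz
        · exact hB _ (param_re_nonneg hm h0 h1)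
    _ = _ := by ring

end LimitEquation

end LimitEquation

/-! ### Solution and uniqueness of the limit equation -/

namespace LimitEquation

open Complex

variable {m : ℝ} {Q Q' : Measure (ℝ × ℝ)} {g₁ g₂ g₁' g₂' : ℂ → ℂ}

theorem isProbabilityMeasure_swap [IsProbabilityMeasure Q] :
    IsProbabilityMeasure (Q.map Prod.swap) :=
  Measure.isProbabilityMeasure_map measurable_swap.aemeasurable

/-- Passing from `z` to `z + 1` exchanges the two boundary functions, so their difference is
antiperiodic. The factor `exp (iπz)` makes it periodic, at the price of growth `exp (2π |Im z|)` at
the lower end, still admissible for `periodic_strip_eq_integral`. Hence the product is constant. -/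
theorem strip_left_eq_right [IsProbabilityMeasure Q] (hm : 0 < m) (h : LimitEquation m Q g₁ g₂)
    {z : ℂ} (h0 : 0 ≤ z.re) (h1 : z.re ≤ 1) :
    sinRatio z * g₁ (param m z) = sinRatio z * g₂ (param m z) := by
  have := isProbabilityMeasure_swap (Q := Q)
  obtain ⟨B₁, hB₁, hF₁⟩ := h.exists_bound_strip hm
  obtain ⟨B₂, hB₂, hF₂⟩ := h.swap.exists_bound_strip hm
  set F₁ : ℂ → ℂ := fun z => sinRatio z * g₁ (param m z) with hF₁d
  set F₂ : ℂ → ℂ := fun z => sinRatio z * g₂ (param m z) with hF₂d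
  set E : ℂ → ℂ := fun z => (F₁ z - F₂ z) * exp (Real.pi * I * z) with hE
  have hnorm : ∀ z : ℂ, 0 ≤ z.re → z.re ≤ 1 → 1 ≤ |z.im| →
      ‖E z‖ ≤ (B₁ + B₂) * Real.exp (Real.pi * (|z.im| - z.im)) / z.im ^ 2 := by
    intro z h0 h1 hz
    have h2 : ‖exp (Real.pi * I * z)‖ = Real.exp (-(Real.pi * z.im)) := by
      rw [Complex.norm_exp]; simp
    rw [hE]
    simp only [norm_mul, h2]
    calc _ ≤ (B₁ * Real.exp (Real.pi * |z.im|) / z.im ^ 2 +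
          B₂ * Real.exp (Real.pi * |z.im|) / z.im ^ 2) * Real.exp (-(Real.pi * z.im)) := by
          gcongr
          exact (norm_sub_le _ _).trans (add_le_add (hF₁ z h0 h1 hz) (hF₂ z h0 h1 hz))
      _ = _ := by
          rw [mul_sub, sub_eq_add_neg, Real.exp_add]; ring
  have hconst : ∀ z : ℂ, 0 ≤ z.re → z.re ≤ 1 → E z = ∫ a : ℝ in (0 : ℝ)..1, E a := by
    intro z h0 h1
    refine periodic_strip_eq_integral (C := B₁ + B₂) ?_ ?_ ?_ ?_ h0 h1
    · exact ((h.continuousOn_strip hm).sub (h.swap.continuousOn_strip hm)).mul (by fun_prop)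
    · exact ((h.differentiableOn_strip hm).sub (h.swap.differentiableOn_strip hm)).mul (by fun_prop)
    · intro b
      have e1 : F₁ (1 + b * I) = F₂ (b * I) := h.boundary_relation hm b
      have e2 : F₂ (1 + b * I) = F₁ (b * I) := h.swap.boundary_relation hm b
      have e3 : exp (Real.pi * I * (1 + b * I)) = -exp (Real.pi * I * (b * I)) := by
        rw [mul_add, Complex.exp_add, mul_one, Complex.exp_pi_mul_I, neg_one_mul]
      simp only [hE, e1, e2, e3]
      ring
    · intro z h0 h1 hz
      refine (hnorm z h0 h1 hz).trans ?_
      gcongr _ * Real.exp ?_ / _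
      nlinarith [Real.pi_pos, neg_abs_le z.im]
  -- At the upper end `exp (iπz)` cancels the growth `exp (π Im z)`, so that `E` is `O(1 / (Im z)²)`
  -- there and the constant is zero.
  have hzero : ∫ a : ℝ in (0 : ℝ)..1, E a = 0 := by
    have hlim : Tendsto (fun b : ℝ => (B₁ + B₂) / b ^ 2) atTop (𝓝 0) :=
      tendsto_const_nhds.div_atTop (tendsto_pow_atTop two_ne_zero)
    refine norm_le_zero_iff.1 (ge_of_tendsto hlim ?_)
    filter_upwards [eventually_ge_atTop 1] with b hb
    have hb0 : |b| = b := abs_of_nonneg (by linarith)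
    rw [← hconst (b * I) (by simp) (by simp)]
    refine (hnorm (b * I) (by simp) (by simp) (by simpa [hb0] using hb)).trans_eq ?_
    simp [hb0]
  have := hconst z h0 h1
  rw [hzero, hE] at this
  exact sub_eq_zero.1 ((mul_eq_zero.1 this).resolve_right (Complex.exp_ne_zero _))

/-- The boundary transforms of the limit law are `z ↦ π z (1 - z) / sin (π z)` in the
parametrization `param`. -/
theorem sinRatio_mul_left [IsProbabilityMeasure Q] (hm : 0 < m) (h : LimitEquation m Q g₁ g₂)
    {z : ℂ} (h0 : 0 ≤ z.re) (h1 : z.re ≤ 1) : sinRatio z * g₁ (param m z) = Real.pi := by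
  have := isProbabilityMeasure_swap (Q := Q)
  obtain ⟨B, hB, hF⟩ := h.exists_bound_strip hm
  have hconst : ∀ z : ℂ, 0 ≤ z.re → z.re ≤ 1 → sinRatio z * g₁ (param m z) =
      ∫ a : ℝ in (0 : ℝ)..1, sinRatio a * g₁ (param m a) := by
    intro z h0 h1
    refine periodic_strip_eq_integral (C := B) (h.continuousOn_strip hm)
      (h.differentiableOn_strip hm) (fun b => ?_) (fun z h0 h1 hz => ?_) h0 h1
    · rw [h.boundary_relation hm b, h.strip_left_eq_right hm (by simp) (by simp)]
    · refine (hF z h0 h1 hz).trans ?_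
      gcongr _ * Real.exp ?_ / _
      nlinarith [Real.pi_pos, abs_nonneg z.im]
  rw [hconst z h0 h1, ← hconst 0 (by simp) (by simp), sinRatio_zero]
  simp [param, h.left_zero]

/-- Roots of `z (1 - z) = 2mt`: real ones in `[0, 1/2]` while `t ≤ 1 / (8m)`, and on the line `Re z
= 1/2` beyond. -/
theorem exists_param_eq (hm : 0 < m) {t : ℝ} (ht : 0 < t) :
    ∃ z : ℂ, 0 ≤ z.re ∧ z.re ≤ 1 ∧ param m z = t := by
  have hm' : (m : ℂ) ≠ 0 := by exact_mod_cast hm.ne'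
  have hmt : 0 < m * t := mul_pos hm ht
  rcases le_total 0 (1 / 4 - 2 * (m * t)) with h | h
  · have h1 : √(1 / 4 - 2 * (m * t)) ≤ 1 / 2 := by
      rw [Real.sqrt_le_left (by norm_num)]; linarith
    have h2 := Real.sq_sqrt h
    have h3 : ((√(1 / 4 - 2 * (m * t)) : ℝ) : ℂ) ^ 2 = 1 / 4 - 2 * (m * t) := by
      rw [← ofReal_pow, h2]
      push_cast
      rfl
    refine ⟨((1 / 2 - √(1 / 4 - 2 * (m * t)) : ℝ) : ℂ), ?_, ?_, ?_⟩
    · rw [ofReal_re]; linarith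
    · rw [ofReal_re]; linarith [Real.sqrt_nonneg (1 / 4 - 2 * (m * t))]
    · rw [param, div_eq_iff (by simpa using hm')]
      push_cast
      linear_combination -h3
  · have h2 := Real.sq_sqrt (x := -(1 / 4 - 2 * (m * t))) (by linarith)
    have h3 : ((√(-(1 / 4 - 2 * (m * t))) : ℝ) : ℂ) ^ 2 = -(1 / 4 - 2 * (m * t)) := by
      rw [← ofReal_pow, h2]
      push_cast
      rfl
    refine ⟨((1 / 2 : ℝ) : ℂ) + (√(-(1 / 4 - 2 * (m * t))) : ℝ) * I, ?_, ?_, ?_⟩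
    · rw [add_re, ofReal_re, re_ofReal_mul, I_re]; norm_num
    · rw [add_re, ofReal_re, re_ofReal_mul, I_re]; norm_num
    · rw [param, div_eq_iff (by simpa using hm')]
      push_cast
      linear_combination h3 - ((√(-(1 / 4 - 2 * (m * t))) : ℝ) : ℂ) ^ 2 * I_sq

/-- The explicit formula gives equality on the positive real axis; the identity theorem extends it
to the open half-plane and continuity to its closure. -/
theorem left_unique [IsProbabilityMeasure Q] [IsProbabilityMeasure Q'] (hm : 0 < m)
    (h : LimitEquation m Q g₁ g₂) (h' : LimitEquation m Q' g₁' g₂') {z : ℂ} (hz : 0 ≤ z.re) :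
    g₁ z = g₁' z := by
  have hreal : ∀ t : ℝ, 0 < t → g₁ t = g₁' t := by
    intro t ht
    obtain ⟨z, h0, h1, hzt⟩ := exists_param_eq hm ht
    have e1 := h.sinRatio_mul_left hm h0 h1
    have e2 := h'.sinRatio_mul_left hm h0 h1
    rw [hzt] at e1 e2
    -- A zero of `sinRatio` is impossible here, since its product with `g₁` is `π`.
    have hne : sinRatio z ≠ 0 := by
      intro h3
      rw [h3, zero_mul] at e1
      exact Real.pi_ne_zero (by exact_mod_cast e1.symm)
    exact mul_left_cancel₀ hne (e1.trans e2.symm)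
  have hopen : IsOpen {z : ℂ | 0 < z.re} := isOpen_lt continuous_const continuous_re
  have hinter : Set.EqOn g₁ g₁' {z : ℂ | 0 < z.re} := by
    refine AnalyticOnNhd.eqOn_of_preconnected_of_frequently_eq
      (h.differentiableOn_left.analyticOnNhd hopen) (h'.differentiableOn_left.analyticOnNhd hopen)
      (convex_halfSpace_re_gt 0).isPreconnected (z₀ := 1) (by simp) ?_
    have hlim : Tendsto (fun n : ℕ => ((1 + 1 / ((n : ℝ) + 1) : ℝ) : ℂ)) atTop (𝓝[≠] 1) := by
      refine tendsto_nhdsWithin_iff.2 ⟨?_, Eventually.of_forall fun n => ?_⟩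
      · have := (tendsto_one_div_add_atTop_nhds_zero_nat (𝕜 := ℝ)).const_add 1
        rw [add_zero] at this
        exact_mod_cast (Complex.continuous_ofReal.tendsto 1).comp this
      · have : (0 : ℝ) < 1 / ((n : ℝ) + 1) := by positivity
        intro h
        have h1 := congrArg re h
        rw [ofReal_re, one_re] at h1
        linarith
    exact hlim.frequently (Frequently.of_forall fun n => hreal _ (by positivity))
  have hw : ∀ n : ℕ, 0 < (z + 1 / ((n : ℂ) + 1)).re := by
    intro n
    have : (1 / ((n : ℂ) + 1)) = ((1 / ((n : ℝ) + 1) : ℝ) : ℂ) := by push_cast; rfl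
    rw [this, add_re, ofReal_re]
    positivity
  have hlim : Tendsto (fun n : ℕ => z + 1 / ((n : ℂ) + 1)) atTop (𝓝[{z | 0 ≤ z.re}] z) := by
    refine tendsto_nhdsWithin_iff.2 ⟨?_, Eventually.of_forall fun n => (hw n).le⟩
    simpa using (tendsto_one_div_add_atTop_nhds_zero_nat (𝕜 := ℂ)).const_add z
  have e1 := ((h.continuousOn_left z hz).tendsto.comp hlim)
  have e2 := ((h'.continuousOn_left z hz).tendsto.comp hlim)
  refine tendsto_nhds_unique e1 (e2.congr fun n => ?_)
  exact (hinter (hw n)).symm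

/-- At imaginary arguments the Laplace transform is the characteristic function, and the equation
recovers it from `g₁` and `g₂` wherever the kernel is nonzero. -/
theorem measure_unique [IsProbabilityMeasure Q] [IsProbabilityMeasure Q'] (hm : 0 < m)
    (h : LimitEquation m Q g₁ g₂) (h' : LimitEquation m Q' g₁' g₂') : Q = Q' := by
  have := isProbabilityMeasure_swap (Q := Q)
  have := isProbabilityMeasure_swap (Q := Q')
  have hlap : ∀ s t : ℝ, lap Q (-(s * I)) (-(t * I)) = lap Q' (-(s * I)) (-(t * I)) := by
    intro s t
    have e1 := h.eq (-(s * I)) (-(t * I)) (by simp) (by simp)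
    have e2 := h'.eq (-(s * I)) (-(t * I)) (by simp) (by simp)
    rw [← h.left_unique hm h' (by simp), ← h.swap.left_unique hm h'.swap (by simp), ← e1] at e2
    -- On the imaginary axes the kernel is `-m (s - t)² - i (s + t)`, which vanishes only at the
    -- origin, where both transforms are `1`.
    rcases eq_or_ne (-(s * I) + -(t * I) + m * (-(s * I) - -(t * I)) ^ 2 : ℂ) 0 with h0 | h0
    · have him := congrArg im h0
      have hre := congrArg re h0
      simp [pow_two] at him hre
      have hst : s = t := by
        rcases hre with h | h
        · exact absurd h hm.ne'
        · linarith
      have hs : s = 0 := by linarith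
      rw [← hst, hs]
      simp [lap_zero_zero]
    · exact (mul_left_cancel₀ h0 e2).symm
  refine Measure.ext_of_charFunDual (funext fun L => ?_)
  have hL : ∀ M : Measure (ℝ × ℝ),
      charFunDual M L = lap M (-((L (1, 0) : ℝ) * I)) (-((L (0, 1) : ℝ) * I)) := by
    intro M
    rw [charFunDual_apply, lap]
    congr 1
    ext v
    congr 1
    have hv : v = v.1 • ((1, 0) : ℝ × ℝ) + v.2 • ((0, 1) : ℝ × ℝ) := by ext <;> simp
    conv_lhs => rw [hv, map_add, map_smul, map_smul]
    push_cast
    simp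
    ring
  rw [hL, hL, hlap]

end LimitEquation

/-! ### Moments from Laplace transforms by monotone convergence -/

section Monotone

/-- Monotone convergence in a form that delivers integrability of the limit together with its
integral, so that moments need not be known finite beforehand. -/
theorem integral_eq_of_monotone_limit {Ω : Type*} [MeasurableSpace Ω] {μ : Measure Ω}
    {f : ℕ → Ω → ℝ} {F : Ω → ℝ} {σ : ℝ} (hf : ∀ n, Integrable (f n) μ)
    (hnonneg : ∀ᵐ x ∂μ, ∀ n, 0 ≤ f n x) (hmono : ∀ᵐ x ∂μ, Monotone fun n => f n x)
    (hlim : ∀ᵐ x ∂μ, Tendsto (fun n => f n x) atTop (𝓝 (F x))) (hF : AEStronglyMeasurable F μ)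
    (hσ : Tendsto (fun n => ∫ x, f n x ∂μ) atTop (𝓝 σ)) :
    Integrable F μ ∧ ∫ x, F x ∂μ = σ := by
  have hnonneg' : ∀ n, 0 ≤ᵐ[μ] f n := fun n => by filter_upwards [hnonneg] with x hx using hx n
  have hF0 : 0 ≤ᵐ[μ] F := by
    filter_upwards [hnonneg, hlim] with x h0 h1 using ge_of_tendsto' h1 h0
  have hσ0 : 0 ≤ σ := ge_of_tendsto' hσ fun n => integral_nonneg_of_ae (hnonneg' n)
  have h1 : Tendsto (fun n => ∫⁻ x, ENNReal.ofReal (f n x) ∂μ) atTop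
      (𝓝 (∫⁻ x, ENNReal.ofReal (F x) ∂μ)) := by
    refine lintegral_tendsto_of_tendsto_of_monotone
      (fun n => (hf n).aestronglyMeasurable.aemeasurable.ennreal_ofReal) ?_ ?_
    · filter_upwards [hmono] with x hx n k hnk using ENNReal.ofReal_le_ofReal (hx hnk)
    · filter_upwards [hlim] with x hx using (ENNReal.continuous_ofReal.tendsto _).comp hx
  have h2 : Tendsto (fun n => ∫⁻ x, ENNReal.ofReal (f n x) ∂μ) atTop (𝓝 (ENNReal.ofReal σ)) := by
    refine ((ENNReal.continuous_ofReal.tendsto _).comp hσ).congr fun n => ?_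
    exact ofReal_integral_eq_lintegral_ofReal (hf n) (hnonneg' n)
  have h3 := tendsto_nhds_unique h1 h2
  refine ⟨⟨hF, ?_⟩, ?_⟩
  · rw [hasFiniteIntegral_iff_ofReal hF0, h3]
    exact ENNReal.ofReal_lt_top
  · rw [integral_eq_lintegral_of_nonneg_ae hF0 hF, h3, ENNReal.toReal_ofReal hσ0]

/-- Difference quotient at `0` of `t ↦ 1 - exp (-t x)`. -/
noncomputable def expQuot (t x : ℝ) : ℝ := (1 - Real.exp (-(t * x))) / t

theorem expQuot_nonneg {t x : ℝ} (ht : 0 < t) (hx : 0 ≤ x) : 0 ≤ expQuot t x := by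
  have : Real.exp (-(t * x)) ≤ 1 := Real.exp_le_one_iff.2 (by nlinarith)
  exact div_nonneg (by linarith) ht.le

/-- Convexity of `exp` between `0` and `-tx`, with weights `1 - s/t` and `s/t`. -/
theorem expQuot_anti {s t x : ℝ} (hs : 0 < s) (hst : s ≤ t) : expQuot t x ≤ expQuot s x := by
  have ht : 0 < t := hs.trans_le hst
  have h := convexOn_exp.2 (Set.mem_univ 0) (Set.mem_univ (-(t * x)))
    (sub_nonneg.2 ((div_le_one ht).2 hst)) (div_pos hs ht).le (by ring)
  have h1 : (1 - s / t) • 0 + (s / t) • (-(t * x)) = -(s * x) := by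
    simp only [smul_eq_mul, mul_zero, zero_add]
    field_simp
  rw [h1, Real.exp_zero] at h
  simp only [smul_eq_mul, mul_one] at h
  rw [expQuot, expQuot, le_div_iff₀ hs]
  calc (1 - Real.exp (-(t * x))) / t * s = s / t * (1 - Real.exp (-(t * x))) := by ring
    _ ≤ _ := by linarith

theorem tendsto_expQuot (x : ℝ) : Tendsto (fun t => expQuot t x) (𝓝[>] 0) (𝓝 x) := by
  have h : HasDerivAt (fun t : ℝ => 1 - Real.exp (-(t * x))) x 0 := by
    have := (((hasDerivAt_id (0 : ℝ)).mul_const x).neg.exp).const_sub 1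
    simpa using this
  have h1 := h.tendsto_slope_zero_right
  refine h1.congr fun t => ?_
  simp [expQuot, div_eq_inv_mul]

end Monotone

/-! ### Expansion of `x / sin x` at zero -/

section Asymptotics

theorem tendsto_sin_div_cube :
    Tendsto (fun x : ℝ => (x - Real.sin x) / x ^ 3) (𝓝[>] 0) (𝓝 (1 / 6)) := by
  have h : Tendsto (fun x : ℝ => x ^ 2 / 100) (𝓝[>] 0) (𝓝 0) := by
    have : Tendsto (fun x : ℝ => x ^ 2 / 100) (𝓝 0) (𝓝 (0 ^ 2 / 100)) :=
      (by fun_prop : Continuous fun x : ℝ => x ^ 2 / 100).tendsto 0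
    simpa using this.mono_left nhdsWithin_le_nhds
  rw [tendsto_iff_dist_tendsto_zero]
  refine squeeze_zero' (Eventually.of_forall fun _ => dist_nonneg) ?_ h
  filter_upwards [Ioc_mem_nhdsGT one_pos] with x hx
  have hx0 : 0 < x := hx.1
  have h1 := Real.sin_bound (x := x) (by rw [abs_of_pos hx0]; exact hx.2)
  rw [abs_of_pos hx0] at h1
  have h2 : (x - Real.sin x) / x ^ 3 - 1 / 6 = -(Real.sin x - (x - x ^ 3 / 6)) / x ^ 3 := by
    field_simp
    ring
  rw [Real.dist_eq, h2, abs_div, abs_neg, abs_of_pos (by positivity : 0 < x ^ 3),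
    div_le_iff₀ (by positivity)]
  calc _ ≤ x ^ 5 / 100 := h1
    _ = _ := by ring

theorem tendsto_div_sin :
    Tendsto (fun x : ℝ => x / Real.sin x) (𝓝[>] 0) (𝓝 1) := by
  have h : Tendsto (fun t : ℝ => t⁻¹ * Real.sin t) (𝓝[>] 0) (𝓝 1) := by
    simpa using (Real.hasDerivAt_sin 0).tendsto_slope_zero_right
  have h1 := h.inv₀ one_ne_zero
  rw [inv_one] at h1
  refine h1.congr fun x => ?_
  rw [mul_inv, inv_inv, div_eq_mul_inv]

theorem tendsto_div_sin_sub_one_div_sq :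
    Tendsto (fun x : ℝ => (x / Real.sin x - 1) / x ^ 2) (𝓝[>] 0) (𝓝 (1 / 6)) := by
  have h := tendsto_sin_div_cube.mul tendsto_div_sin
  rw [mul_one] at h
  refine h.congr' ?_
  filter_upwards [Ioo_mem_nhdsGT Real.pi_pos] with x hx
  have hs : Real.sin x ≠ 0 := (Real.sin_pos_of_pos_of_lt_pi hx.1 hx.2).ne'
  have hx0 : x ≠ 0 := hx.1.ne'
  field_simp

/-- Second-order expansion behind the cross moment of the limit law. -/
theorem tendsto_cross_moment {m : ℝ} (hm : 0 < m) :
    Tendsto (fun x : ℝ => (1 - 2 / (1 + m * (x * (1 - x) / (2 * m))) +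
        Real.pi * x * (1 - x) / Real.sin (Real.pi * x)) / (x * (1 - x) / (2 * m)) ^ 2)
      (𝓝[>] 0) (𝓝 (2 * m ^ 2 * (Real.pi ^ 2 / 3 - 3))) := by
  have hpi : Tendsto (fun x : ℝ => Real.pi * x) (𝓝[>] 0) (𝓝[>] 0) := by
    refine tendsto_nhdsWithin_iff.2 ⟨?_, ?_⟩
    · have : Tendsto (fun x : ℝ => Real.pi * x) (𝓝 0) (𝓝 (Real.pi * 0)) :=
        (by fun_prop : Continuous fun x : ℝ => Real.pi * x).tendsto 0
      simpa using this.mono_left nhdsWithin_le_nhds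
    · filter_upwards [self_mem_nhdsWithin] with x hx using mul_pos Real.pi_pos hx
  have h1 := tendsto_div_sin_sub_one_div_sq.comp hpi
  have h2 : Tendsto (fun x : ℝ => x) (𝓝[>] 0) (𝓝 0) := tendsto_id.mono_left nhdsWithin_le_nhds
  -- With `w = x (1 - x)` the rational part is `2 - x - 4 / (2 + w) = -x² - w² / (2 + w)`. The
  -- first-order terms have cancelled, so `x²` can be divided out before passing to the limit.
  have h3 : Tendsto (fun x : ℝ => 4 * m ^ 2 / (1 - x) ^ 2 *
      (-1 - (1 - x) ^ 2 / (2 + x * (1 - x)) + (1 - x) * (Real.pi ^ 2 *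
        ((Real.pi * x / Real.sin (Real.pi * x) - 1) / (Real.pi * x) ^ 2)))) (𝓝[>] 0)
      (𝓝 (4 * m ^ 2 / (1 - 0) ^ 2 *
      (-1 - (1 - 0) ^ 2 / (2 + 0 * (1 - 0)) + (1 - 0) * (Real.pi ^ 2 * (1 / 6))))) := by
    refine Tendsto.mul ?_ ?_
    · exact (tendsto_const_nhds.div ((h2.const_sub 1).pow 2) (by norm_num))
    · refine Tendsto.add ?_ (Tendsto.mul (h2.const_sub 1) (h1.const_mul _))
      exact tendsto_const_nhds.sub (((h2.const_sub 1).pow 2).div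
        ((h2.mul (h2.const_sub 1)).const_add 2) (by norm_num))
  have h4 : 4 * m ^ 2 / (1 - 0) ^ 2 *
      (-1 - (1 - 0) ^ 2 / (2 + 0 * (1 - 0)) + (1 - 0) * (Real.pi ^ 2 * (1 / 6))) =
      2 * m ^ 2 * (Real.pi ^ 2 / 3 - 3) := by ring
  rw [h4] at h3
  refine h3.congr' ?_
  filter_upwards [Ioo_mem_nhdsGT one_pos] with x hx
  have hx0 : x ≠ 0 := hx.1.ne'
  have hx1 : 1 - x ≠ 0 := (sub_pos.2 hx.2).ne'
  have hs : Real.sin (Real.pi * x) ≠ 0 := by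
    refine (Real.sin_pos_of_pos_of_lt_pi (mul_pos Real.pi_pos hx.1) ?_).ne'
    nlinarith [Real.pi_pos, hx.2]
  have hw : 2 + x * (1 - x) ≠ 0 := by
    have := mul_pos hx.1 (sub_pos.2 hx.2)
    positivity
  have hm0 : m ≠ 0 := hm.ne'
  have hw' : 1 + m * (x * (1 - x) / (2 * m)) = (2 + x * (1 - x)) / 2 := by
    field_simp
  rw [hw']
  have hpi0 := Real.pi_ne_zero
  generalize Real.sin (Real.pi * x) = s at hs ⊢
  field_simp
  ring

end Asymptotics

/-! ### Moments and correlation of the limit law -/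

namespace LimitEquation

variable {m : ℝ} {Q : Measure (ℝ × ℝ)} {g₁ g₂ : ℂ → ℂ}

theorem integral_exp_fst [IsProbabilityMeasure Q] (hm : 0 < m) (h : LimitEquation m Q g₁ g₂)
    {t : ℝ} (ht : 0 < t) : ∫ v, Real.exp (-(t * v.1)) ∂Q = 1 / (1 + m * t) := by
  have h1 := h.mul_lap_left ht
  rw [h.left_zero] at h1
  have h2 := lap_ofReal Q t 0
  rw [Complex.ofReal_zero] at h2
  rw [h2] at h1
  have h3 : (1 + m * t) * ∫ v : ℝ × ℝ, Real.exp (-(t * v.1 + 0 * v.2)) ∂Q = 1 := by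
    exact_mod_cast h1
  simp only [zero_mul, add_zero] at h3
  rw [eq_div_iff (by positivity), mul_comm, h3]

/-- On the diagonal the kernel is `2t`, so the transform is the average of `g₁(t)` and `g₂(t)`, both
known in the parametrization `t = x (1 - x) / (2m)`. -/
theorem integral_exp_add [IsProbabilityMeasure Q] (hm : 0 < m) (h : LimitEquation m Q g₁ g₂)
    {x : ℝ} (hx0 : 0 < x) (hx1 : x < 1) :
    ∫ v, Real.exp (-(x * (1 - x) / (2 * m) * (v.1 + v.2))) ∂Q =
      Real.pi * x * (1 - x) / Real.sin (Real.pi * x) := by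
  set t : ℝ := x * (1 - x) / (2 * m) with ht
  have ht0 : 0 < t := by
    have := mul_pos hx0 (sub_pos.2 hx1)
    positivity
  have hp : param m x = t := by rw [param, ht]; push_cast; rfl
  have e1 := h.sinRatio_mul_left (z := x) hm (by simpa using hx0.le) (by simpa using hx1.le)
  have e2 := h.strip_left_eq_right (z := x) hm (by simpa using hx0.le) (by simpa using hx1.le)
  rw [hp] at e1 e2
  have e3 := mul_sinRatio x
  have e4 := h.eq t t (by simpa using ht0.le) (by simpa using ht0.le)
  have ht' : (t : ℂ) ≠ 0 := by exact_mod_cast ht0.ne'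
  have hlap : Complex.sin (Real.pi * x) * lap Q t t = Real.pi * x * (1 - x) := by
    refine mul_left_cancel₀ (mul_ne_zero two_ne_zero ht') ?_
    linear_combination -2 * t * lap Q t t * e3 + x * (1 - x) * sinRatio x * e4 +
      2 * t * x * (1 - x) * e1 - t * x * (1 - x) * e2
  rw [lap_ofReal] at hlap
  have h3 : Real.sin (Real.pi * x) * ∫ v : ℝ × ℝ, Real.exp (-(t * v.1 + t * v.2)) ∂Q =
      Real.pi * x * (1 - x) := by exact_mod_cast hlap
  have hs : Real.sin (Real.pi * x) ≠ 0 := by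
    refine (Real.sin_pos_of_pos_of_lt_pi (mul_pos Real.pi_pos hx0) ?_).ne'
    nlinarith [Real.pi_pos]
  rw [eq_div_iff hs, mul_comm, ← h3]
  simp [mul_add]

theorem integrable_exp_fst [IsProbabilityMeasure Q] (h : LimitEquation m Q g₁ g₂) {t : ℝ}
    (ht : 0 < t) : Integrable (fun v : ℝ × ℝ => Real.exp (-(t * v.1))) Q := by
  refine Integrable.mono' (integrable_const 1) (by fun_prop) ?_
  filter_upwards [h.nonneg] with v hv
  rw [Real.norm_of_nonneg (Real.exp_pos _).le, Real.exp_le_one_iff]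
  nlinarith [hv.1]

theorem integrable_exp_snd [IsProbabilityMeasure Q] (h : LimitEquation m Q g₁ g₂) {t : ℝ}
    (ht : 0 < t) : Integrable (fun v : ℝ × ℝ => Real.exp (-(t * v.2))) Q := by
  refine Integrable.mono' (integrable_const 1) (by fun_prop) ?_
  filter_upwards [h.nonneg] with v hv
  rw [Real.norm_of_nonneg (Real.exp_pos _).le, Real.exp_le_one_iff]
  nlinarith [hv.2]

theorem integrable_exp_add [IsProbabilityMeasure Q] (h : LimitEquation m Q g₁ g₂) {t : ℝ}
    (ht : 0 < t) : Integrable (fun v : ℝ × ℝ => Real.exp (-(t * (v.1 + v.2)))) Q := by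
  refine Integrable.mono' (integrable_const 1) (by fun_prop) ?_
  filter_upwards [h.nonneg] with v hv
  rw [Real.norm_of_nonneg (Real.exp_pos _).le, Real.exp_le_one_iff]
  nlinarith [hv.1, hv.2]

theorem integral_exp_snd [IsProbabilityMeasure Q] (hm : 0 < m) (h : LimitEquation m Q g₁ g₂)
    {t : ℝ} (ht : 0 < t) : ∫ v, Real.exp (-(t * v.2)) ∂Q = 1 / (1 + m * t) := by
  have := isProbabilityMeasure_swap (Q := Q)
  rw [← h.swap.integral_exp_fst hm ht, integral_map measurable_swap.aemeasurable (by fun_prop)]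
  rfl

/-- The shift by two keeps the points in `(0, 1/2]`, where `x (1 - x)` is increasing; the cross
moment relies on this for monotone convergence. -/
theorem tendsto_one_div_add_two :
    Tendsto (fun n : ℕ => 1 / ((n : ℝ) + 2)) atTop (𝓝[>] 0) := by
  refine tendsto_nhdsWithin_iff.2 ⟨?_, Eventually.of_forall fun n => by
    simp only [Set.mem_Ioi]; positivity⟩
  refine tendsto_const_nhds.div_atTop ?_
  exact tendsto_atTop_add_const_right _ _ tendsto_natCast_atTop_atTop

theorem one_div_add_two_anti {n k : ℕ} (h : n ≤ k) : 1 / ((k : ℝ) + 2) ≤ 1 / ((n : ℝ) + 2) := by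
  have : (n : ℝ) ≤ k := by exact_mod_cast h
  gcongr

theorem integral_fst [IsProbabilityMeasure Q] (hm : 0 < m) (h : LimitEquation m Q g₁ g₂) :
    Integrable (fun v : ℝ × ℝ => v.1) Q ∧ ∫ v, v.1 ∂Q = m := by
  have hpos : ∀ n : ℕ, (0 : ℝ) < 1 / ((n : ℝ) + 2) := fun n => by positivity
  refine integral_eq_of_monotone_limit (f := fun n v => expQuot (1 / ((n : ℝ) + 2)) v.1)
    (fun n => ?_) ?_ ?_ ?_ (by fun_prop) ?_
  · exact ((integrable_const 1).sub (h.integrable_exp_fst (hpos n))).div_const _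
  · filter_upwards [h.nonneg] with v hv n using expQuot_nonneg (hpos n) hv.1
  · exact Eventually.of_forall fun v n k hnk => expQuot_anti (hpos k) (one_div_add_two_anti hnk)
  · exact Eventually.of_forall fun v => (tendsto_expQuot v.1).comp tendsto_one_div_add_two
  · have h1 : Tendsto (fun t : ℝ => m / (1 + m * t)) (𝓝[>] 0) (𝓝 m) := by
      have : ContinuousAt (fun t : ℝ => m / (1 + m * t)) 0 := by
        refine ContinuousAt.div (by fun_prop) (by fun_prop) (by simp)
      have h2 : Tendsto (fun t : ℝ => m / (1 + m * t)) (𝓝 0) (𝓝 (m / (1 + m * 0))) := this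
      simpa using h2.mono_left nhdsWithin_le_nhds
    refine (h1.comp tendsto_one_div_add_two).congr fun n => ?_
    simp only [Function.comp, expQuot]
    set t : ℝ := 1 / ((n : ℝ) + 2) with ht
    have ht0 : 0 < t := hpos n
    rw [integral_div, integral_sub (integrable_const 1) (h.integrable_exp_fst ht0),
      h.integral_exp_fst hm ht0]
    simp
    field_simp
    ring

theorem integral_fst_sq [IsProbabilityMeasure Q] (hm : 0 < m) (h : LimitEquation m Q g₁ g₂) :
    Integrable (fun v : ℝ × ℝ => v.1 ^ 2) Q ∧ ∫ v, v.1 ^ 2 ∂Q = 2 * m ^ 2 := by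
  have hpos : ∀ n : ℕ, (0 : ℝ) < 1 / ((n : ℝ) + 2) := fun n => by positivity
  have hexpand : ∀ t x : ℝ, expQuot t x ^ 2 =
      (1 - 2 * Real.exp (-(t * x)) + Real.exp (-(2 * t * x))) / t ^ 2 := by
    intro t x
    have : Real.exp (-(2 * t * x)) = Real.exp (-(t * x)) ^ 2 := by
      rw [← Real.exp_nat_mul]; congr 1; push_cast; ring
    rw [expQuot, this]
    ring
  have hint : ∀ t : ℝ, 0 < t → Integrable (fun v : ℝ × ℝ => expQuot t v.1 ^ 2) Q := by
    intro t ht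
    simp only [hexpand]
    exact (((integrable_const 1).sub ((h.integrable_exp_fst ht).const_mul 2)).add
      (h.integrable_exp_fst (by positivity))).div_const _
  refine integral_eq_of_monotone_limit (f := fun n v => expQuot (1 / ((n : ℝ) + 2)) v.1 ^ 2)
    (fun n => hint _ (hpos n)) ?_ ?_ ?_ (by fun_prop) ?_
  · exact Eventually.of_forall fun v n => sq_nonneg _
  · filter_upwards [h.nonneg] with v hv n k hnk
    exact pow_le_pow_left₀ (expQuot_nonneg (hpos n) hv.1)
      (expQuot_anti (hpos k) (one_div_add_two_anti hnk)) 2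
  · exact Eventually.of_forall fun v => ((tendsto_expQuot v.1).comp tendsto_one_div_add_two).pow 2
  · have h1 : Tendsto (fun t : ℝ => 2 * m ^ 2 / ((1 + m * t) * (1 + 2 * m * t))) (𝓝[>] 0)
        (𝓝 (2 * m ^ 2)) := by
      have : ContinuousAt (fun t : ℝ => 2 * m ^ 2 / ((1 + m * t) * (1 + 2 * m * t))) 0 := by
        refine ContinuousAt.div (by fun_prop) (by fun_prop) (by simp)
      have h2 : Tendsto (fun t : ℝ => 2 * m ^ 2 / ((1 + m * t) * (1 + 2 * m * t))) (𝓝 0)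
        (𝓝 (2 * m ^ 2 / ((1 + m * 0) * (1 + 2 * m * 0)))) := this
      simpa using h2.mono_left nhdsWithin_le_nhds
    refine (h1.comp tendsto_one_div_add_two).congr fun n => ?_
    simp only [Function.comp, hexpand]
    set t : ℝ := 1 / ((n : ℝ) + 2) with ht
    have ht0 : 0 < t := hpos n
    have i1 := h.integrable_exp_fst ht0
    have i2 := h.integrable_exp_fst (t := 2 * t) (by positivity)
    have i3 : Integrable (fun v : ℝ × ℝ => 1 - 2 * Real.exp (-(t * v.1))) Q :=
      (integrable_const 1).sub (i1.const_mul 2)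
    rw [integral_div, integral_add i3 i2,
      integral_sub (integrable_const 1) (i1.const_mul 2), integral_const_mul,
      h.integral_exp_fst hm ht0, h.integral_exp_fst hm (by positivity)]
    simp only [integral_const, probReal_univ, smul_eq_mul, mul_one]
    field_simp
    ring

theorem integrable_exp_comb [IsProbabilityMeasure Q] (h : LimitEquation m Q g₁ g₂) {t : ℝ}
    (ht : 0 < t) : Integrable (fun v : ℝ × ℝ => 1 - Real.exp (-(t * v.1)) - Real.exp (-(t * v.2)) +
      Real.exp (-(t * (v.1 + v.2)))) Q :=
  (((integrable_const 1).sub (h.integrable_exp_fst ht)).sub (h.integrable_exp_snd ht)).add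
    (h.integrable_exp_add ht)

theorem integral_exp_comb [IsProbabilityMeasure Q] (hm : 0 < m) (h : LimitEquation m Q g₁ g₂)
    {t : ℝ} (ht : 0 < t) :
    ∫ v, (1 - Real.exp (-(t * v.1)) - Real.exp (-(t * v.2)) + Real.exp (-(t * (v.1 + v.2)))) ∂Q =
      1 - 2 / (1 + m * t) + ∫ v, Real.exp (-(t * (v.1 + v.2))) ∂Q := by
  have i1 : Integrable (fun v : ℝ × ℝ => 1 - Real.exp (-(t * v.1))) Q :=
    (integrable_const 1).sub (h.integrable_exp_fst ht)
  have i2 : Integrable (fun v : ℝ × ℝ => 1 - Real.exp (-(t * v.1)) - Real.exp (-(t * v.2))) Q :=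
    i1.sub (h.integrable_exp_snd ht)
  rw [integral_add i2 (h.integrable_exp_add ht), integral_sub i1 (h.integrable_exp_snd ht),
    integral_sub (integrable_const 1) (h.integrable_exp_fst ht), h.integral_exp_fst hm ht,
    h.integral_exp_snd hm ht]
  simp only [integral_const, probReal_univ, smul_eq_mul, mul_one]
  ring

theorem expQuot_mul_expQuot (t x y : ℝ) : expQuot t x * expQuot t y =
    (1 - Real.exp (-(t * x)) - Real.exp (-(t * y)) + Real.exp (-(t * (x + y)))) / t ^ 2 := by
  have : Real.exp (-(t * (x + y))) = Real.exp (-(t * x)) * Real.exp (-(t * y)) := by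
    rw [← Real.exp_add]; congr 1; ring
  rw [expQuot, expQuot, this]
  ring

/-- The product of the difference quotients in `t` increases to `v₁v₂` as `t` decreases to `0`, and
its integral involves only the marginals and the diagonal of the transform. The points `t = T n` are
images of points `x`, because the diagonal is explicit in `x` only. -/
theorem integral_mul [IsProbabilityMeasure Q] (hm : 0 < m) (h : LimitEquation m Q g₁ g₂) :
    Integrable (fun v : ℝ × ℝ => v.1 * v.2) Q ∧
      ∫ v, v.1 * v.2 ∂Q = 2 * m ^ 2 * (Real.pi ^ 2 / 3 - 3) := by
  have hx0 : ∀ n : ℕ, (0 : ℝ) < 1 / ((n : ℝ) + 2) := fun n => by positivity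
  have hx1 : ∀ n : ℕ, 1 / ((n : ℝ) + 2) ≤ 1 / 2 := fun n => by
    gcongr
    linarith [n.cast_nonneg (α := ℝ)]
  obtain ⟨T, hT⟩ : ∃ T : ℕ → ℝ, ∀ n, T n =
      1 / ((n : ℝ) + 2) * (1 - 1 / ((n : ℝ) + 2)) / (2 * m) := ⟨_, fun _ => rfl⟩
  have hpos : ∀ n : ℕ, 0 < T n := fun n => by
    rw [hT]
    exact div_pos (mul_pos (hx0 n) (by linarith [hx1 n])) (by positivity)
  have hTanti : ∀ n k : ℕ, n ≤ k → T k ≤ T n := by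
    intro n k hnk
    have h1 := one_div_add_two_anti hnk
    have h2 := hx1 n
    have h3 := hx1 k
    rw [hT, hT]
    gcongr ?_ / _
    generalize 1 / ((n : ℝ) + 2) = a at *
    generalize 1 / ((k : ℝ) + 2) = b at *
    nlinarith
  have hTlim : Tendsto T atTop (𝓝[>] 0) := by
    refine tendsto_nhdsWithin_iff.2 ⟨?_, Eventually.of_forall hpos⟩
    have h1 : Tendsto (fun x : ℝ => x * (1 - x) / (2 * m)) (𝓝 0) (𝓝 (0 * (1 - 0) / (2 * m))) :=
      (by fun_prop : Continuous fun x : ℝ => x * (1 - x) / (2 * m)).tendsto 0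
    rw [zero_mul, zero_div] at h1
    refine (h1.comp (tendsto_one_div_add_two.mono_right nhdsWithin_le_nhds)).congr fun n => ?_
    rw [hT]
    rfl
  refine integral_eq_of_monotone_limit (f := fun n v => expQuot (T n) v.1 * expQuot (T n) v.2)
    (fun n => ?_) ?_ ?_ ?_ (by fun_prop) ?_
  · simp only [expQuot_mul_expQuot]
    exact (h.integrable_exp_comb (hpos n)).div_const _
  · filter_upwards [h.nonneg] with v hv n
    exact mul_nonneg (expQuot_nonneg (hpos n) hv.1) (expQuot_nonneg (hpos n) hv.2)
  · filter_upwards [h.nonneg] with v hv n k hnk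
    exact mul_le_mul (expQuot_anti (hpos k) (hTanti n k hnk))
      (expQuot_anti (hpos k) (hTanti n k hnk)) (expQuot_nonneg (hpos n) hv.2)
      (expQuot_nonneg (hpos k) hv.1)
  · exact Eventually.of_forall fun v =>
      ((tendsto_expQuot v.1).comp hTlim).mul ((tendsto_expQuot v.2).comp hTlim)
  · refine ((tendsto_cross_moment hm).comp tendsto_one_div_add_two).congr fun n => ?_
    have hadd := h.integral_exp_add hm (hx0 n) (by linarith [hx1 n])
    have ht0 := hpos n
    simp only [Function.comp, expQuot_mul_expQuot]
    rw [← hT] at hadd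
    rw [integral_div, h.integral_exp_comb hm ht0, hadd, ← hT]

theorem integral_snd [IsProbabilityMeasure Q] (hm : 0 < m) (h : LimitEquation m Q g₁ g₂) :
    ∫ v, v.2 ∂Q = m := by
  have := isProbabilityMeasure_swap (Q := Q)
  rw [← (h.swap.integral_fst hm).2, integral_map measurable_swap.aemeasurable (by fun_prop)]
  rfl

theorem integral_snd_sq [IsProbabilityMeasure Q] (hm : 0 < m) (h : LimitEquation m Q g₁ g₂) :
    Integrable (fun v : ℝ × ℝ => v.2 ^ 2) Q ∧ ∫ v, v.2 ^ 2 ∂Q = 2 * m ^ 2 := by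
  have := isProbabilityMeasure_swap (Q := Q)
  obtain ⟨h1, h2⟩ := h.swap.integral_fst_sq hm
  rw [integrable_map_measure (by fun_prop) measurable_swap.aemeasurable] at h1
  rw [integral_map measurable_swap.aemeasurable (by fun_prop)] at h2
  exact ⟨h1, h2⟩

theorem memLp_fst [IsProbabilityMeasure Q] (hm : 0 < m) (h : LimitEquation m Q g₁ g₂) :
    MemLp (fun v : ℝ × ℝ => v.1) 2 Q :=
  (memLp_two_iff_integrable_sq (by fun_prop)).2 (h.integral_fst_sq hm).1

theorem memLp_snd [IsProbabilityMeasure Q] (hm : 0 < m) (h : LimitEquation m Q g₁ g₂) :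
    MemLp (fun v : ℝ × ℝ => v.2) 2 Q :=
  (memLp_two_iff_integrable_sq (by fun_prop)).2 (h.integral_snd_sq hm).1

theorem correlation_eq [IsProbabilityMeasure Q] (hm : 0 < m) (h : LimitEquation m Q g₁ g₂) :
    correlation (fun v : ℝ × ℝ => v.1) (fun v : ℝ × ℝ => v.2) Q = 2 / 3 * Real.pi ^ 2 - 7 := by
  have v1 : variance (fun v : ℝ × ℝ => v.1) Q = m ^ 2 := by
    rw [variance_eq_sub (h.memLp_fst hm)]
    simp only [Pi.pow_apply, (h.integral_fst hm).2, (h.integral_fst_sq hm).2]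
    ring
  have v2 : variance (fun v : ℝ × ℝ => v.2) Q = m ^ 2 := by
    rw [variance_eq_sub (h.memLp_snd hm)]
    simp only [Pi.pow_apply, h.integral_snd hm, (h.integral_snd_sq hm).2]
    ring
  rw [correlation, covariance_eq_sub (h.memLp_fst hm) (h.memLp_snd hm), v1, v2]
  simp only [Pi.mul_apply, (h.integral_mul hm).2, (h.integral_fst hm).2, h.integral_snd hm]
  rw [Real.sqrt_sq hm.le]
  field_simp
  ring

end LimitEquation

/-! ### Balance equations from a short-time expansion -/

section Balance

open Complex

/-- Transform of the part of a measure that sits on the axis where the first queue is empty. -/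
noncomputable def boundaryLap (M : Measure (ℝ × ℝ)) (β : ℂ) : ℂ :=
  ∫ v in {v : ℝ × ℝ | v.1 = 0}, exp (-(β * v.2)) ∂M

/-- Balance equation for a queueing period at queue 1 whose workloads start with law `N` and, at
an exponential time with rate `c`, have law `M`. -/
def HalfBalance (lam mu c : ℝ) (M N : Measure (ℝ × ℝ)) : Prop :=
  ∀ α β : ℂ, 0 ≤ α.re → 0 ≤ β.re →
    (c + α * (lam - mu) + β * lam) * lap M α β =
      c * lap N α β + α * (lam - mu) * boundaryLap M β

/-- Balance equations for the workloads `M` at the end of a visit to queue 1 and `N` at the end of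
a visit to queue 2. -/
structure Balance (lam mu c : ℝ) (M N : Measure (ℝ × ℝ)) : Prop where
  prob_left : IsProbabilityMeasure M
  prob_right : IsProbabilityMeasure N
  nonneg_left : ∀ᵐ v ∂M, 0 ≤ v.1 ∧ 0 ≤ v.2
  nonneg_right : ∀ᵐ v ∂N, 0 ≤ v.1 ∧ 0 ≤ v.2
  first : HalfBalance lam mu c M N
  second : HalfBalance lam mu c (N.map Prod.swap) (M.map Prod.swap)

theorem Balance.swap {lam mu c : ℝ} {M N : Measure (ℝ × ℝ)} (h : Balance lam mu c M N) :
    Balance lam mu c (N.map Prod.swap) (M.map Prod.swap) := by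
  have := h.prob_left
  have := h.prob_right
  have hs : ∀ K : Measure (ℝ × ℝ), (K.map Prod.swap).map Prod.swap = K := by
    intro K
    rw [Measure.map_map measurable_swap measurable_swap, Prod.swap_swap_eq, Measure.map_id]
  exact
    { prob_left := Measure.isProbabilityMeasure_map measurable_swap.aemeasurable
      prob_right := Measure.isProbabilityMeasure_map measurable_swap.aemeasurable
      nonneg_left := nonneg_map_swap h.nonneg_right
      nonneg_right := nonneg_map_swap h.nonneg_left
      first := h.second
      second := by rw [hs, hs]; exact h.first }

theorem norm_exp_sub_exp_le {z w : ℂ} (hz : z.re ≤ 0) (hw : w.re ≤ 0) :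
    ‖exp z - exp w‖ ≤ ‖z - w‖ := by
  have h := (convex_halfSpace_re_le 0).norm_image_sub_le_of_norm_deriv_le (f := exp) (C := 1)
    (fun x _ => Complex.differentiableAt_exp) (fun x hx => ?_) hw hz
  · simpa using h
  · rw [Complex.deriv_exp, Complex.norm_exp, Real.exp_le_one_iff]
    exact hx

theorem norm_exp_neg_sub_le {α β : ℂ} (hα : 0 ≤ α.re) (hβ : 0 ≤ β.re) {v w : ℝ × ℝ}
    (hv : 0 ≤ v.1 ∧ 0 ≤ v.2) (hw : 0 ≤ w.1 ∧ 0 ≤ w.2) {δ : ℝ} (h1 : |v.1 - w.1| ≤ δ)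
    (h2 : |v.2 - w.2| ≤ δ) :
    ‖exp (-(α * v.1 + β * v.2)) - exp (-(α * w.1 + β * w.2))‖ ≤ (‖α‖ + ‖β‖) * δ := by
  have hre : ∀ u : ℝ × ℝ, 0 ≤ u.1 ∧ 0 ≤ u.2 → (-(α * u.1 + β * u.2)).re ≤ 0 := by
    intro u hu
    have := mul_nonneg hα hu.1
    have := mul_nonneg hβ hu.2
    simp
    linarith
  refine (norm_exp_sub_exp_le (hre v hv) (hre w hw)).trans ?_
  have : -(α * v.1 + β * v.2) - -(α * w.1 + β * w.2) =
      -(α * ((v.1 - w.1 : ℝ) : ℂ) + β * ((v.2 - w.2 : ℝ) : ℂ)) := by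
    push_cast; ring
  rw [this, norm_neg, add_mul]
  refine (norm_add_le _ _).trans (add_le_add ?_ ?_)
  · rw [norm_mul, Complex.norm_real, Real.norm_eq_abs]; gcongr
  · rw [norm_mul, Complex.norm_real, Real.norm_eq_abs]; gcongr

variable {lam mu : ℝ}

theorem drain_nonneg (t v : ℝ) : 0 ≤ drain lam mu t v := le_max_left _ _

theorem abs_drain_sub_le (h0 : 0 ≤ lam) (h1 : lam ≤ mu) {t v : ℝ} (ht : 0 ≤ t) (hv : 0 ≤ v) :
    |drain lam mu t v - v| ≤ mu * t := by
  have h2 : (lam - mu) * t ≤ 0 := mul_nonpos_of_nonpos_of_nonneg (by linarith) ht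
  have h3 : 0 ≤ lam * t := mul_nonneg h0 ht
  rw [drain, abs_le]
  constructor
  · nlinarith [le_max_right 0 (v + (lam - mu) * t)]
  · have : max 0 (v + (lam - mu) * t) ≤ v := max_le hv (by linarith)
    nlinarith

theorem abs_fill_sub_le (h0 : 0 ≤ lam) (h1 : lam ≤ mu) {t : ℝ} (ht : 0 ≤ t) (v : ℝ) :
    |fill lam t v - v| ≤ mu * t := by
  rw [fill, add_sub_cancel_left, abs_of_nonneg (mul_nonneg h0 ht)]
  gcongr

theorem serveFirst_nonneg (h0 : 0 ≤ lam) {t : ℝ} (ht : 0 ≤ t) {v : ℝ × ℝ}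
    (hv : 0 ≤ v.1 ∧ 0 ≤ v.2) :
    0 ≤ (serveFirst lam mu t v).1 ∧ 0 ≤ (serveFirst lam mu t v).2 :=
  ⟨drain_nonneg _ _, add_nonneg hv.2 (mul_nonneg h0 ht)⟩

theorem serveSecond_eq_swap (t : ℝ) (v : ℝ × ℝ) :
    serveSecond lam mu t v = (serveFirst lam mu t v.swap).swap := rfl

theorem serveSecond_nonneg (h0 : 0 ≤ lam) {t : ℝ} (ht : 0 ≤ t) {v : ℝ × ℝ}
    (hv : 0 ≤ v.1 ∧ 0 ≤ v.2) :
    0 ≤ (serveSecond lam mu t v).1 ∧ 0 ≤ (serveSecond lam mu t v).2 :=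
  ⟨add_nonneg hv.1 (mul_nonneg h0 ht), drain_nonneg _ _⟩

theorem continuous_serveFirst : Continuous fun p : ℝ × (ℝ × ℝ) => serveFirst lam mu p.1 p.2 := by
  unfold serveFirst drain fill
  fun_prop

theorem continuous_serveSecond :
    Continuous fun p : ℝ × (ℝ × ℝ) => serveSecond lam mu p.1 p.2 := by
  unfold serveSecond drain fill
  fun_prop

theorem measurable_serveFirst (t : ℝ) : Measurable (serveFirst lam mu t) :=
  (continuous_serveFirst.comp (by fun_prop : Continuous fun v : ℝ × ℝ => (t, v))).measurable

theorem tendsto_exp_quot (k : ℂ) :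
    Tendsto (fun h : ℝ => (exp (-(k * h)) - 1) / h) (𝓝[>] 0) (𝓝 (-k)) := by
  have h : HasDerivAt (fun t : ℝ => exp (-(k * t))) (-k) 0 := by
    have h1 : HasDerivAt (fun t : ℝ => (t : ℂ)) 1 0 := Complex.ofRealCLM.hasDerivAt
    have := (h1.const_mul k).neg.cexp
    simpa using this
  refine h.tendsto_slope_zero_right.congr fun t => ?_
  simp [div_eq_inv_mul]

/-- Right derivative of the test exponential along the flow. When the served queue is empty its
drift `lam - mu` is switched off; the indicator term restores what the first term wrongly counts,
and is the source of the boundary transform. -/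
theorem tendsto_serveFirst_quot (h1 : lam ≤ mu) (α β : ℂ) {v : ℝ × ℝ}
    (hv : 0 ≤ v.1 ∧ 0 ≤ v.2) :
    Tendsto (fun h : ℝ => (exp (-(α * (serveFirst lam mu h v).1 + β * (serveFirst lam mu h v).2)) -
        exp (-(α * v.1 + β * v.2))) / h) (𝓝[>] 0)
      (𝓝 (-(α * (lam - mu) + β * lam) * exp (-(α * v.1 + β * v.2)) +
        α * (lam - mu) * {v : ℝ × ℝ | v.1 = 0}.indicator (fun v => exp (-(β * v.2))) v)) := by
  rcases hv.1.eq_or_lt with h0 | h0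
  · have hmem : v ∈ {v : ℝ × ℝ | v.1 = 0} := h0.symm
    rw [Set.indicator_of_mem hmem]
    have hlim := (tendsto_exp_quot (β * lam)).mul_const (exp (-(β * v.2)))
    have e : -(α * (lam - mu) + β * lam) * exp (-(α * v.1 + β * v.2)) +
        α * (lam - mu) * exp (-(β * v.2)) = -(β * lam) * exp (-(β * v.2)) := by
      rw [← h0]
      simp
      ring
    rw [e]
    refine hlim.congr' ?_
    filter_upwards [self_mem_nhdsWithin] with t ht
    have hd : drain lam mu t 0 = 0 := by
      rw [drain, zero_add]
      exact max_eq_left (mul_nonpos_of_nonpos_of_nonneg (by linarith) (le_of_lt ht))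
    simp only [serveFirst, fill, ← h0, hd]
    have : exp (-(α * ((0 : ℝ) : ℂ) + β * ((v.2 + lam * t : ℝ) : ℂ))) =
        exp (-(β * lam * t)) * exp (-(β * v.2)) := by
      rw [← Complex.exp_add]; congr 1; push_cast; ring
    rw [this]
    simp
    ring
  · have hmem : v ∉ {v : ℝ × ℝ | v.1 = 0} := h0.ne'
    rw [Set.indicator_of_notMem hmem, mul_zero, add_zero]
    refine ((tendsto_exp_quot (α * (lam - mu) + β * lam)).mul_const _).congr' ?_
    have hcont : Tendsto (fun t : ℝ => v.1 + (lam - mu) * t) (𝓝[>] 0) (𝓝 (v.1 + (lam - mu) * 0)) :=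
      ((by fun_prop : Continuous fun t : ℝ => v.1 + (lam - mu) * t).tendsto 0).mono_left
        nhdsWithin_le_nhds
    rw [mul_zero, add_zero] at hcont
    filter_upwards [hcont.eventually (lt_mem_nhds h0)] with t ht
    simp only [serveFirst, fill, drain, max_eq_right ht.le]
    have : exp (-(α * ((v.1 + (lam - mu) * t : ℝ) : ℂ) + β * ((v.2 + lam * t : ℝ) : ℂ))) =
        exp (-((α * (lam - mu) + β * lam) * t)) * exp (-(α * v.1 + β * v.2)) := by
      rw [← Complex.exp_add]; congr 1; push_cast; ring
    rw [this]
    ring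

/-- Over a time `h` the law `M` is, up to `O(h²)`, the mixture of `M` transported by the flow (no
switch, weight `exp (-ch)`) and of `N` (weight `1 - exp (-ch)`). Dividing by `h` and letting `h → 0`
yields the balance equation. Both kinds of epochs are treated through this criterion. -/
theorem halfBalance_of_approx {c : ℝ} {M N : Measure (ℝ × ℝ)} [IsFiniteMeasure M]
    (h0 : 0 ≤ lam) (h1 : lam ≤ mu) (hM : ∀ᵐ v ∂M, 0 ≤ v.1 ∧ 0 ≤ v.2)
    (happrox : ∀ α β : ℂ, 0 ≤ α.re → 0 ≤ β.re → ∃ C : ℝ, ∀ h : ℝ, 0 < h → h ≤ 1 →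
      ‖lap M α β - exp (-(c * h)) * ∫ v, exp (-(α * (serveFirst lam mu h v).1 +
        β * (serveFirst lam mu h v).2)) ∂M - (1 - exp (-(c * h))) * lap N α β‖ ≤ C * h ^ 2) :
    HalfBalance lam mu c M N := by
  intro α β hα hβ
  obtain ⟨C, hC⟩ := happrox α β hα hβ
  set D : ℝ → ℂ := fun h => ∫ v, (exp (-(α * (serveFirst lam mu h v).1 +
    β * (serveFirst lam mu h v).2)) - exp (-(α * v.1 + β * v.2))) / h ∂M with hD
  have hmeas : ∀ h : ℝ, Measurable fun v : ℝ × ℝ =>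
      exp (-(α * (serveFirst lam mu h v).1 + β * (serveFirst lam mu h v).2)) := by
    intro h
    exact (by fun_prop : Measurable fun w : ℝ × ℝ => exp (-(α * w.1 + β * w.2))).comp
      (measurable_serveFirst h)
  have hset : MeasurableSet {v : ℝ × ℝ | v.1 = 0} :=
    measurable_fst (measurableSet_singleton (0 : ℝ))
  have hint : Integrable (fun v : ℝ × ℝ => exp (-(β * v.2))) M := by
    simpa using integrable_exp_neg hM (α := 0) (by simp) hβ
  have hDlim : Tendsto D (𝓝[>] 0) (𝓝 (-(α * (lam - mu) + β * lam) * lap M α β +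
      α * (lam - mu) * boundaryLap M β)) := by
    have e : -(α * (lam - mu) + β * lam) * lap M α β + α * (lam - mu) * boundaryLap M β =
        ∫ v, (-(α * (lam - mu) + β * lam) * exp (-(α * v.1 + β * v.2)) +
        α * (lam - mu) * {v : ℝ × ℝ | v.1 = 0}.indicator (fun v => exp (-(β * v.2))) v) ∂M := by
      rw [integral_add ((integrable_exp_neg hM hα hβ).const_mul _)
        ((hint.indicator hset).const_mul _), integral_const_mul, integral_const_mul,
        integral_indicator hset]
      rfl
    rw [e]
    refine tendsto_integral_filter_of_dominated_convergence (fun _ => (‖α‖ + ‖β‖) * mu)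
      (Eventually.of_forall fun h => ?_) ?_ (integrable_const _) ?_
    · exact (((hmeas h).sub (by fun_prop)).div_const _).aestronglyMeasurable
    · filter_upwards [self_mem_nhdsWithin] with h hh
      filter_upwards [hM] with v hv
      have hh' : (0 : ℝ) < h := hh
      rw [norm_div, Complex.norm_real, Real.norm_of_nonneg hh'.le, div_le_iff₀ hh', mul_assoc]
      exact norm_exp_neg_sub_le hα hβ (serveFirst_nonneg h0 hh'.le hv) hv
        (abs_drain_sub_le h0 h1 hh'.le hv.1) (abs_fill_sub_le h0 h1 hh'.le v.2)
    · filter_upwards [hM] with v hv using tendsto_serveFirst_quot h1 α β hv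
  have hexp := tendsto_exp_quot c
  have hexp0 : Tendsto (fun h : ℝ => exp (-(c * h))) (𝓝[>] 0) (𝓝 1) := by
    have : Tendsto (fun h : ℝ => exp (-(c * h))) (𝓝 0) (𝓝 (exp (-(c * (0 : ℝ))))) :=
      (by fun_prop : Continuous fun h : ℝ => exp (-(c * h))).tendsto 0
    simpa using this.mono_left nhdsWithin_le_nhds
  have hlim := (hexp.mul_const (lap M α β - lap N α β)).add (hexp0.mul hDlim)
  -- This expression is minus the defect in `happrox` divided by `h`, hence at most `C h` in norm.
  have hzero : Tendsto (fun h : ℝ => (exp (-(c * h)) - 1) / h * (lap M α β - lap N α β) +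
      exp (-(c * h)) * D h) (𝓝[>] 0) (𝓝 0) := by
    have hCh : Tendsto (fun h : ℝ => C * h) (𝓝[>] 0) (𝓝 0) := by
      have : Tendsto (fun h : ℝ => C * h) (𝓝 0) (𝓝 (C * 0)) :=
        (by fun_prop : Continuous fun h : ℝ => C * h).tendsto 0
      simpa using this.mono_left nhdsWithin_le_nhds
    refine squeeze_zero_norm' ?_ hCh
    filter_upwards [Ioc_mem_nhdsGT one_pos] with h hh
    have hh0 : 0 < h := hh.1
    have hhne : (h : ℂ) ≠ 0 := by exact_mod_cast hh0.ne'
    have hint2 : Integrable (fun v : ℝ × ℝ =>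
        exp (-(α * (serveFirst lam mu h v).1 + β * (serveFirst lam mu h v).2))) M := by
      refine Integrable.mono' (integrable_const 1) (hmeas h).aestronglyMeasurable ?_
      filter_upwards [hM] with v hv
      exact norm_exp_neg_le_one hα hβ (serveFirst_nonneg h0 hh0.le hv)
    have hDh : D h = (∫ v, exp (-(α * (serveFirst lam mu h v).1 +
        β * (serveFirst lam mu h v).2)) ∂M - lap M α β) / h := by
      simp only [hD]
      rw [integral_div, integral_sub hint2 (integrable_exp_neg hM hα hβ)]
      rfl
    rw [hDh]
    have hb := hC h hh0 hh.2
    set J := ∫ v, exp (-(α * (serveFirst lam mu h v).1 + β * (serveFirst lam mu h v).2)) ∂M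
    have e : (exp (-(c * h)) - 1) / h * (lap M α β - lap N α β) +
        exp (-(c * h)) * ((J - lap M α β) / h) =
        -(lap M α β - exp (-(c * h)) * J - (1 - exp (-(c * h))) * lap N α β) / h := by
      field_simp
      ring
    rw [e, norm_div, norm_neg, Complex.norm_real, Real.norm_of_nonneg hh0.le, div_le_iff₀ hh0]
    calc _ ≤ C * h ^ 2 := hb
      _ = _ := by ring
  have := tendsto_nhds_unique hlim hzero
  linear_combination -this

end Balance

/-! ### The exponential distribution -/

section Exponential

variable {c : ℝ}

theorem integral_expMeasure {E : Type*} [NormedAddCommGroup E] [NormedSpace ℝ E] (hc : 0 < c)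
    (u : ℝ → E) :
    ∫ t, u t ∂(expMeasure c) = ∫ t in Set.Ioi (0 : ℝ), (c * Real.exp (-(c * t))) • u t := by
  have h1 : expMeasure c = volume.withDensity (exponentialPDF c) := rfl
  have h2 : Measurable (exponentialPDF c) := (measurable_exponentialPDFReal c).ennreal_ofReal
  rw [h1, integral_withDensity_eq_integral_toReal_smul h2
    (Eventually.of_forall fun _ => ENNReal.ofReal_lt_top), ← integral_Ici_eq_integral_Ioi,
    ← integral_indicator measurableSet_Ici]
  congr 1
  ext t
  rw [exponentialPDF_eq]
  by_cases ht : 0 ≤ t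
  · rw [if_pos ht, Set.indicator_of_mem (Set.mem_Ici.2 ht), ENNReal.toReal_ofReal (by positivity)]
  · rw [if_neg ht, Set.indicator_of_notMem (by simpa using ht)]
    simp

theorem measureReal_expMeasure_Iic (hc : 0 < c) {t : ℝ} (ht : 0 ≤ t) :
    (expMeasure c).real (Set.Iic t) = 1 - Real.exp (-(c * t)) := by
  have := isProbabilityMeasure_expMeasure hc
  rw [← cdf_eq_real, cdf_expMeasure_eq hc, if_pos ht]

theorem measureReal_expMeasure_Iic_le (hc : 0 < c) {t : ℝ} (ht : 0 ≤ t) :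
    (expMeasure c).real (Set.Iic t) ≤ c * t := by
  rw [measureReal_expMeasure_Iic hc ht]
  linarith [Real.add_one_le_exp (-(c * t))]

theorem ae_pos_expMeasure (hc : 0 < c) : ∀ᵐ t ∂(expMeasure c), 0 < t := by
  have := isProbabilityMeasure_expMeasure hc
  have h := measureReal_expMeasure_Iic hc le_rfl
  rw [mul_zero, neg_zero, Real.exp_zero, sub_self, measureReal_eq_zero_iff] at h
  rw [ae_iff]
  convert h using 2
  ext t
  simp

/-- Memorylessness: beyond `h`, an event of probability `exp (-ch)`, the excess over `h` is
exponential again. -/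
theorem integral_expMeasure_add (hc : 0 < c) {u : ℝ → ℂ} (hu : Integrable u (expMeasure c)) {h : ℝ}
    (hh : 0 ≤ h) :
    ∫ t, u t ∂(expMeasure c) = ∫ t in Set.Iic h, u t ∂(expMeasure c) +
      Complex.exp (-(c * h)) * ∫ t, u (t + h) ∂(expMeasure c) := by
  rw [← integral_add_compl measurableSet_Iic hu, Set.compl_Iic]
  congr 1
  rw [← integral_indicator measurableSet_Ioi, integral_expMeasure hc, integral_expMeasure hc,
    ← integral_const_mul]
  have e : ∀ t : ℝ, (c * Real.exp (-(c * t))) • (Set.Ioi h).indicator u t =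
      (Set.Ioi h).indicator (fun t => (c * Real.exp (-(c * t))) • u t) t := by
    intro t
    by_cases ht : t ∈ Set.Ioi h
    · simp only [Set.indicator_of_mem ht]
    · simp only [Set.indicator_of_notMem ht, smul_zero]
  simp_rw [e]
  rw [setIntegral_indicator measurableSet_Ioi, Set.Ioi_inter_Ioi, sup_of_le_right hh]
  have h2 := (measurePreserving_add_right (volume : Measure ℝ) h).setIntegral_preimage_emb
    (MeasurableEquiv.addRight h).measurableEmbedding
    (fun t => (c * Real.exp (-(c * t))) • u t) (Set.Ioi h)
  rw [← h2]
  simp only [Set.preimage_add_const_Ioi, sub_self]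
  refine integral_congr_ae (Eventually.of_forall fun t => ?_)
  simp only [Complex.real_smul]
  push_cast
  have : Complex.exp (-(c * (t + h))) = Complex.exp (-(c * h)) * Complex.exp (-(c * t)) := by
    rw [← Complex.exp_add]; congr 1; ring
  rw [this]
  ring

end Exponential

/-! ### Balance equations at switching epochs -/

section Cycle

open Complex

variable {lam mu c : ℝ}

/-- Law of the workloads after an exponential visit to queue 1 that starts with law `N`. -/
noncomputable def visitLaw (lam mu c : ℝ) (N : Measure (ℝ × ℝ)) : Measure (ℝ × ℝ) :=
  (N.prod (expMeasure c)).map fun p => serveFirst lam mu p.2 p.1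

theorem continuous_serveFirst_swap :
    Continuous fun p : (ℝ × ℝ) × ℝ => serveFirst lam mu p.2 p.1 :=
  continuous_serveFirst.comp continuous_swap

theorem drain_add (h1 : lam ≤ mu) {s t : ℝ} (ht : 0 ≤ t) (v : ℝ) :
    drain lam mu t (drain lam mu s v) = drain lam mu (s + t) v := by
  have h2 : (lam - mu) * t ≤ 0 := mul_nonpos_of_nonpos_of_nonneg (by linarith) ht
  have h3 : v + (lam - mu) * (s + t) = v + (lam - mu) * s + (lam - mu) * t := by ring
  rw [drain, drain, drain, h3, max_add, ← max_assoc, zero_add, max_eq_left h2]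

theorem serveFirst_add (h1 : lam ≤ mu) {s t : ℝ} (ht : 0 ≤ t) (v : ℝ × ℝ) :
    serveFirst lam mu t (serveFirst lam mu s v) = serveFirst lam mu (s + t) v := by
  simp only [serveFirst, drain_add h1 ht, fill]
  ring_nf

variable {N : Measure (ℝ × ℝ)}

theorem isProbabilityMeasure_visitLaw (hc : 0 < c) [IsProbabilityMeasure N] :
    IsProbabilityMeasure (visitLaw lam mu c N) :=
  have := isProbabilityMeasure_expMeasure hc
  Measure.isProbabilityMeasure_map continuous_serveFirst_swap.measurable.aemeasurable

theorem measurableSet_quadrant : MeasurableSet {v : ℝ × ℝ | 0 ≤ v.1 ∧ 0 ≤ v.2} :=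
  (measurableSet_le measurable_const measurable_fst).inter
    (measurableSet_le measurable_const measurable_snd)

theorem ae_prod_expMeasure (hc : 0 < c) [IsProbabilityMeasure N]
    (hN : ∀ᵐ v ∂N, 0 ≤ v.1 ∧ 0 ≤ v.2) :
    ∀ᵐ p ∂(N.prod (expMeasure c)), (0 ≤ p.1.1 ∧ 0 ≤ p.1.2) ∧ 0 ≤ p.2 := by
  have := isProbabilityMeasure_expMeasure hc
  have h1 := Measure.quasiMeasurePreserving_fst (μ := N) (ν := expMeasure c) |>.ae hN
  have h2 := Measure.quasiMeasurePreserving_snd (μ := N) (ν := expMeasure c) |>.ae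
    (ae_pos_expMeasure hc)
  filter_upwards [h1, h2] with p hp1 hp2 using ⟨hp1, hp2.le⟩

theorem nonneg_visitLaw (hc : 0 < c) (h0 : 0 ≤ lam) [IsProbabilityMeasure N]
    (hN : ∀ᵐ v ∂N, 0 ≤ v.1 ∧ 0 ≤ v.2) :
    ∀ᵐ v ∂(visitLaw lam mu c N), 0 ≤ v.1 ∧ 0 ≤ v.2 := by
  rw [visitLaw, ae_map_iff continuous_serveFirst_swap.measurable.aemeasurable
    measurableSet_quadrant]
  filter_upwards [ae_prod_expMeasure hc hN] with p hp using serveFirst_nonneg h0 hp.2 hp.1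

/-- Split the visit length at `h`. If it exceeds `h`, the final state is that of a fresh visit
followed by a further time `h` of flow. If not, an event of probability at most `ch`, the workloads
have moved by at most `mu * h` from their initial value; the two small factors make the error
quadratic. -/
theorem halfBalance_visitLaw (hc : 0 < c) (h0 : 0 ≤ lam) (h1 : lam ≤ mu) [IsProbabilityMeasure N]
    (hN : ∀ᵐ v ∂N, 0 ≤ v.1 ∧ 0 ≤ v.2) : HalfBalance lam mu c (visitLaw lam mu c N) N := by
  have := isProbabilityMeasure_expMeasure hc
  have := isProbabilityMeasure_visitLaw (lam := lam) (mu := mu) hc (N := N)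
  refine halfBalance_of_approx h0 h1 (nonneg_visitLaw hc h0 hN) fun α β hα hβ => ?_
  set L := (‖α‖ + ‖β‖) * mu with hL
  refine ⟨L * c, fun h hh0 hh1 => ?_⟩
  set e : ℝ × ℝ → ℂ := fun v => exp (-(α * v.1 + β * v.2)) with he
  have hec : Continuous e := by simp only [he]; fun_prop
  have hcont1 : Continuous fun p : (ℝ × ℝ) × ℝ => e (serveFirst lam mu p.2 p.1) :=
    hec.comp continuous_serveFirst_swap
  have hcont2 : Continuous fun p : (ℝ × ℝ) × ℝ => e (serveFirst lam mu (p.2 + h) p.1) :=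
    hec.comp (continuous_serveFirst.comp (f := fun p : (ℝ × ℝ) × ℝ => (p.2 + h, p.1)) (by fun_prop))
  have hint1 : Integrable (fun p : (ℝ × ℝ) × ℝ => e (serveFirst lam mu p.2 p.1))
      (N.prod (expMeasure c)) := by
    refine Integrable.mono' (integrable_const 1) hcont1.aestronglyMeasurable ?_
    filter_upwards [ae_prod_expMeasure hc hN] with p hp
    exact norm_exp_neg_le_one hα hβ (serveFirst_nonneg h0 hp.2 hp.1)
  have hint2 : Integrable (fun p : (ℝ × ℝ) × ℝ => e (serveFirst lam mu (p.2 + h) p.1))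
      (N.prod (expMeasure c)) := by
    refine Integrable.mono' (integrable_const 1) hcont2.aestronglyMeasurable ?_
    filter_upwards [ae_prod_expMeasure hc hN] with p hp
    exact norm_exp_neg_le_one hα hβ (serveFirst_nonneg h0 (add_nonneg hp.2 hh0.le) hp.1)
  have e1 : lap (visitLaw lam mu c N) α β =
      ∫ v, ∫ t, e (serveFirst lam mu t v) ∂(expMeasure c) ∂N := by
    rw [lap, visitLaw, integral_map continuous_serveFirst_swap.measurable.aemeasurable
      hec.aestronglyMeasurable, integral_prod _ hint1]
  have e2 : ∫ v, exp (-(α * (serveFirst lam mu h v).1 +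
      β * (serveFirst lam mu h v).2)) ∂(visitLaw lam mu c N) =
      ∫ v, ∫ t, e (serveFirst lam mu (t + h) v) ∂(expMeasure c) ∂N := by
    change ∫ v, (e ∘ serveFirst lam mu h) v ∂(visitLaw lam mu c N) = _
    rw [visitLaw, integral_map continuous_serveFirst_swap.measurable.aemeasurable
      (hec.measurable.comp (measurable_serveFirst h)).aestronglyMeasurable,
      ← integral_prod _ hint2]
    refine integral_congr_ae (Eventually.of_forall fun p => ?_)
    simp only [Function.comp, serveFirst_add h1 hh0.le]
  have e3 : ∫ t, (1 : ℂ) ∂((expMeasure c).restrict (Set.Iic h)) = 1 - exp (-(c * h)) := by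
    rw [integral_const, measureReal_restrict_apply_univ, measureReal_expMeasure_Iic hc hh0.le]
    simp
  have i1 : Integrable (fun v => ∫ t, e (serveFirst lam mu t v) ∂(expMeasure c)) N :=
    hint1.integral_prod_left
  have i2 : Integrable (fun v => exp (-(c * h)) *
      ∫ t, e (serveFirst lam mu (t + h) v) ∂(expMeasure c)) N :=
    hint2.integral_prod_left.const_mul _
  have i3 : Integrable (fun v => ∫ t, e (serveFirst lam mu t v) ∂(expMeasure c) -
      exp (-(c * h)) * ∫ t, e (serveFirst lam mu (t + h) v) ∂(expMeasure c)) N := i1.sub i2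
  rw [e1, e2, lap, ← integral_const_mul, ← integral_const_mul, ← integral_sub i1 i2,
    ← integral_sub i3 ((integrable_exp_neg hN hα hβ).const_mul _)]
  have hbound : ∀ᵐ v ∂N, ‖∫ t, e (serveFirst lam mu t v) ∂(expMeasure c) -
      exp (-(c * h)) * ∫ t, e (serveFirst lam mu (t + h) v) ∂(expMeasure c) -
      (1 - exp (-(c * h))) * e v‖ ≤ L * c * h ^ 2 := by
    filter_upwards [hN] with v hv
    have hu : Integrable (fun t => e (serveFirst lam mu t v)) (expMeasure c) := by
      refine Integrable.mono' (integrable_const 1) (hcont1.comp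
        (by fun_prop : Continuous fun t : ℝ => (v, t))).aestronglyMeasurable ?_
      filter_upwards [ae_pos_expMeasure hc] with t ht
      exact norm_exp_neg_le_one hα hβ (serveFirst_nonneg h0 ht.le hv)
    rw [integral_expMeasure_add hc hu hh0.le, add_sub_cancel_right, ← e3,
      ← integral_mul_const, ← integral_sub hu.integrableOn (integrable_const _)]
    have hb : ∀ᵐ t ∂((expMeasure c).restrict (Set.Iic h)),
        ‖e (serveFirst lam mu t v) - 1 * e v‖ ≤ L * h := by
      filter_upwards [ae_restrict_mem measurableSet_Iic, ae_restrict_of_ae (ae_pos_expMeasure hc)]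
        with t ht ht0
      have hmu : 0 ≤ mu := h0.trans h1
      rw [one_mul, hL, mul_assoc]
      refine (norm_exp_neg_sub_le hα hβ (serveFirst_nonneg h0 ht0.le hv) hv
        (abs_drain_sub_le h0 h1 ht0.le hv.1) (abs_fill_sub_le h0 h1 ht0.le v.2)).trans ?_
      gcongr
      exact ht
    refine (norm_integral_le_of_norm_le_const hb).trans ?_
    rw [measureReal_restrict_apply_univ]
    have hmu : 0 ≤ mu := h0.trans h1
    calc L * h * (expMeasure c).real (Set.Iic h) ≤ L * h * (c * h) := by
          have := measureReal_expMeasure_Iic_le hc hh0.le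
          gcongr
      _ = _ := by ring
  have hfin := norm_integral_le_of_norm_le_const hbound
  rwa [probReal_univ, mul_one] at hfin

/-- A full cycle consists of two visits with the roles of the queues exchanged. -/
theorem map_cycle_eq (hc : 0 < c) [IsProbabilityMeasure N] :
    ((N.prod ((expMeasure c).prod (expMeasure c))).map
      (fun p => serveSecond lam mu p.2.2 (serveFirst lam mu p.2.1 p.1))).map Prod.swap =
      visitLaw lam mu c ((visitLaw lam mu c N).map Prod.swap) := by
  have := isProbabilityMeasure_expMeasure hc
  have hs := (continuous_serveFirst_swap (lam := lam) (mu := mu)).measurable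
  have hs2 : Measurable fun p : (ℝ × ℝ) × ℝ × ℝ =>
      serveSecond lam mu p.2.2 (serveFirst lam mu p.2.1 p.1) :=
    (continuous_serveSecond.comp (f := fun p : (ℝ × ℝ) × ℝ × ℝ =>
      (p.2.2, serveFirst lam mu p.2.1 p.1)) ((by fun_prop : Continuous fun p : (ℝ × ℝ) × ℝ × ℝ =>
        p.2.2).prodMk (continuous_serveFirst.comp (f := fun p : (ℝ × ℝ) × ℝ × ℝ =>
          (p.2.1, p.1)) (by fun_prop)))).measurable
  have e1 : ((visitLaw lam mu c N).map Prod.swap).prod (expMeasure c) =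
      (N.prod ((expMeasure c).prod (expMeasure c))).map
        (fun p => ((serveFirst lam mu p.2.1 p.1).swap, p.2.2)) := by
    rw [visitLaw, Measure.map_map measurable_swap hs]
    conv_lhs => rw [← Measure.map_id (μ := expMeasure c)]
    rw [Measure.map_prod_map _ _ (measurable_swap.comp hs) measurable_id, Measure.map_id,
      ← (measurePreserving_prodAssoc N (expMeasure c) (expMeasure c)).symm.map_eq,
      Measure.map_map ((measurable_swap.comp hs).prodMap measurable_id)
        (MeasurableEquiv.prodAssoc.symm.measurable)]
    rfl
  rw [visitLaw, e1, Measure.map_map measurable_swap hs2, Measure.map_map hs]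
  · rfl
  · have hp : Measurable fun p : (ℝ × ℝ) × ℝ × ℝ => (p.1, p.2.1) := by fun_prop
    exact (measurable_swap.comp (hs.comp hp)).prodMk (measurable_snd.comp measurable_snd)

/-- The law at arrivals at queue 1 is the law at the ends of visits to queue 2, so it plays the role
of `N`. Stationarity over the cycle closes the system. -/
theorem IsCycleStationary.balance (hc : 0 < c) (h0 : 0 ≤ lam) (h1 : lam ≤ mu)
    [IsProbabilityMeasure N] (h : IsCycleStationary lam mu c N) :
    Balance lam mu c (visitLaw lam mu c N) N := by
  have := isProbabilityMeasure_visitLaw (lam := lam) (mu := mu) hc (N := N)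
  have hsw : IsProbabilityMeasure ((visitLaw lam mu c N).map Prod.swap) :=
    Measure.isProbabilityMeasure_map measurable_swap.aemeasurable
  have hnn := nonneg_visitLaw (mu := mu) hc h0 h.nonneg
  refine ⟨this, ‹_›, hnn, h.nonneg, halfBalance_visitLaw hc h0 h1 h.nonneg, ?_⟩
  have e := map_cycle_eq (lam := lam) (mu := mu) hc (N := N)
  rw [h.stationary] at e
  rw [e]
  exact halfBalance_visitLaw hc h0 h1 (nonneg_map_swap hnn)

end Cycle

/-! ### Short-time behaviour of the process at arbitrary epochs -/

section Time

variable {lam mu c : ℝ}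

theorem flow_nonneg (h0 : 0 ≤ lam) {t : ℝ} (ht : 0 ≤ t) {x : State}
    (hx : 0 ≤ x.1.1 ∧ 0 ≤ x.1.2) :
    0 ≤ (flow lam mu t x).1.1 ∧ 0 ≤ (flow lam mu t x).1.2 := by
  unfold flow
  split_ifs
  · exact serveFirst_nonneg h0 ht hx
  · exact serveSecond_nonneg h0 ht hx

theorem abs_flow_sub_le (h0 : 0 ≤ lam) (h1 : lam ≤ mu) {t : ℝ} (ht : 0 ≤ t) {x : State}
    (hx : 0 ≤ x.1.1 ∧ 0 ≤ x.1.2) :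
    |(flow lam mu t x).1.1 - x.1.1| ≤ mu * t ∧ |(flow lam mu t x).1.2 - x.1.2| ≤ mu * t := by
  unfold flow
  split_ifs
  · exact ⟨abs_drain_sub_le h0 h1 ht hx.1, abs_fill_sub_le h0 h1 ht _⟩
  · exact ⟨abs_fill_sub_le h0 h1 ht _, abs_drain_sub_le h0 h1 ht hx.2⟩

theorem measurable_flow (t : ℝ) : Measurable (flow lam mu t) := by
  unfold flow
  refine Measurable.prodMk ?_ measurable_snd
  refine Measurable.ite (measurable_snd (measurableSet_singleton (0 : Fin 2)))
    ((measurable_serveFirst t).comp measurable_fst) ?_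
  exact (continuous_serveSecond.comp
    (by fun_prop : Continuous fun v : ℝ × ℝ => (t, v))).measurable.comp measurable_fst

theorem measurable_switchServer : Measurable switchServer :=
  measurable_fst.prodMk ((measurable_from_top (f := fun i : Fin 2 => 1 - i)).comp measurable_snd)

theorem stateAt_of_lt {τ : ℕ → ℝ} (hτ : ∀ k, 0 < τ k) {h : ℝ} (hh : h < τ 0) (x : State) :
    stateAt lam mu x τ h = flow lam mu h x := by
  have hcount : switchCount τ h = 0 := by
    have : {n : ℕ | switchTime τ (n + 1) ≤ h} = ∅ := by
      ext n
      simp only [Set.mem_ofPred_eq, Set.mem_empty_iff_false, iff_false, not_le]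
      refine hh.trans_le ?_
      exact Finset.single_le_sum (f := τ) (fun k _ => (hτ k).le) (by simp)
    rw [switchCount, this, Set.ncard_empty]
  rw [stateAt, hcount]
  simp [switchTime, stateAtSwitch]

/-- The condition `h < τ 1` is stronger than needed for exactly one switch before `h`, but its
failure together with `τ 0 ≤ h` still has probability `O(h²)` and is simple to compute. -/
theorem stateAt_of_le_of_lt {τ : ℕ → ℝ} (hτ : ∀ k, 0 < τ k) {h : ℝ} (h0 : τ 0 ≤ h) (h1 : h < τ 1)
    (x : State) : stateAt lam mu x τ h =
      flow lam mu (h - τ 0) (switchServer (flow lam mu (τ 0) x)) := by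
  have hcount : switchCount τ h = 1 := by
    have : {n : ℕ | switchTime τ (n + 1) ≤ h} = {0} := by
      ext n
      simp only [Set.mem_ofPred_eq, Set.mem_singleton_iff]
      constructor
      · intro hn
        by_contra hne
        have h2 : τ 1 ≤ switchTime τ (n + 1) :=
          Finset.single_le_sum (f := τ) (fun k _ => (hτ k).le)
            (by simp only [Finset.mem_range]; omega)
        linarith
      · rintro rfl
        simpa [switchTime] using h0
    rw [switchCount, this, Set.ncard_singleton]
  rw [stateAt, hcount]
  simp [switchTime, stateAtSwitch]

theorem isProbabilityMeasure_residenceLaw (hc : 0 < c) :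
    IsProbabilityMeasure (residenceLaw c) := by
  have := isProbabilityMeasure_expMeasure hc
  unfold residenceLaw
  infer_instance

theorem ae_pos_residenceLaw (hc : 0 < c) : ∀ᵐ τ ∂(residenceLaw c), ∀ k, 0 < τ k := by
  have := isProbabilityMeasure_expMeasure hc
  rw [ae_all_iff]
  intro k
  exact (measurePreserving_eval_infinitePi (fun _ : ℕ => expMeasure c) k).quasiMeasurePreserving.ae
    (ae_pos_expMeasure hc)

theorem measureReal_residenceLaw_le_one (hc : 0 < c) {h : ℝ} (hh : 0 ≤ h) :
    (residenceLaw c).real {τ | τ 0 ≤ h} = 1 - Real.exp (-(c * h)) := by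
  have := isProbabilityMeasure_expMeasure hc
  rw [← measureReal_expMeasure_Iic hc hh, measureReal_def, measureReal_def]
  congr 1
  exact (measurePreserving_eval_infinitePi (fun _ : ℕ => expMeasure c) 0).measure_preimage
    measurableSet_Iic.nullMeasurableSet

theorem measureReal_residenceLaw_le_two (hc : 0 < c) {h : ℝ} (hh : 0 ≤ h) :
    (residenceLaw c).real {τ | τ 0 ≤ h ∧ τ 1 ≤ h} ≤ (c * h) ^ 2 := by
  have := isProbabilityMeasure_expMeasure hc
  have e : {τ : ℕ → ℝ | τ 0 ≤ h ∧ τ 1 ≤ h} =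
      Set.pi (({0, 1} : Finset ℕ) : Set ℕ) fun _ => Set.Iic h := by
    ext τ; simp
  rw [e, measureReal_def, residenceLaw,
    Measure.infinitePi_pi _ (fun _ _ => measurableSet_Iic)]
  simp only [Finset.prod_const]
  rw [ENNReal.toReal_pow, ← measureReal_def]
  have h2 : ({0, 1} : Finset ℕ).card = 2 := rfl
  rw [h2]
  exact pow_le_pow_left₀ measureReal_nonneg (measureReal_expMeasure_Iic_le hc hh) 2

/-- Stationarity at a small time `h`, split according to the residence times: no switch (the flow),
one switch (the switched state, up to a displacement `mu * h`), or `τ 0` and `τ 1` both at most `h`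
(negligible). -/
theorem IsTimeStationary.approx {π : Measure State} [IsProbabilityMeasure π] (hc : 0 < c)
    (h0 : 0 ≤ lam) (h1 : lam ≤ mu) (hπ : IsTimeStationary lam mu c π) {f : State → ℂ} {K : ℝ}
    (hfm : Measurable f) (hf1 : ∀ x, ‖f x‖ ≤ 1)
    (hfL : ∀ x y : State, 0 ≤ x.1.1 ∧ 0 ≤ x.1.2 → 0 ≤ y.1.1 ∧ 0 ≤ y.1.2 → x.2 = y.2 → ∀ δ,
      |x.1.1 - y.1.1| ≤ δ → |x.1.2 - y.1.2| ≤ δ → ‖f x - f y‖ ≤ K * δ)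
    (hK : 0 ≤ K) {h : ℝ} (hh : 0 < h) :
    ‖∫ x, f x ∂π - Complex.exp (-(c * h)) * ∫ x, f (flow lam mu h x) ∂π -
      (1 - Complex.exp (-(c * h))) * ∫ x, f (switchServer x) ∂π‖ ≤
      (K * mu * c + 2 * c ^ 2) * h ^ 2 := by
  have := isProbabilityMeasure_residenceLaw hc
  have hmu : 0 ≤ mu := h0.trans h1
  set X : State × (ℕ → ℝ) → State := fun p => stateAt lam mu p.1 p.2 h with hX
  have hst := hπ.stationary h hh.le
  -- Measurability comes from stationarity itself: the image measure of a map that is not a.e.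
  -- measurable is `0` by convention, which is not a probability measure.
  have hXm : AEMeasurable X (π.prod (residenceLaw c)) := by
    by_contra hnot
    rw [Measure.map_of_not_aemeasurable hnot] at hst
    exact IsProbabilityMeasure.ne_zero π hst.symm
  have e1 : ∫ x, f x ∂π = ∫ p, f (X p) ∂(π.prod (residenceLaw c)) := by
    conv_lhs => rw [← hst]
    exact integral_map hXm hfm.aestronglyMeasurable
  have hA : MeasurableSet {τ : ℕ → ℝ | τ 0 ≤ h} := measurableSet_le (measurable_pi_apply 0) measurable_const
  have hB : MeasurableSet {τ : ℕ → ℝ | τ 0 ≤ h ∧ τ 1 ≤ h} :=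
    hA.inter (measurableSet_le (measurable_pi_apply 1) measurable_const)
  have hbdd : ∀ g : State → State, Measurable g → Integrable (fun x => f (g x)) π := fun g hg =>
    Integrable.mono' (integrable_const 1) (hfm.comp hg).aestronglyMeasurable
      (Eventually.of_forall fun x => hf1 _)
  have i1 := hbdd _ (measurable_flow (lam := lam) (mu := mu) h)
  have i2 := hbdd _ measurable_switchServer
  set u : (ℕ → ℝ) → ℂ := {τ : ℕ → ℝ | τ 0 ≤ h}.indicator 1 with hu
  set w : (ℕ → ℝ) → ℂ := {τ : ℕ → ℝ | τ 0 ≤ h}ᶜ.indicator 1 with hw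
  have iu : Integrable u (residenceLaw c) := (integrable_const (1 : ℂ)).indicator hA
  have iw : Integrable w (residenceLaw c) := (integrable_const (1 : ℂ)).indicator hA.compl
  have eu : ∫ τ, u τ ∂(residenceLaw c) = 1 - Complex.exp (-(c * h)) := by
    rw [hu, integral_indicator hA]
    simp only [Pi.one_apply]
    rw [setIntegral_const, measureReal_residenceLaw_le_one hc hh.le]
    simp
  have ew : ∫ τ, w τ ∂(residenceLaw c) = Complex.exp (-(c * h)) := by
    rw [hw, integral_indicator hA.compl]
    simp only [Pi.one_apply]
    rw [setIntegral_const, probReal_compl_eq_one_sub hA, measureReal_residenceLaw_le_one hc hh.le]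
    simp
  have iH1 := i1.mul_prod iw
  have iH2 := i2.mul_prod iu
  have iX : Integrable (fun p => f (X p)) (π.prod (residenceLaw c)) :=
    Integrable.mono' (integrable_const 1) (hfm.comp_aemeasurable hXm).aestronglyMeasurable
      (Eventually.of_forall fun x => hf1 _)
  have e2 : ∫ x, f x ∂π - Complex.exp (-(c * h)) * ∫ x, f (flow lam mu h x) ∂π -
      (1 - Complex.exp (-(c * h))) * ∫ x, f (switchServer x) ∂π =
      ∫ p, (f (X p) - f (flow lam mu h p.1) * w p.2 - f (switchServer p.1) * u p.2)
        ∂(π.prod (residenceLaw c)) := by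
    have i3 : Integrable (fun p => f (X p) - f (flow lam mu h p.1) * w p.2)
      (π.prod (residenceLaw c)) := iX.sub iH1
    rw [integral_sub i3 iH2, integral_sub iX iH1, integral_prod_mul (fun x => f (flow lam mu h x)) w,
      integral_prod_mul (fun x => f (switchServer x)) u, eu, ew, e1]
    ring
  -- The Lipschitz error `K * (mu * h)` occurs on an event of probability at most `c * h`; the crude
  -- bound `2` is spent on an event of probability at most `(c * h) ^ 2`.
  set bd : (ℕ → ℝ) → ℝ := fun τ => K * (mu * h) * {τ : ℕ → ℝ | τ 0 ≤ h}.indicator 1 τ +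
    2 * {τ : ℕ → ℝ | τ 0 ≤ h ∧ τ 1 ≤ h}.indicator 1 τ with hbd
  have ibd1 : Integrable (fun τ : ℕ → ℝ => K * (mu * h) *
      {τ : ℕ → ℝ | τ 0 ≤ h}.indicator (1 : (ℕ → ℝ) → ℝ) τ) (residenceLaw c) :=
    ((integrable_const (1 : ℝ)).indicator hA).const_mul _
  have ibd2 : Integrable (fun τ : ℕ → ℝ =>
      2 * {τ : ℕ → ℝ | τ 0 ≤ h ∧ τ 1 ≤ h}.indicator (1 : (ℕ → ℝ) → ℝ) τ) (residenceLaw c) :=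
    ((integrable_const (1 : ℝ)).indicator hB).const_mul _
  have ibd : Integrable (fun p : State × (ℕ → ℝ) => bd p.2) (π.prod (residenceLaw c)) :=
    (ibd1.add ibd2).comp_snd π
  have hpt : ∀ᵐ p ∂(π.prod (residenceLaw c)),
      ‖f (X p) - f (flow lam mu h p.1) * w p.2 - f (switchServer p.1) * u p.2‖ ≤ bd p.2 := by
    filter_upwards [Measure.quasiMeasurePreserving_fst.ae hπ.nonneg,
      Measure.quasiMeasurePreserving_snd.ae (ae_pos_residenceLaw hc)] with p hx hτ
    by_cases hA' : p.2 0 ≤ h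
    · have hmA : p.2 ∈ {τ : ℕ → ℝ | τ 0 ≤ h} := hA'
      have hu1 : u p.2 = 1 := Set.indicator_of_mem hmA _
      have hw1 : w p.2 = 0 := Set.indicator_of_notMem (by simpa using hA') _
      have hKmu : 0 ≤ K * (mu * h) := by positivity
      by_cases hB' : p.2 1 ≤ h
      · have hmB : p.2 ∈ {τ : ℕ → ℝ | τ 0 ≤ h ∧ τ 1 ≤ h} := ⟨hA', hB'⟩
        have hb : bd p.2 = K * (mu * h) + 2 := by
          simp only [hbd, Set.indicator_of_mem hmA, Set.indicator_of_mem hmB]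
          simp
        rw [hb, hu1, hw1, mul_zero, sub_zero, mul_one]
        have := norm_sub_le (f (X p)) (f (switchServer p.1))
        linarith [hf1 (X p), hf1 (switchServer p.1)]
      · have hmB : p.2 ∉ {τ : ℕ → ℝ | τ 0 ≤ h ∧ τ 1 ≤ h} := fun h => hB' h.2
        have hb : bd p.2 = K * (mu * h) := by
          simp only [hbd, Set.indicator_of_mem hmA, Set.indicator_of_notMem hmB]
          simp
        rw [hb, hu1, hw1, mul_zero, sub_zero, mul_one]
        simp only [hX]
        rw [stateAt_of_le_of_lt hτ hA' (not_le.1 hB')]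
        have hτ0 := (hτ 0).le
        have hs : 0 ≤ h - p.2 0 := sub_nonneg.2 hA'
        have n1 : 0 ≤ (switchServer (flow lam mu (p.2 0) p.1)).1.1 ∧
            0 ≤ (switchServer (flow lam mu (p.2 0) p.1)).1.2 := flow_nonneg h0 hτ0 hx
        have d1 := abs_flow_sub_le h0 h1 hτ0 hx
        have d2 := abs_flow_sub_le h0 h1 hs n1
        have hsum : mu * (h - p.2 0) + mu * p.2 0 = mu * h := by ring
        refine hfL _ (switchServer p.1) (flow_nonneg h0 hs n1) hx rfl _ ?_ ?_
        · rw [← hsum]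
          exact (abs_sub_le _ _ _).trans (add_le_add d2.1 d1.1)
        · rw [← hsum]
          exact (abs_sub_le _ _ _).trans (add_le_add d2.2 d1.2)
    · have hmA : p.2 ∉ {τ : ℕ → ℝ | τ 0 ≤ h} := hA'
      have hu1 : u p.2 = 0 := Set.indicator_of_notMem hmA _
      have hw1 : w p.2 = 1 := Set.indicator_of_mem (Set.mem_compl hmA) _
      have hmB : p.2 ∉ {τ : ℕ → ℝ | τ 0 ≤ h ∧ τ 1 ≤ h} := fun h => hA' h.1
      have hb : bd p.2 = 0 := by
        simp only [hbd, Set.indicator_of_notMem hmA, Set.indicator_of_notMem hmB]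
        simp
      have hXp : X p = flow lam mu h p.1 := stateAt_of_lt hτ (not_le.1 hA') _
      rw [hb, hu1, hw1, hXp]
      simp
  rw [e2]
  refine (norm_integral_le_of_norm_le ibd hpt).trans ?_
  rw [integral_fun_snd, probReal_univ, one_smul, hbd, integral_add ibd1 ibd2, integral_const_mul,
    integral_const_mul, integral_indicator_one hA, integral_indicator_one hB]
  have b1 : (residenceLaw c).real {τ | τ 0 ≤ h} ≤ c * h := by
    rw [measureReal_residenceLaw_le_one hc hh.le]
    linarith [Real.add_one_le_exp (-(c * h))]
  have b2 := measureReal_residenceLaw_le_two hc hh.le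
  calc _ ≤ K * (mu * h) * (c * h) + 2 * (c * h) ^ 2 := by gcongr
    _ = _ := by ring

end Time

/-! ### Balance equations at arbitrary epochs -/

section TimeBalance

open Complex

variable {lam mu c : ℝ} {π : Measure State}

/-- Conditional law of the workloads given the position of the server, when both positions have
probability `1 / 2`. -/
noncomputable def serverLaw (π : Measure State) (i : Fin 2) : Measure (ℝ × ℝ) :=
  (2 : ENNReal) • (π.restrict {x | x.2 = i}).map Prod.fst

theorem measurableSet_server (i : Fin 2) : MeasurableSet {x : State | x.2 = i} :=
  measurable_snd (measurableSet_singleton i)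

instance [IsFiniteMeasure π] (i : Fin 2) : IsFiniteMeasure (serverLaw π i) := by
  unfold serverLaw
  exact Measure.smul_finite _ ENNReal.ofNat_ne_top

theorem indicator_server_of_eq {x : State} {i : Fin 2} (h : x.2 = i) (g : State → ℂ) :
    {x : State | x.2 = i}.indicator g x = g x :=
  Set.indicator_of_mem (s := {x : State | x.2 = i}) h g

theorem indicator_server_of_ne {x : State} {i : Fin 2} (h : x.2 ≠ i) (g : State → ℂ) :
    {x : State | x.2 = i}.indicator g x = 0 :=
  Set.indicator_of_notMem (s := {x : State | x.2 = i}) h g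

theorem ae_serverLaw {p : ℝ × ℝ → Prop} (hp : MeasurableSet {v | p v}) (h : ∀ᵐ x ∂π, p x.1)
    (i : Fin 2) : ∀ᵐ v ∂(serverLaw π i), p v := by
  refine Measure.ae_smul_measure ?_ 2
  rw [ae_map_iff measurable_fst.aemeasurable hp]
  exact ae_restrict_of_ae h

theorem integral_serverLaw {g : ℝ × ℝ → ℂ} (hg : Measurable g) (i : Fin 2) :
    ∫ v, g v ∂(serverLaw π i) = 2 * ∫ x, {x : State | x.2 = i}.indicator (fun x => g x.1) x ∂π := by
  rw [serverLaw, integral_smul_measure, integral_map measurable_fst.aemeasurable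
    hg.aestronglyMeasurable, integral_indicator (measurableSet_server i)]
  simp

/-- The exponential test function restricted to one position of the server. -/
noncomputable def testFun (i : Fin 2) (α β : ℂ) : State → ℂ :=
  {x : State | x.2 = i ∧ 0 ≤ x.1.1 ∧ 0 ≤ x.1.2}.indicator
    fun x => exp (-(α * x.1.1 + β * x.1.2))

theorem testFun_of_nonneg (i : Fin 2) (α β : ℂ) {x : State} (hx : 0 ≤ x.1.1 ∧ 0 ≤ x.1.2) :
    testFun i α β x =
      {x : State | x.2 = i}.indicator (fun x => exp (-(α * x.1.1 + β * x.1.2))) x := by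
  unfold testFun
  by_cases hi : x.2 = i
  · rw [indicator_server_of_eq hi]
    exact Set.indicator_of_mem (s := {x : State | x.2 = i ∧ 0 ≤ x.1.1 ∧ 0 ≤ x.1.2}) ⟨hi, hx⟩ _
  · rw [indicator_server_of_ne hi]
    exact Set.indicator_of_notMem (s := {x : State | x.2 = i ∧ 0 ≤ x.1.1 ∧ 0 ≤ x.1.2})
      (fun h => hi h.1) _

theorem measurable_testFun (i : Fin 2) (α β : ℂ) : Measurable (testFun i α β) := by
  refine Measurable.indicator (by fun_prop) ?_
  exact (measurableSet_server i).inter (measurable_fst measurableSet_quadrant)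

/-- The restriction to the quadrant inside `testFun` makes this bound hold everywhere and not only
almost everywhere, as `IsTimeStationary.approx` demands. -/
theorem norm_testFun_le_one (i : Fin 2) {α β : ℂ} (hα : 0 ≤ α.re) (hβ : 0 ≤ β.re) (x : State) :
    ‖testFun i α β x‖ ≤ 1 := by
  unfold testFun
  by_cases hx : x ∈ {x : State | x.2 = i ∧ 0 ≤ x.1.1 ∧ 0 ≤ x.1.2}
  · rw [Set.indicator_of_mem hx]
    exact norm_exp_neg_le_one hα hβ hx.2
  · rw [Set.indicator_of_notMem hx]
    simp

theorem norm_testFun_sub_le (i : Fin 2) {α β : ℂ} (hα : 0 ≤ α.re) (hβ : 0 ≤ β.re) (x y : State)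
    (hx : 0 ≤ x.1.1 ∧ 0 ≤ x.1.2) (hy : 0 ≤ y.1.1 ∧ 0 ≤ y.1.2) (hxy : x.2 = y.2) (δ : ℝ)
    (h1 : |x.1.1 - y.1.1| ≤ δ) (h2 : |x.1.2 - y.1.2| ≤ δ) :
    ‖testFun i α β x - testFun i α β y‖ ≤ (‖α‖ + ‖β‖) * δ := by
  have hδ : 0 ≤ δ := (abs_nonneg _).trans h1
  rw [testFun_of_nonneg i α β hx, testFun_of_nonneg i α β hy]
  by_cases hi : x.2 = i
  · rw [indicator_server_of_eq hi,
      indicator_server_of_eq (hxy ▸ hi)]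
    exact norm_exp_neg_sub_le hα hβ hx hy h1 h2
  · rw [indicator_server_of_ne hi, indicator_server_of_ne (fun h => hi (hxy.trans h))]
    simp only [sub_self, norm_zero]
    positivity

theorem lap_serverLaw (hπ : ∀ᵐ x ∂π, 0 ≤ x.1.1 ∧ 0 ≤ x.1.2) (i : Fin 2) (α β : ℂ) :
    lap (serverLaw π i) α β = 2 * ∫ x, testFun i α β x ∂π := by
  rw [lap, integral_serverLaw (by fun_prop)]
  congr 1
  refine integral_congr_ae ?_
  filter_upwards [hπ] with x hx using (testFun_of_nonneg i α β hx).symm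

theorem lap_serverLaw_switch (hπ : ∀ᵐ x ∂π, 0 ≤ x.1.1 ∧ 0 ≤ x.1.2) (i : Fin 2) (α β : ℂ) :
    lap (serverLaw π (1 - i)) α β = 2 * ∫ x, testFun i α β (switchServer x) ∂π := by
  rw [lap, integral_serverLaw (by fun_prop)]
  congr 1
  refine integral_congr_ae ?_
  filter_upwards [hπ] with x hx
  have hx' : 0 ≤ (switchServer x).1.1 ∧ 0 ≤ (switchServer x).1.2 := hx
  rw [testFun_of_nonneg i α β hx']
  have hiff : x.2 = 1 - i ↔ 1 - x.2 = i := by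
    constructor
    · intro h; rw [h, sub_sub_cancel]
    · intro h; rw [← h, sub_sub_cancel]
  by_cases hi : x.2 = 1 - i
  · rw [indicator_server_of_eq hi,
      indicator_server_of_eq (x := switchServer x) (hiff.1 hi)]
    rfl
  · rw [indicator_server_of_ne hi, indicator_server_of_ne (x := switchServer x) (fun h => hi (hiff.2 h))]

variable [IsProbabilityMeasure π]

theorem IsTimeStationary.halfBalance_first (hc : 0 < c) (h0 : 0 ≤ lam) (h1 : lam ≤ mu)
    (hπ : IsTimeStationary lam mu c π) :
    HalfBalance lam mu c (serverLaw π 0) (serverLaw π 1) := by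
  refine halfBalance_of_approx h0 h1 (ae_serverLaw measurableSet_quadrant hπ.nonneg 0)
    fun α β hα hβ => ⟨2 * ((‖α‖ + ‖β‖) * mu * c + 2 * c ^ 2), fun h hh _ => ?_⟩
  have key := hπ.approx hc h0 h1 (measurable_testFun 0 α β) (norm_testFun_le_one 0 hα hβ)
    (norm_testFun_sub_le 0 hα hβ) (by positivity) hh
  have e1 : ∫ v, exp (-(α * (serveFirst lam mu h v).1 + β * (serveFirst lam mu h v).2))
      ∂(serverLaw π 0) = 2 * ∫ x, testFun 0 α β (flow lam mu h x) ∂π := by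
    rw [integral_serverLaw (g := fun v : ℝ × ℝ =>
        exp (-(α * (serveFirst lam mu h v).1 + β * (serveFirst lam mu h v).2)))
      ((by fun_prop : Measurable fun w : ℝ × ℝ => exp (-(α * w.1 + β * w.2))).comp
        (measurable_serveFirst h))]
    congr 1
    refine integral_congr_ae ?_
    filter_upwards [hπ.nonneg] with x hx
    rw [testFun_of_nonneg 0 α β (flow_nonneg h0 hh.le hx)]
    by_cases hi : x.2 = 0
    · rw [indicator_server_of_eq hi,
        indicator_server_of_eq (x := flow lam mu h x) hi, flow, if_pos hi]
    · rw [indicator_server_of_ne hi, indicator_server_of_ne (x := flow lam mu h x) hi]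
  have e2 := lap_serverLaw_switch hπ.nonneg 0 α β
  rw [sub_zero] at e2
  rw [lap_serverLaw hπ.nonneg, e1, e2]
  refine le_trans (le_of_eq ?_) ((mul_le_mul_of_nonneg_left key zero_le_two).trans_eq (by ring))
  rw [← Complex.norm_two, ← norm_mul]
  congr 1
  ring

theorem IsTimeStationary.halfBalance_second (hc : 0 < c) (h0 : 0 ≤ lam) (h1 : lam ≤ mu)
    (hπ : IsTimeStationary lam mu c π) :
    HalfBalance lam mu c ((serverLaw π 1).map Prod.swap) ((serverLaw π 0).map Prod.swap) := by
  refine halfBalance_of_approx h0 h1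
    (nonneg_map_swap (ae_serverLaw measurableSet_quadrant hπ.nonneg 1))
    fun α β hα hβ => ⟨2 * ((‖β‖ + ‖α‖) * mu * c + 2 * c ^ 2), fun h hh _ => ?_⟩
  have key := hπ.approx hc h0 h1 (measurable_testFun 1 β α) (norm_testFun_le_one 1 hβ hα)
    (norm_testFun_sub_le 1 hβ hα) (by positivity) hh
  have hm : Measurable fun v : ℝ × ℝ =>
      exp (-(α * (serveFirst lam mu h v).1 + β * (serveFirst lam mu h v).2)) :=
    (by fun_prop : Measurable fun w : ℝ × ℝ => exp (-(α * w.1 + β * w.2))).comp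
        (measurable_serveFirst h)
  have e1 : ∫ v, exp (-(α * (serveFirst lam mu h v).1 + β * (serveFirst lam mu h v).2))
      ∂((serverLaw π 1).map Prod.swap) = 2 * ∫ x, testFun 1 β α (flow lam mu h x) ∂π := by
    rw [integral_map measurable_swap.aemeasurable hm.aestronglyMeasurable,
      integral_serverLaw (g := fun v : ℝ × ℝ => exp (-(α * (serveFirst lam mu h v.swap).1 +
        β * (serveFirst lam mu h v.swap).2))) (hm.comp measurable_swap)]
    congr 1
    refine integral_congr_ae ?_
    filter_upwards [hπ.nonneg] with x hx
    rw [testFun_of_nonneg 1 β α (flow_nonneg h0 hh.le hx)]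
    by_cases hi : x.2 = 1
    · have hi0 : x.2 ≠ 0 := by rw [hi]; exact one_ne_zero
      rw [indicator_server_of_eq hi,
        indicator_server_of_eq (x := flow lam mu h x) hi, flow,
        if_neg hi0]
      simp only [serveSecond_eq_swap, Prod.fst_swap, Prod.snd_swap]
      rw [add_comm]
    · rw [indicator_server_of_ne hi, indicator_server_of_ne (x := flow lam mu h x) hi]
  have e2 := lap_serverLaw_switch hπ.nonneg 1 β α
  rw [sub_self] at e2
  rw [lap_map_swap, lap_map_swap, lap_serverLaw hπ.nonneg, e1, e2]
  refine le_trans (le_of_eq ?_) ((mul_le_mul_of_nonneg_left key zero_le_two).trans_eq (by ring))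
  rw [← Complex.norm_two, ← norm_mul]
  congr 1
  ring

/-- The balance equation at `α = β = 0` equates the masses of the two server positions, so each has
probability `1 / 2` and the factor `2` in `serverLaw` normalizes. -/
theorem IsTimeStationary.isProbabilityMeasure_serverLaw (hc : 0 < c) (h0 : 0 ≤ lam)
    (h1 : lam ≤ mu) (hπ : IsTimeStationary lam mu c π) (i : Fin 2) :
    IsProbabilityMeasure (serverLaw π i) := by
  have h := hπ.halfBalance_first hc h0 h1 0 0 (by simp) (by simp)
  have hc' : (c : ℂ) ≠ 0 := by exact_mod_cast hc.ne'
  have huniv : ∀ i, lap (serverLaw π i) 0 0 = ((serverLaw π i).real Set.univ : ℂ) := by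
    intro i
    simp [lap]
  simp only [zero_mul, add_zero] at h
  have h2 := mul_left_cancel₀ hc' h
  rw [huniv, huniv, Complex.ofReal_inj] at h2
  have hmass : ∀ i, (serverLaw π i).real Set.univ = 2 * π.real {x | x.2 = i} := by
    intro i
    rw [measureReal_def, serverLaw, Measure.smul_apply,
      Measure.map_apply measurable_fst MeasurableSet.univ, Set.preimage_univ,
      Measure.restrict_apply_univ, smul_eq_mul, ENNReal.toReal_mul, measureReal_def]
    simp
  have hcompl : π.real {x | x.2 = 0} + π.real {x | x.2 = 1} = 1 := by
    have := probReal_add_probReal_compl (μ := π) (measurableSet_server 0)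
    rw [← this]
    congr 2
    ext x
    simp only [Set.mem_ofPred_eq, Set.mem_compl_iff]
    omega
  have hone : (serverLaw π i).real Set.univ = 1 := by
    rw [hmass, hmass] at h2
    rw [hmass]
    fin_cases i
    · change 2 * π.real {x | x.2 = 0} = 1
      linarith
    · change 2 * π.real {x | x.2 = 1} = 1
      linarith
  exact ⟨by rwa [measureReal_def, ENNReal.toReal_eq_one_iff] at hone⟩

theorem IsTimeStationary.balance (hc : 0 < c) (h0 : 0 ≤ lam) (h1 : lam ≤ mu)
    (hπ : IsTimeStationary lam mu c π) :
    Balance lam mu c (serverLaw π 0) (serverLaw π 1) where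
  prob_left := hπ.isProbabilityMeasure_serverLaw hc h0 h1 0
  prob_right := hπ.isProbabilityMeasure_serverLaw hc h0 h1 1
  nonneg_left := ae_serverLaw measurableSet_quadrant hπ.nonneg 0
  nonneg_right := ae_serverLaw measurableSet_quadrant hπ.nonneg 1
  first := hπ.halfBalance_first hc h0 h1
  second := hπ.halfBalance_second hc h0 h1

theorem lap_map_fst (hπ : ∀ᵐ x ∂π, 0 ≤ x.1.1 ∧ 0 ≤ x.1.2) {α β : ℂ} (hα : 0 ≤ α.re)
    (hβ : 0 ≤ β.re) : lap (π.map Prod.fst) α β =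
      (lap (serverLaw π 0) α β + lap (serverLaw π 1) α β) / 2 := by
  have hint : ∀ i, Integrable (testFun i α β) π := fun i =>
    Integrable.mono' (integrable_const 1) (measurable_testFun i α β).aestronglyMeasurable
      (Eventually.of_forall (norm_testFun_le_one i hα hβ))
  rw [lap_serverLaw hπ, lap_serverLaw hπ, ← mul_add, mul_div_cancel_left₀ _ two_ne_zero,
    ← integral_add (hint 0) (hint 1), lap, integral_map measurable_fst.aemeasurable (by fun_prop)]
  refine integral_congr_ae ?_
  filter_upwards [hπ] with x hx
  rw [testFun_of_nonneg 0 α β hx, testFun_of_nonneg 1 α β hx]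
  by_cases hi : x.2 = 0
  · have hi1 : x.2 ≠ 1 := by rw [hi]; exact zero_ne_one
    rw [indicator_server_of_eq hi,
      indicator_server_of_ne hi1, add_zero]
  · have hi1 : x.2 = 1 := by omega
    rw [indicator_server_of_ne hi, indicator_server_of_eq hi1, zero_add]

end TimeBalance

/-! ### Marginals, kernel equation and heavy-traffic limit of the equations -/

section HeavyTraffic

open Complex

variable {lam mu c : ℝ} {M N : Measure (ℝ × ℝ)}

/-- During a visit to queue 2 the first workload only gains `lam` times an independent exponential
time, whose transform is `c / (c + α * lam)`. -/
theorem Balance.lap_right_left (h : Balance lam mu c M N) {α : ℂ} (hα : 0 ≤ α.re) :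
    (c + α * lam) * lap N α 0 = c * lap M α 0 := by
  have := h.second 0 α (by simp) hα
  rw [lap_map_swap, lap_map_swap] at this
  linear_combination this

/-- The probability that queue 1 is empty, from conservation of work: add the two equations at `(t,
0)`, divide by `t` and let `t → 0`. -/
theorem Balance.boundaryLap_zero (h : Balance lam mu c M N) :
    (mu - lam) * boundaryLap M 0 = mu - 2 * lam := by
  have := h.prob_left
  have := h.prob_right
  have hcont : ∀ K : Measure (ℝ × ℝ), IsProbabilityMeasure K → (∀ᵐ v ∂K, 0 ≤ v.1 ∧ 0 ≤ v.2) →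
      Tendsto (fun t : ℝ => lap K t 0) (𝓝[>] 0) (𝓝 1) := by
    intro K _ hK
    have h1 : ContinuousOn (fun t : ℝ => lap K t 0) (Set.Ici 0) :=
      (continuousOn_lap hK).comp (f := fun t : ℝ => ((t : ℂ), (0 : ℂ))) (by fun_prop)
        fun t ht => ⟨by simpa using ht, by simp⟩
    have h2 := (h1 0 (by simp)).mono_left (nhdsWithin_mono _ Set.Ioi_subset_Ici_self)
    simpa [lap_zero_zero] using h2
  have hlim := ((hcont M h.prob_left h.nonneg_left).const_mul ((mu : ℂ) - lam)).sub
    ((hcont N h.prob_right h.nonneg_right).const_mul (lam : ℂ))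
  have hconst : Tendsto (fun t : ℝ => ((mu : ℂ) - lam) * lap M t 0 - lam * lap N t 0) (𝓝[>] 0)
      (𝓝 ((mu - lam) * boundaryLap M 0)) := by
    refine tendsto_const_nhds.congr' ?_
    filter_upwards [self_mem_nhdsWithin] with t ht
    have ht' : (t : ℂ) ≠ 0 := by exact_mod_cast (ne_of_gt ht)
    have htre : 0 ≤ (t : ℂ).re := by simpa using le_of_lt ht
    have e1 := h.first t 0 htre (by simp)
    have e2 := h.lap_right_left htre
    refine mul_left_cancel₀ ht' ?_
    linear_combination e1 + e2
  rw [tendsto_nhds_unique hconst hlim]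
  ring

theorem norm_boundaryLap_le [IsFiniteMeasure M] (hM : ∀ᵐ v ∂M, 0 ≤ v.1 ∧ 0 ≤ v.2) {β : ℂ}
    (hβ : 0 ≤ β.re) : ‖boundaryLap M β‖ ≤ ‖boundaryLap M 0‖ := by
  have h0 : boundaryLap M 0 = (M.real {v : ℝ × ℝ | v.1 = 0} : ℂ) := by
    simp [boundaryLap, measureReal_def]
  have h1 : ∀ᵐ v ∂(M.restrict {v : ℝ × ℝ | v.1 = 0}), ‖exp (-(β * v.2))‖ ≤ 1 := by
    filter_upwards [ae_restrict_of_ae hM] with v hv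
    simpa using norm_exp_neg_le_one (α := 0) (by simp) hβ hv
  have h2 := norm_integral_le_of_norm_le_const h1
  rw [measureReal_restrict_apply_univ, one_mul] at h2
  rw [h0, Complex.norm_real, Real.norm_of_nonneg measureReal_nonneg]
  exact h2

theorem Balance.norm_boundaryLap_le (h : Balance lam mu c M N) (hlam : 2 * lam < mu)
    (hlam0 : 0 ≤ lam) {β : ℂ} (hβ : 0 ≤ β.re) :
    ‖boundaryLap M β‖ ≤ (mu - 2 * lam) / (mu - lam) := by
  have := h.prob_left
  refine (FluidPolling.norm_boundaryLap_le h.nonneg_left hβ).trans (le_of_eq ?_)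
  have hpos : 0 < mu - lam := by linarith
  have e := congrArg norm h.boundaryLap_zero
  have e1 : ‖(mu : ℂ) - lam‖ = mu - lam := by
    rw [← ofReal_sub, Complex.norm_real, Real.norm_of_nonneg hpos.le]
  have e2 : ‖(mu : ℂ) - 2 * lam‖ = mu - 2 * lam := by
    have : (mu : ℂ) - 2 * lam = ((mu - 2 * lam : ℝ) : ℂ) := by push_cast; ring
    rw [this, Complex.norm_real, Real.norm_of_nonneg (by linarith)]
  rw [norm_mul, e1, e2] at e
  rw [eq_div_iff hpos.ne', ← e, mul_comm]

/-- The marginal transforms are explicit. -/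
theorem Balance.lap_left_marginal (h : Balance lam mu c M N) {t : ℝ} (ht : 0 < t) :
    ((mu - 2 * lam) * c + (mu - lam) * lam * t) * lap M t 0 =
      (mu - 2 * lam) * (c + lam * t) := by
  have ht' : (t : ℂ) ≠ 0 := by exact_mod_cast ht.ne'
  have htre : 0 ≤ (t : ℂ).re := by simpa using ht.le
  have e1 := h.first t 0 htre (by simp)
  have e2 := h.lap_right_left htre
  have e3 := h.boundaryLap_zero
  refine mul_left_cancel₀ ht' ?_
  linear_combination -(c + t * lam) * e1 + t * (c + lam * t) * e3 - c * e2

theorem norm_one_sub_ratio_le {a b d x : ℝ} {z : ℂ} (ha : 0 < a) (hb : 0 ≤ b) (hx : 0 ≤ x)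
    (hxb : x ≤ b) (hd : b / a ≤ d) (h : ((a : ℂ) + b) * z = a + x) : ‖1 - z‖ ≤ d := by
  have hab : 0 < a + b := by linarith
  have hab' : (a : ℂ) + b ≠ 0 := by exact_mod_cast hab.ne'
  have e : 1 - z = (((b - x) / (a + b) : ℝ) : ℂ) := by
    push_cast
    rw [eq_div_iff hab']
    linear_combination -h
  rw [e, Complex.norm_real, Real.norm_of_nonneg (div_nonneg (by linarith) hab.le)]
  refine le_trans ?_ hd
  rw [div_le_div_iff₀ hab ha]
  nlinarith

/-- By the explicit marginals the deviation from `1` is at most `(mu - lam) * lam * (ε * t) / ((mu -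
2 * lam) * c)`. Since `mu - 2 * lam = 2 * ε * mu`, the factor `ε` cancels and the bound is uniform,
which is what tightness needs. -/
theorem Balance.norm_one_sub_lap_le (hc : 0 < c) (hmu : 0 < mu) {ε : ℝ} (hε0 : 0 < ε)
    (hε : ε < 1 / 2) (h : Balance ((1 / 2 - ε) * mu) mu c M N) {t : ℝ} (ht : 0 < t) :
    ‖1 - lap M (ε * t) 0‖ ≤ mu / (4 * c) * t ∧ ‖1 - lap N (ε * t) 0‖ ≤ mu / (4 * c) * t := by
  set lam := (1 / 2 - ε) * mu with hlam
  have hlam0 : 0 < lam := mul_pos (by linarith) hmu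
  have hs : 0 < ε * t := mul_pos hε0 ht
  have e1 := h.lap_left_marginal hs
  have e2 := h.lap_right_left (α := ((ε * t : ℝ) : ℂ)) (by simpa using hs.le)
  have hgap : mu - 2 * lam = 2 * ε * mu := by rw [hlam]; ring
  have hml : mu - lam ≤ mu := by linarith
  have hml0 : 0 < mu - lam := by rw [hlam]; nlinarith
  have hlm : lam ≤ mu / 2 := by rw [hlam]; nlinarith
  have ha : 0 < (mu - 2 * lam) * c := by rw [hgap]; positivity
  have hb : 0 ≤ (mu - lam) * lam * (ε * t) := by positivity
  have hd : (mu - lam) * lam * (ε * t) / ((mu - 2 * lam) * c) ≤ mu / (4 * c) * t := by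
    rw [hgap, div_le_iff₀ (by positivity)]
    calc (mu - lam) * lam * (ε * t) ≤ mu * (mu / 2) * (ε * t) := by gcongr
      _ = _ := by field_simp; ring
  have hgapC : (mu : ℂ) - 2 * lam = ((mu - 2 * lam : ℝ) : ℂ) := by push_cast; ring
  rw [← ofReal_mul]
  constructor
  · refine norm_one_sub_ratio_le (x := (mu - 2 * lam) * (lam * (ε * t))) ha hb ?_ ?_ hd ?_
    · rw [hgap]; positivity
    · have : mu - 2 * lam ≤ mu - lam := by linarith
      rw [mul_assoc (mu - lam)]
      exact mul_le_mul_of_nonneg_right this (by positivity)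
    · push_cast at e1 ⊢
      linear_combination e1
  · refine norm_one_sub_ratio_le (x := 0) ha hb le_rfl hb hd ?_
    have hne : (c : ℂ) + ((ε * t : ℝ) : ℂ) * lam ≠ 0 := by
      have : 0 < c + ε * t * lam := by positivity
      exact_mod_cast this.ne'
    refine mul_left_cancel₀ hne ?_
    push_cast at e1 e2 ⊢
    linear_combination ((mu - 2 * lam) * c + (mu - lam) * lam * (ε * t)) * e2 + c * e1

/-- The bound is linear in the arguments, so at arguments scaled by `ε` the two laws become
indistinguishable; this is why the limit does not depend on the kind of epochs. -/
theorem Balance.norm_lap_sub_lap_le (hc : 0 < c) (h : Balance lam mu c M N) (h0 : 0 ≤ lam)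
    (h1 : lam ≤ mu) {α β : ℂ} (hα : 0 ≤ α.re) (hβ : 0 ≤ β.re) :
    ‖lap M α β - lap N α β‖ ≤ (2 * ‖α‖ + ‖β‖) * mu / c := by
  have := h.prob_left
  have hmu : 0 ≤ mu := h0.trans h1
  have e := h.first α β hα hβ
  have hc' : (c : ℂ) ≠ 0 := by exact_mod_cast hc.ne'
  have e1 : lap M α β - lap N α β =
      (α * (lam - mu) * (boundaryLap M β - lap M α β) - β * lam * lap M α β) / c := by
    rw [eq_div_iff hc']
    linear_combination e
  have hB : ‖boundaryLap M β‖ ≤ 1 := by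
    refine (FluidPolling.norm_boundaryLap_le h.nonneg_left hβ).trans ?_
    have h2 : boundaryLap M 0 = (M.real {v : ℝ × ℝ | v.1 = 0} : ℂ) := by
      simp [boundaryLap, measureReal_def]
    rw [h2, Complex.norm_real, Real.norm_of_nonneg measureReal_nonneg]
    exact measureReal_le_one
  have hL := norm_lap_le_one h.nonneg_left hα hβ
  have hlm : ‖(lam : ℂ) - mu‖ ≤ mu := by
    rw [← ofReal_sub, Complex.norm_real, Real.norm_eq_abs, abs_le]
    constructor <;> linarith
  have hl : ‖(lam : ℂ)‖ ≤ mu := by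
    rw [Complex.norm_real, Real.norm_of_nonneg h0]; exact h1
  rw [e1, norm_div, Complex.norm_real, Real.norm_of_nonneg hc.le]
  gcongr
  calc _ ≤ ‖α‖ * ‖(lam : ℂ) - mu‖ * ‖boundaryLap M β - lap M α β‖ + ‖β‖ * ‖(lam : ℂ)‖ * ‖lap M α β‖ := by
        refine (norm_sub_le _ _).trans ?_
        simp only [norm_mul]
        exact le_rfl
    _ ≤ ‖α‖ * mu * (1 + 1) + ‖β‖ * mu * 1 := by
        gcongr
        exact (norm_sub_le _ _).trans (add_le_add hB hL)
    _ = _ := by ring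

/-- Elimination of `lap N α β` between the two balance equations. -/
theorem Balance.kernel_eq (h : Balance lam mu c M N) {α β : ℂ} (hα : 0 ≤ α.re) (hβ : 0 ≤ β.re) :
    (c * ((2 * lam - mu) * (α + β)) +
        (α * (lam - mu) + β * lam) * (α * lam + β * (lam - mu))) * lap M α β =
      (lam - mu) * (α * (c + (α * lam + β * (lam - mu))) * boundaryLap M β +
        c * β * boundaryLap (N.map Prod.swap) α) := by
  have e1 := h.first α β hα hβ
  have e2 := h.second β α hβ hα
  rw [lap_map_swap, lap_map_swap] at e2
  linear_combination (c + (α * lam + β * (lam - mu))) * e1 + c * e2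

/-- The scaled balance equations converge to the limit equation. -/
theorem exists_limitEquation (hmu : 0 < mu) (hc : 0 < c) {ε : ℕ → ℝ} (hε0 : ∀ n, 0 < ε n)
    (hε1 : ∀ n, ε n < 1 / 2) (hε : Tendsto ε atTop (𝓝 0)) {M N : ℕ → Measure (ℝ × ℝ)}
    (hB : ∀ n, Balance ((1 / 2 - ε n) * mu) mu c (M n) (N n)) {Q : Measure (ℝ × ℝ)}
    (hQ : ∀ᵐ v ∂Q, 0 ≤ v.1 ∧ 0 ≤ v.2)
    (hlim : ∀ α β : ℂ, 0 ≤ α.re → 0 ≤ β.re →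
      Tendsto (fun n => lap (M n) (ε n * α) (ε n * β)) atTop (𝓝 (lap Q α β))) :
    ∃ g₁ g₂ : ℂ → ℂ, LimitEquation (mu / (8 * c)) Q g₁ g₂ := by
  set G₁ : ℕ → ℂ → ℂ := fun n β => boundaryLap (M n) (ε n * β) / (4 * ε n) with hG₁
  set G₂ : ℕ → ℂ → ℂ := fun n α => boundaryLap ((N n).map Prod.swap) (ε n * α) / (4 * ε n) with hG₂
  have hεre : ∀ n (z : ℂ), 0 ≤ z.re → 0 ≤ (ε n * z).re := by
    intro n z hz
    rw [re_ofReal_mul]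
    exact mul_nonneg (hε0 n).le hz
  have hbound : ∀ n (K L : Measure (ℝ × ℝ)), Balance ((1 / 2 - ε n) * mu) mu c K L →
      ∀ z : ℂ, 0 ≤ z.re → ‖boundaryLap K (ε n * z) / (4 * ε n)‖ ≤ 1 := by
    intro n K L hKL z hz
    have h0 := hε0 n
    have h1 := hε1 n
    have hb := hKL.norm_boundaryLap_le (by nlinarith) (mul_nonneg (by linarith) hmu.le)
      (hεre n z hz)
    have h4 : ‖(4 * ε n : ℂ)‖ = 4 * ε n := by
      rw [norm_mul, Complex.norm_real, Real.norm_of_nonneg h0.le]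
      norm_num
    rw [norm_div, h4, div_le_one (by positivity)]
    refine hb.trans ?_
    rw [div_le_iff₀ (by nlinarith)]
    nlinarith [mul_pos h0 hmu, mul_pos (mul_pos h0 h0) hmu]
  have hG₁b : ∀ n z, 0 ≤ z.re → ‖G₁ n z‖ ≤ 1 := fun n z hz => hbound n _ _ (hB n) z hz
  have hG₂b : ∀ n z, 0 ≤ z.re → ‖G₂ n z‖ ≤ 1 := fun n z hz => hbound n _ _ (hB n).swap z hz
  set R : ℂ → ℂ → ℂ := fun α β => (α + β + ((mu / (8 * c) : ℝ) : ℂ) * (α - β) ^ 2) * lap Q α β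
    with hR
  have hεC : Tendsto (fun n => (ε n : ℂ)) atTop (𝓝 0) := by
    have := (Complex.continuous_ofReal.tendsto 0).comp hε
    rwa [ofReal_zero] at this
  have hmuC : (mu : ℂ) ≠ 0 := by exact_mod_cast hmu.ne'
  have hcC : (c : ℂ) ≠ 0 := by exact_mod_cast hc.ne'
  have hkey : ∀ α β : ℂ, 0 ≤ α.re → 0 ≤ β.re →
      Tendsto (fun n => α * G₁ n β + β * G₂ n α) atTop (𝓝 (R α β)) := by
    intro α β hα hβ
    set b : ℕ → ℂ := fun n => α * ((1 / 2 - ε n) * mu) + β * ((1 / 2 - ε n) * mu - mu) with hb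
    set a : ℕ → ℂ := fun n => α * ((1 / 2 - ε n) * mu - mu) + β * ((1 / 2 - ε n) * mu) with ha
    have hhalf : Tendsto (fun n => ((1 : ℂ) / 2 - ε n) * mu) atTop (𝓝 ((1 / 2 - 0) * mu)) :=
      (hεC.const_sub _).mul_const _
    have hblim : Tendsto b atTop (𝓝 (α * ((1 / 2 - 0) * mu) + β * ((1 / 2 - 0) * mu - mu))) :=
      (hhalf.const_mul α).add ((hhalf.sub_const _).const_mul β)
    have halim : Tendsto a atTop (𝓝 (α * ((1 / 2 - 0) * mu - mu) + β * ((1 / 2 - 0) * mu))) :=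
      ((hhalf.sub_const _).const_mul α).add (hhalf.const_mul β)
    have hden : ∀ n, ((1 / 2 - ε n) * mu - mu : ℂ) ≠ 0 := by
      intro n
      have : (1 / 2 - ε n) * mu - mu < 0 := by nlinarith [hε0 n]
      have h2 := ofReal_ne_zero.2 this.ne
      push_cast at h2
      exact h2
    -- The kernel equation at scaled arguments, divided by `ε²`. In the limit `a * b` is `-(mu²/4)
    -- (α - β)²` and the denominator is `-2 * mu * c`, whence the coefficient `mu / (8 * c)`.
    have heq : ∀ n, α * G₁ n β + β * G₂ n α =
        (-(2 * mu * c * (α + β)) + a n * b n) * lap (M n) (ε n * α) (ε n * β) /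
          (4 * ((1 / 2 - ε n) * mu - mu) * c) - ε n * (α * b n * G₁ n β / c) := by
      intro n
      have hεn : (ε n : ℂ) ≠ 0 := by exact_mod_cast (hε0 n).ne'
      have hk := (hB n).kernel_eq (hεre n α hα) (hεre n β hβ)
      have hdn := hden n
      have e1 : boundaryLap (M n) (ε n * β) = 4 * ε n * G₁ n β := by
        simp only [hG₁]; field_simp
      have e2 : boundaryLap ((N n).map Prod.swap) (ε n * α) = 4 * ε n * G₂ n α := by
        simp only [hG₂]; field_simp
      rw [e1, e2] at hk
      push_cast at hk
      have hk2 : (-(2 * mu * c * (α + β)) + a n * b n) * lap (M n) (ε n * α) (ε n * β) =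
          4 * ((1 / 2 - ε n) * mu - mu) *
            (α * (c + ε n * b n) * G₁ n β + c * β * G₂ n α) := by
        refine mul_left_cancel₀ (pow_ne_zero 2 hεn) ?_
        simp only [ha, hb]
        linear_combination hk
      rw [hk2]
      generalize ((1 : ℂ) / 2 - ε n) * mu - mu = X at hdn
      generalize b n = Y
      field_simp
      ring
    have hsmall : Tendsto (fun n => ε n * (α * b n * G₁ n β / c)) atTop (𝓝 0) := by
      have hbb : Tendsto (fun n => (ε n : ℂ) * (α * b n / c)) atTop (𝓝 0) := by
        simpa using hεC.mul ((hblim.const_mul α).div_const (c : ℂ))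
      refine squeeze_zero_norm (fun n => ?_) (tendsto_zero_iff_norm_tendsto_zero.1 hbb)
      have : ε n * (α * b n * G₁ n β / c) = (ε n : ℂ) * (α * b n / c) * G₁ n β := by ring
      rw [this, norm_mul]
      exact mul_le_of_le_one_right (norm_nonneg _) (hG₁b n β hβ)
    have hden0 : (4 * ((1 / 2 - 0) * mu - mu) * c : ℂ) ≠ 0 := by
      have : (4 * ((1 / 2 - 0) * mu - mu) * c : ℂ) = -(2 * mu * c) := by ring
      rw [this]
      simp [hmuC, hcC]
    have hmain := ((((halim.mul hblim).const_add (-(2 * mu * c * (α + β)))).mul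
      (hlim α β hα hβ)).div (((hhalf.sub_const (mu : ℂ)).const_mul 4).mul_const (c : ℂ)) hden0).sub
      hsmall
    have e : R α β = (-(2 * mu * c * (α + β)) +
        (α * ((1 / 2 - 0) * mu - mu) + β * ((1 / 2 - 0) * mu)) *
        (α * ((1 / 2 - 0) * mu) + β * ((1 / 2 - 0) * mu - mu))) * lap Q α β /
          (4 * ((1 / 2 - 0) * mu - mu) * c) - 0 := by
      rw [sub_zero, eq_div_iff hden0]
      simp only [hR]
      push_cast
      field_simp
      ring
    rw [e]
    exact hmain.congr fun n => (heq n).symm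
  -- Convergence of the single bounded sequence `G₂ n 1` suffices: with `α = 1` the limit relation
  -- then forces convergence of `G₁` everywhere, and with `β = 1` that of `G₂`.
  obtain ⟨γ, -, ψ, hψ, hγ⟩ := tendsto_subseq_of_bounded (Metric.isBounded_closedBall (x := (0 : ℂ)) (r := 1))
    (x := fun n => G₂ n 1) fun n => by simpa using hG₂b n 1 (by simp)
  have hkey' : ∀ α β : ℂ, 0 ≤ α.re → 0 ≤ β.re →
      Tendsto (fun n => α * G₁ (ψ n) β + β * G₂ (ψ n) α) atTop (𝓝 (R α β)) := fun α β hα hβ =>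
    (hkey α β hα hβ).comp hψ.tendsto_atTop
  have h₁ : ∀ β : ℂ, 0 ≤ β.re →
      Tendsto (fun n => G₁ (ψ n) β) atTop (𝓝 (R 1 β - β * γ)) := by
    intro β hβ
    refine ((hkey' 1 β (by simp) hβ).sub (hγ.const_mul β)).congr fun n => ?_
    simp only [Function.comp]
    ring
  have h₂ : ∀ α : ℂ, 0 ≤ α.re →
      Tendsto (fun n => G₂ (ψ n) α) atTop (𝓝 (R α 1 - α * (R 1 1 - 1 * γ))) := by
    intro α hα
    refine ((hkey' α 1 hα (by simp)).sub ((h₁ 1 (by simp)).const_mul α)).congr fun n => ?_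
    ring
  refine ⟨fun β => R 1 β - β * γ, fun α => R α 1 - α * (R 1 1 - 1 * γ), hQ, ⟨1, fun z hz => ?_⟩,
    ⟨1, fun z hz => ?_⟩, fun α β hα hβ => ?_⟩
  · exact le_of_tendsto (h₁ z hz).norm (Eventually.of_forall fun n => hG₁b _ z hz)
  · exact le_of_tendsto (h₂ z hz).norm (Eventually.of_forall fun n => hG₂b _ z hz)
  · exact tendsto_nhds_unique (hkey' α β hα hβ)
      (((h₁ β hβ).const_mul α).add ((h₂ α hα).const_mul β))

end HeavyTraffic

/-! ### Tightness and convergence in distribution -/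

section Convergence

variable {lam mu c : ℝ}

/-- The law `K` is a mixture of the laws of the workloads at the two kinds of switching epochs of
the stationary model. -/
structure StationaryWorkload (lam mu c : ℝ) (K : Measure (ℝ × ℝ)) : Prop where
  prob : IsProbabilityMeasure K
  nonneg : ∀ᵐ v ∂K, 0 ≤ v.1 ∧ 0 ≤ v.2
  mixture : ∃ M N : Measure (ℝ × ℝ), Balance lam mu c M N ∧ ∃ θ : ℝ, 0 ≤ θ ∧ θ ≤ 1 ∧
    ∀ α β : ℂ, 0 ≤ α.re → 0 ≤ β.re → lap K α β = θ * lap M α β + (1 - θ) * lap N α β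

theorem IsCycleStationary.stationaryWorkload (hc : 0 < c) (h0 : 0 ≤ lam) (h1 : lam ≤ mu)
    {ν : Measure (ℝ × ℝ)} [IsProbabilityMeasure ν] (h : IsCycleStationary lam mu c ν) :
    StationaryWorkload lam mu c ν where
  prob := ‹_›
  nonneg := h.nonneg
  mixture := ⟨_, _, h.balance hc h0 h1, 0, le_rfl, zero_le_one, fun α β _ _ => by simp⟩

theorem IsTimeStationary.stationaryWorkload (hc : 0 < c) (h0 : 0 ≤ lam) (h1 : lam ≤ mu)
    {π : Measure State} [IsProbabilityMeasure π] (h : IsTimeStationary lam mu c π) :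
    StationaryWorkload lam mu c (π.map Prod.fst) where
  prob := Measure.isProbabilityMeasure_map measurable_fst.aemeasurable
  nonneg := by
    rw [ae_map_iff measurable_fst.aemeasurable measurableSet_quadrant]
    exact h.nonneg
  mixture := by
    refine ⟨_, _, h.balance hc h0 h1, 1 / 2, by norm_num, by norm_num, fun α β hα hβ => ?_⟩
    rw [lap_map_fst h.nonneg hα hβ]
    push_cast
    ring

/-- Scaling of the plane. -/
def scale (ε : ℝ) (v : ℝ × ℝ) : ℝ × ℝ := (ε * v.1, ε * v.2)

theorem measurable_scale (ε : ℝ) : Measurable (scale ε) := by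
  unfold scale; fun_prop

theorem lap_map_scale (K : Measure (ℝ × ℝ)) (ε : ℝ) (α β : ℂ) :
    lap (K.map (scale ε)) α β = lap K (ε * α) (ε * β) := by
  rw [lap, integral_map (measurable_scale ε).aemeasurable (by fun_prop), lap]
  congr 1
  ext v
  simp only [scale, Complex.ofReal_mul]
  congr 1
  ring

theorem nonneg_map_scale {K : Measure (ℝ × ℝ)} (hK : ∀ᵐ v ∂K, 0 ≤ v.1 ∧ 0 ≤ v.2) {ε : ℝ}
    (hε : 0 ≤ ε) : ∀ᵐ v ∂(K.map (scale ε)), 0 ≤ v.1 ∧ 0 ≤ v.2 := by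
  rw [ae_map_iff (measurable_scale ε).aemeasurable measurableSet_quadrant]
  filter_upwards [hK] with v hv using ⟨mul_nonneg hε hv.1, mul_nonneg hε hv.2⟩

/-- Markov's inequality for `1 - exp (-v₁ / R)`, which is at least `1 - 1/e ≥ 1/2` where `v₁ ≥ R`.
-/
theorem measureReal_tail_le {Q : Measure (ℝ × ℝ)} [IsProbabilityMeasure Q]
    (hQ : ∀ᵐ v ∂Q, 0 ≤ v.1 ∧ 0 ≤ v.2) {A R : ℝ} (hR : 0 < R)
    (h : ‖1 - lap Q ((1 / R : ℝ) : ℂ) 0‖ ≤ A * (1 / R)) :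
    Q.real {v | R ≤ v.1} ≤ 2 * A / R := by
  have hint : Integrable (fun v : ℝ × ℝ => Real.exp (-(1 / R * v.1))) Q := by
    refine Integrable.mono' (integrable_const 1) (by fun_prop) ?_
    filter_upwards [hQ] with v hv
    rw [Real.norm_of_nonneg (Real.exp_pos _).le, Real.exp_le_one_iff, neg_nonpos]
    exact mul_nonneg (by positivity) hv.1
  have hI : ∫ v, (1 - Real.exp (-(1 / R * v.1))) ∂Q ≤ A * (1 / R) := by
    rw [integral_sub (integrable_const 1) hint, integral_const, probReal_univ, one_smul]
    have e := lap_ofReal Q (1 / R) 0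
    simp only [zero_mul, add_zero, Complex.ofReal_zero] at e
    rw [e, ← Complex.ofReal_one, ← Complex.ofReal_sub, Complex.norm_real] at h
    exact (Real.le_norm_self _).trans h
  have hmarkov := mul_meas_ge_le_integral_of_nonneg (μ := Q)
    (f := fun v => 1 - Real.exp (-(1 / R * v.1))) ?_ ((integrable_const 1).sub hint) (1 / 2)
  · have hsub : {v : ℝ × ℝ | R ≤ v.1} ⊆ {v | 1 / 2 ≤ 1 - Real.exp (-(1 / R * v.1))} := by
      intro v hv
      have h1 : R ≤ v.1 := hv
      have h2 : (1 : ℝ) ≤ 1 / R * v.1 := by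
        rw [one_div, inv_mul_eq_div, le_div_iff₀ hR]; linarith
      have h3 : Real.exp (-(1 / R * v.1)) ≤ Real.exp (-1) := Real.exp_le_exp.2 (by linarith)
      have h4 : Real.exp (-1) ≤ 1 / 2 := by
        rw [Real.exp_neg, ← one_div]
        exact one_div_le_one_div_of_le two_pos (by linarith [Real.add_one_le_exp 1])
      simp only [Set.mem_ofPred_eq]
      linarith
    have hmono := measureReal_mono (μ := Q) hsub
    have : 2 * A / R = 2 * (A * (1 / R)) := by ring
    linarith
  · filter_upwards [hQ] with v hv
    have : Real.exp (-(1 / R * v.1)) ≤ 1 := by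
      rw [Real.exp_le_one_iff, neg_nonpos]
      exact mul_nonneg (by positivity) hv.1
    simpa using this

theorem isTightMeasureSet_of_lap {S : Set (Measure (ℝ × ℝ))} {A : ℝ} (hA : 0 ≤ A)
    (hS : ∀ Q ∈ S, IsProbabilityMeasure Q ∧ (∀ᵐ v ∂Q, 0 ≤ v.1 ∧ 0 ≤ v.2) ∧
      ∀ t : ℝ, 0 < t → ‖1 - lap Q t 0‖ ≤ A * t ∧ ‖1 - lap Q 0 t‖ ≤ A * t) :
    IsTightMeasureSet S := by
  rw [isTightMeasureSet_iff_exists_isCompact_measure_compl_le]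
  intro ε hε
  obtain ⟨R, hR, hRε⟩ : ∃ R : ℝ, 0 < R ∧ ENNReal.ofReal (4 * A / R) ≤ ε := by
    rcases eq_or_ne ε ⊤ with rfl | htop
    · exact ⟨1, one_pos, le_top⟩
    · have hε' : 0 < ε.toReal := ENNReal.toReal_pos hε.ne' htop
      refine ⟨4 * (A + 1) / ε.toReal, by positivity, ?_⟩
      rw [ENNReal.ofReal_le_iff_le_toReal htop, div_le_iff₀ (by positivity)]
      field_simp
      linarith
  refine ⟨Set.Icc 0 R ×ˢ Set.Icc 0 R, isCompact_Icc.prod isCompact_Icc, fun Q hQ => ?_⟩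
  obtain ⟨hprob, hnn, hl⟩ := hS Q hQ
  have h1 := measureReal_tail_le hnn hR (hl (1 / R) (by positivity)).1
  have h2 : Q.real {v | R ≤ v.2} ≤ 2 * A / R := by
    have hsw : IsProbabilityMeasure (Q.map Prod.swap) :=
      Measure.isProbabilityMeasure_map measurable_swap.aemeasurable
    have h3 := measureReal_tail_le (nonneg_map_swap hnn) hR (A := A)
      (by rw [lap_map_swap]; exact (hl (1 / R) (by positivity)).2)
    rwa [measureReal_def, Measure.map_apply measurable_swap
      (measurableSet_le measurable_const measurable_fst), ← measureReal_def] at h3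
  refine le_trans ?_ hRε
  have hsub : Q (Set.Icc 0 R ×ˢ Set.Icc 0 R)ᶜ ≤ Q ({v | R ≤ v.1} ∪ {v | R ≤ v.2}) := by
    refine measure_mono_ae ?_
    filter_upwards [hnn] with v hv hmem
    have hmem' : ¬ (v ∈ Set.Icc (0 : ℝ) R ×ˢ Set.Icc (0 : ℝ) R) := hmem
    change R ≤ v.1 ∨ R ≤ v.2
    by_contra! hcon
    exact hmem' ⟨⟨hv.1, hcon.1.le⟩, ⟨hv.2, hcon.2.le⟩⟩
  refine hsub.trans ?_
  rw [← ofReal_measureReal]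
  refine ENNReal.ofReal_le_ofReal ((measureReal_union_le _ _).trans ?_)
  have : 4 * A / R = 2 * A / R + 2 * A / R := by ring
  linarith

theorem nonneg_of_tendsto {Qn : ℕ → ProbabilityMeasure (ℝ × ℝ)} {Q : ProbabilityMeasure (ℝ × ℝ)}
    (hlim : Tendsto Qn atTop (𝓝 Q)) (hn : ∀ n, ∀ᵐ v ∂(Qn n : Measure (ℝ × ℝ)), 0 ≤ v.1 ∧ 0 ≤ v.2) :
    ∀ᵐ v ∂(Q : Measure (ℝ × ℝ)), 0 ≤ v.1 ∧ 0 ≤ v.2 := by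
  have hclosed : IsClosed {v : ℝ × ℝ | 0 ≤ v.1 ∧ 0 ≤ v.2} :=
    (isClosed_le continuous_const continuous_fst).inter
      (isClosed_le continuous_const continuous_snd)
  have h := ProbabilityMeasure.limsup_measure_closed_le_of_tendsto hlim hclosed
  have h1 : ∀ n, (Qn n : Measure (ℝ × ℝ)) {v : ℝ × ℝ | 0 ≤ v.1 ∧ 0 ≤ v.2} = 1 := fun n =>
    (prob_compl_eq_zero_iff hclosed.measurableSet).1 (hn n)
  simp only [h1, limsup_const] at h
  exact (prob_compl_eq_zero_iff hclosed.measurableSet).2 (le_antisymm prob_le_one h)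

/-- The exponential is unbounded off the quadrant; composing with `max 0` gives a bounded continuous
test function with the same integrals. -/
theorem tendsto_lap_of_tendsto {Qn : ℕ → ProbabilityMeasure (ℝ × ℝ)}
    {Q : ProbabilityMeasure (ℝ × ℝ)} (hlim : Tendsto Qn atTop (𝓝 Q))
    (hn : ∀ n, ∀ᵐ v ∂(Qn n : Measure (ℝ × ℝ)), 0 ≤ v.1 ∧ 0 ≤ v.2) {α β : ℂ} (hα : 0 ≤ α.re)
    (hβ : 0 ≤ β.re) :
    Tendsto (fun n => lap (Qn n : Measure (ℝ × ℝ)) α β) atTop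
      (𝓝 (lap (Q : Measure (ℝ × ℝ)) α β)) := by
  let g : BoundedContinuousFunction (ℝ × ℝ) ℂ := BoundedContinuousFunction.ofNormedAddCommGroup
    (fun v : ℝ × ℝ => Complex.exp (-(α * (max 0 v.1 : ℝ) + β * (max 0 v.2 : ℝ)))) (by fun_prop) 1
    (fun v => norm_exp_neg_le_one (v := (max 0 v.1, max 0 v.2)) hα hβ
      ⟨le_max_left _ _, le_max_left _ _⟩)
  have hg : ∀ K : Measure (ℝ × ℝ), (∀ᵐ v ∂K, 0 ≤ v.1 ∧ 0 ≤ v.2) → ∫ v, g v ∂K = lap K α β := by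
    intro K hK
    refine integral_congr_ae ?_
    filter_upwards [hK] with v hv
    change Complex.exp (-(α * (max 0 v.1 : ℝ) + β * (max 0 v.2 : ℝ))) = _
    rw [max_eq_right hv.1, max_eq_right hv.2]
  have h := (ProbabilityMeasure.tendsto_iff_forall_integral_rclike_tendsto ℂ).1 hlim g
  rw [hg _ (nonneg_of_tendsto hlim hn)] at h
  exact h.congr fun n => hg _ (hn n)

/-- Prokhorov's theorem together with the limit of the balance equations. A convex combination of `M
n` and `N n` inherits the marginal bounds and, at scaled arguments, the limit of `M n`. -/
theorem exists_subseq_limit (hmu : 0 < mu) (hc : 0 < c) {ε : ℕ → ℝ} (hε0 : ∀ n, 0 < ε n)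
    (hε1 : ∀ n, ε n < 1 / 2) (hε : Tendsto ε atTop (𝓝 0)) {K : ℕ → Measure (ℝ × ℝ)}
    (hK : ∀ n, StationaryWorkload ((1 / 2 - ε n) * mu) mu c (K n))
    {Qn : ℕ → ProbabilityMeasure (ℝ × ℝ)}
    (hQn : ∀ n, (Qn n : Measure (ℝ × ℝ)) = (K n).map (scale (ε n))) :
    ∃ (Q : ProbabilityMeasure (ℝ × ℝ)) (ψ : ℕ → ℕ) (g₁ g₂ : ℂ → ℂ), StrictMono ψ ∧
      Tendsto (Qn ∘ ψ) atTop (𝓝 Q) ∧ LimitEquation (mu / (8 * c)) (Q : Measure (ℝ × ℝ)) g₁ g₂ := by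
  choose M N hB θ hθ0 hθ1 hmix using fun n => (hK n).mixture
  have hnn : ∀ n, ∀ᵐ v ∂(Qn n : Measure (ℝ × ℝ)), 0 ≤ v.1 ∧ 0 ≤ v.2 := fun n => by
    rw [hQn]; exact nonneg_map_scale (hK n).nonneg (hε0 n).le
  have hεre : ∀ n (z : ℂ), 0 ≤ z.re → 0 ≤ ((ε n : ℂ) * z).re := by
    intro n z hz
    rw [Complex.re_ofReal_mul]
    exact mul_nonneg (hε0 n).le hz
  have hcomb : ∀ (θ : ℝ), 0 ≤ θ → θ ≤ 1 → ∀ (x y : ℂ) (d : ℝ), ‖1 - x‖ ≤ d → ‖1 - y‖ ≤ d →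
      ‖1 - (θ * x + (1 - θ) * y)‖ ≤ d := by
    intro θ h0 h1 x y d hx hy
    have e : 1 - (θ * x + (1 - θ) * y) = (θ : ℂ) * (1 - x) + ((1 - θ : ℝ) : ℂ) * (1 - y) := by
      push_cast; ring
    rw [e]
    refine (norm_add_le _ _).trans ?_
    rw [norm_mul, norm_mul, Complex.norm_real, Complex.norm_real, Real.norm_of_nonneg h0,
      Real.norm_of_nonneg (sub_nonneg.2 h1)]
    nlinarith
  have htight : IsTightMeasureSet {((μ : ProbabilityMeasure (ℝ × ℝ)) : Measure (ℝ × ℝ)) |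
      μ ∈ Set.range Qn} := by
    refine isTightMeasureSet_of_lap (A := mu / (4 * c)) (by positivity) ?_
    rintro _ ⟨_, ⟨n, rfl⟩, rfl⟩
    refine ⟨inferInstance, hnn n, fun t ht => ?_⟩
    have htre : 0 ≤ (t : ℂ).re := by simpa using ht.le
    rw [hQn, lap_map_scale, lap_map_scale, mul_zero, hmix n _ _ (hεre n t htre) (by simp),
      hmix n _ _ (by simp) (hεre n t htre)]
    have b1 := (hB n).norm_one_sub_lap_le hc hmu (hε0 n) (hε1 n) ht
    have b2 := (hB n).swap.norm_one_sub_lap_le hc hmu (hε0 n) (hε1 n) ht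
    rw [lap_map_swap, lap_map_swap] at b2
    exact ⟨hcomb _ (hθ0 n) (hθ1 n) _ _ _ b1.1 b1.2, hcomb _ (hθ0 n) (hθ1 n) _ _ _ b2.2 b2.1⟩
  obtain ⟨Q, -, ψ, hψ, hlim⟩ := (isCompact_closure_of_isTightMeasureSet htight).tendsto_subseq
    (x := Qn) fun n => subset_closure ⟨n, rfl⟩
  have hQ := nonneg_of_tendsto hlim fun n => hnn (ψ n)
  have hdiff : ∀ α β : ℂ, 0 ≤ α.re → 0 ≤ β.re →
      Tendsto (fun n => lap (M n) (ε n * α) (ε n * β) - lap (Qn n : Measure (ℝ × ℝ)) α β) atTop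
        (𝓝 0) := by
    intro α β hα hβ
    have hz : Tendsto (fun n => ε n * ((2 * ‖α‖ + ‖β‖) * mu / c)) atTop (𝓝 0) := by
      simpa using hε.mul_const ((2 * ‖α‖ + ‖β‖) * mu / c)
    refine squeeze_zero_norm (fun n => ?_) hz
    have hlam0 : 0 ≤ (1 / 2 - ε n) * mu := mul_nonneg (by linarith [hε1 n]) hmu.le
    have hlam1 : (1 / 2 - ε n) * mu ≤ mu := by nlinarith [hε0 n]
    have hd := (hB n).norm_lap_sub_lap_le hc hlam0 hlam1 (hεre n α hα) (hεre n β hβ)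
    rw [hQn, lap_map_scale, hmix n _ _ (hεre n α hα) (hεre n β hβ)]
    have e : lap (M n) (ε n * α) (ε n * β) - (θ n * lap (M n) (ε n * α) (ε n * β) +
        (1 - θ n) * lap (N n) (ε n * α) (ε n * β)) = ((1 - θ n : ℝ) : ℂ) *
        (lap (M n) (ε n * α) (ε n * β) - lap (N n) (ε n * α) (ε n * β)) := by
      push_cast; ring
    rw [e, norm_mul, Complex.norm_real, Real.norm_of_nonneg (sub_nonneg.2 (hθ1 n))]
    rw [norm_mul, norm_mul, Complex.norm_real, Real.norm_of_nonneg (hε0 n).le] at hd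
    calc _ ≤ 1 * ((2 * (ε n * ‖α‖) + ε n * ‖β‖) * mu / c) := by
          gcongr
          linarith [hθ0 n]
      _ = _ := by ring
  obtain ⟨g₁, g₂, hg⟩ := exists_limitEquation hmu hc (ε := ε ∘ ψ) (fun n => hε0 _)
    (fun n => hε1 _) (hε.comp hψ.tendsto_atTop) (M := M ∘ ψ) (N := N ∘ ψ) (fun n => hB (ψ n)) hQ
    (fun α β hα hβ => by
      have h1 := (hdiff α β hα hβ).comp hψ.tendsto_atTop
      have h2 := tendsto_lap_of_tendsto hlim (fun n => hnn (ψ n)) hα hβ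
      have h3 := h1.add h2
      rw [zero_add] at h3
      refine h3.congr fun n => ?_
      simp only [Function.comp]
      ring)
  exact ⟨Q, ψ, g₁, g₂, hψ, hlim, hg⟩

/-- Every sequence `ρ → 1/2` has a subsequence along which the scaled laws converge to a solution of
the limit equation, and `P` is the only one. -/
theorem tendsto_of_limitEquation (hmu : 0 < mu) (hc : 0 < c) {P : ProbabilityMeasure (ℝ × ℝ)}
    {g₁ g₂ : ℂ → ℂ} (hP : LimitEquation (mu / (8 * c)) (P : Measure (ℝ × ℝ)) g₁ g₂)
    {K : ℝ → Measure (ℝ × ℝ)}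
    (hK : ∀ ρ ∈ Set.Ioo (0 : ℝ) (1 / 2), StationaryWorkload (ρ * mu) mu c (K ρ))
    {Q : ℝ → ProbabilityMeasure (ℝ × ℝ)}
    (hQ : ∀ ρ, (Q ρ : Measure (ℝ × ℝ)) = (K ρ).map (scale (1 / 2 - ρ))) :
    Tendsto Q (𝓝[<] (1 / 2)) (𝓝 P) := by
  refine tendsto_of_subseq_tendsto fun x hx => ?_
  have hmem : ∀ᶠ n in atTop, x n ∈ Set.Ioo (0 : ℝ) (1 / 2) :=
    hx.eventually (Ioo_mem_nhdsLT (by norm_num))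
  obtain ⟨n₀, hn₀⟩ := eventually_atTop.1 hmem
  -- The sequence lies in `(0, 1/2)` only eventually; the shift by `n₀` makes this true for every
  -- index.
  have hy : ∀ n, x (n + n₀) ∈ Set.Ioo (0 : ℝ) (1 / 2) := fun n => hn₀ _ (Nat.le_add_left _ _)
  have hx0 : Tendsto x atTop (𝓝 (1 / 2)) := hx.mono_right nhdsWithin_le_nhds
  have hε : Tendsto (fun n => 1 / 2 - x (n + n₀)) atTop (𝓝 0) := by
    have := ((tendsto_add_atTop_iff_nat n₀).2 hx0).const_sub (1 / 2)
    rwa [sub_self] at this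
  obtain ⟨L, ψ, f₁, f₂, hψ, hlim, hL⟩ := exists_subseq_limit hmu hc
    (ε := fun n => 1 / 2 - x (n + n₀)) (fun n => sub_pos.2 (hy n).2)
    (fun n => by linarith [(hy n).1]) hε (K := fun n => K (x (n + n₀)))
    (fun n => by simpa using hK _ (hy n)) (Qn := fun n => Q (x (n + n₀))) (fun n => hQ _)
  have hLP' : (L : Measure (ℝ × ℝ)) = P := hL.measure_unique (by positivity) hP
  have hLP : L = P := Subtype.ext hLP'
  rw [hLP] at hlim
  exact ⟨fun n => ψ n + n₀, hlim⟩

end Convergence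

/-! ### Existence of a stationary law at cycle epochs -/

section Existence

variable {lam mu c : ℝ}

theorem lintegral_exp_expMeasure {s : ℝ} (hc : 0 < c) (hs : s < c) :
    ∫⁻ t, ENNReal.ofReal (Real.exp (s * t)) ∂(expMeasure c) = ENNReal.ofReal (c / (c - s)) := by
  have hcs : 0 < c - s := sub_pos.2 hs
  have h1 : expMeasure c = volume.withDensity (exponentialPDF c) := rfl
  have h2 : ∀ r : ℝ, Measurable (exponentialPDF r) := fun r =>
    (measurable_exponentialPDFReal r).ennreal_ofReal
  rw [h1, lintegral_withDensity_eq_lintegral_mul _ (h2 c) (by fun_prop)]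
  have h3 : ∀ t : ℝ, (exponentialPDF c * fun t => ENNReal.ofReal (Real.exp (s * t))) t =
      ENNReal.ofReal (c / (c - s)) * exponentialPDF (c - s) t := by
    intro t
    rw [Pi.mul_apply, exponentialPDF_eq, exponentialPDF_eq,
      ← ENNReal.ofReal_mul' (Real.exp_pos _).le, ← ENNReal.ofReal_mul (by positivity)]
    congr 1
    split_ifs
    · have : Real.exp (-((c - s) * t)) = Real.exp (-(c * t)) * Real.exp (s * t) := by
        rw [← Real.exp_add]; congr 1; ring
      rw [this]
      field_simp
    · simp
  simp_rw [h3]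
  rw [lintegral_const_mul _ (h2 _), lintegral_exponentialPDF_eq_one hcs, mul_one]

/-- The workloads after a full cycle with residence times `t.1` and `t.2`. -/
noncomputable def cycleMap (lam mu : ℝ) (p : (ℝ × ℝ) × ℝ × ℝ) : ℝ × ℝ :=
  serveSecond lam mu p.2.2 (serveFirst lam mu p.2.1 p.1)

theorem continuous_cycleMap : Continuous (cycleMap lam mu) :=
  continuous_serveSecond.comp (f := fun p : (ℝ × ℝ) × ℝ × ℝ =>
    (p.2.2, serveFirst lam mu p.2.1 p.1)) ((by fun_prop : Continuous fun p : (ℝ × ℝ) × ℝ × ℝ =>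
      p.2.2).prodMk (continuous_serveFirst.comp (f := fun p : (ℝ × ℝ) × ℝ × ℝ =>
        (p.2.1, p.1)) (by fun_prop)))

/-- Transition operator of the workloads over a full cycle. -/
noncomputable def cycleLaw (lam mu c : ℝ) (N : Measure (ℝ × ℝ)) : Measure (ℝ × ℝ) :=
  (N.prod ((expMeasure c).prod (expMeasure c))).map (cycleMap lam mu)

/-- Laws on the quadrant whose marginals have exponential moments bounded by `B`. -/
structure ExpBounded (θ B : ℝ) (N : Measure (ℝ × ℝ)) : Prop where
  prob : IsProbabilityMeasure N
  nonneg : ∀ᵐ v ∂N, 0 ≤ v.1 ∧ 0 ≤ v.2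
  fst : ∫⁻ v, ENNReal.ofReal (Real.exp (θ * v.1)) ∂N ≤ ENNReal.ofReal B
  snd : ∫⁻ v, ENNReal.ofReal (Real.exp (θ * v.2)) ∂N ≤ ENNReal.ofReal B

/-- From `|1 - exp (-t v₁)| ≤ t v₁` and `θ v₁ ≤ exp (θ v₁)`. -/
theorem ExpBounded.norm_one_sub_lap_le {θ B : ℝ} (hθ : 0 < θ) (hB : 0 ≤ B) {N : Measure (ℝ × ℝ)}
    (h : ExpBounded θ B N) {t : ℝ} (ht : 0 < t) : ‖1 - lap N t 0‖ ≤ B / θ * t := by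
  have := h.prob
  have hint : Integrable (fun v : ℝ × ℝ => Real.exp (θ * v.1)) N := by
    refine ⟨by fun_prop, ?_⟩
    rw [hasFiniteIntegral_iff_ofReal (Eventually.of_forall fun _ => (Real.exp_pos _).le)]
    exact h.fst.trans_lt ENNReal.ofReal_lt_top
  have hI : ∫ v, Real.exp (θ * v.1) ∂N ≤ B := by
    rw [integral_eq_lintegral_of_nonneg_ae (Eventually.of_forall fun _ => (Real.exp_pos _).le)
      (by fun_prop)]
    exact ENNReal.toReal_le_of_le_ofReal hB h.fst
  have hi := integrable_exp_neg h.nonneg (α := t) (β := 0) (by simpa using ht.le) (by simp)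
  have e : 1 - lap N t 0 = ∫ v : ℝ × ℝ, (1 - Complex.exp (-(t * v.1 + 0 * v.2))) ∂N := by
    rw [integral_sub (integrable_const 1) hi]
    simp [lap]
  rw [e]
  have hb : ∀ᵐ v ∂N, ‖1 - Complex.exp (-((t : ℂ) * (v.1 : ℂ) + 0 * v.2))‖ ≤
      t / θ * Real.exp (θ * v.1) := by
    filter_upwards [h.nonneg] with v hv
    have h1 := norm_exp_neg_sub_le (α := t) (β := 0) (by simpa using ht.le) (by simp)
      (v := (0, 0)) (w := v) (by simp) hv (δ := max v.1 v.2)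
      (by simp [abs_of_nonneg hv.1])
      (by simp [abs_of_nonneg hv.2])
    have h2 := norm_exp_sub_exp_le (z := 0) (w := -((t : ℂ) * (v.1 : ℂ) + 0 * v.2)) (by simp)
      (by simpa using mul_nonneg ht.le hv.1)
    rw [Complex.exp_zero] at h2
    refine h2.trans ?_
    have h3 : ‖(0 : ℂ) - -((t : ℂ) * (v.1 : ℂ) + 0 * v.2)‖ = t * v.1 := by
      rw [zero_sub, neg_neg, zero_mul, add_zero, ← Complex.ofReal_mul, Complex.norm_real,
        Real.norm_of_nonneg (mul_nonneg ht.le hv.1)]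
    rw [h3, div_mul_eq_mul_div, le_div_iff₀ hθ, mul_assoc]
    gcongr
    linarith [Real.add_one_le_exp (θ * v.1)]
  refine (norm_integral_le_of_norm_le (hint.const_mul _) hb).trans ?_
  rw [integral_const_mul]
  calc t / θ * ∫ v, Real.exp (θ * v.1) ∂N ≤ t / θ * B := by gcongr
    _ = _ := by ring

theorem ExpBounded.swap {θ B : ℝ} {N : Measure (ℝ × ℝ)} (h : ExpBounded θ B N) :
    ExpBounded θ B (N.map Prod.swap) where
  prob := have := h.prob; Measure.isProbabilityMeasure_map measurable_swap.aemeasurable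
  nonneg := nonneg_map_swap h.nonneg
  fst := by
    rw [lintegral_map (by fun_prop) measurable_swap]
    exact h.snd
  snd := by
    rw [lintegral_map (by fun_prop) measurable_swap]
    exact h.fst

theorem isTightMeasureSet_expBounded {θ B : ℝ} (hθ : 0 < θ) (hB : 0 ≤ B) :
    IsTightMeasureSet {N | ExpBounded θ B N} := by
  refine isTightMeasureSet_of_lap (A := B / θ) (by positivity) fun N hN => ⟨hN.prob, hN.nonneg,
    fun t ht => ⟨hN.norm_one_sub_lap_le hθ hB ht, ?_⟩⟩
  have := hN.swap.norm_one_sub_lap_le hθ hB ht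
  rwa [lap_map_swap] at this

theorem isProbabilityMeasure_cycleLaw (hc : 0 < c) {N : Measure (ℝ × ℝ)}
    [IsProbabilityMeasure N] : IsProbabilityMeasure (cycleLaw lam mu c N) :=
  have := isProbabilityMeasure_expMeasure hc
  Measure.isProbabilityMeasure_map continuous_cycleMap.measurable.aemeasurable

theorem lintegral_three {N : Measure (ℝ × ℝ)} [IsProbabilityMeasure N] {E : Measure ℝ}
    [IsProbabilityMeasure E] {f : ℝ × ℝ → ENNReal} {g h : ℝ → ENNReal} (hf : Measurable f)
    (hg : Measurable g) (hh : Measurable h) :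
    ∫⁻ p : (ℝ × ℝ) × ℝ × ℝ, f p.1 * (g p.2.1 * h p.2.2) ∂(N.prod (E.prod E)) =
      (∫⁻ v, f v ∂N) * ((∫⁻ t, g t ∂E) * ∫⁻ t, h t ∂E) := by
  have h1 : Measurable fun q : ℝ × ℝ => g q.1 * h q.2 :=
    (hg.comp measurable_fst).mul (hh.comp measurable_snd)
  rw [lintegral_prod_mul (f := f) (g := fun q : ℝ × ℝ => g q.1 * h q.2) hf.aemeasurable
    h1.aemeasurable, lintegral_prod_mul (f := g) (g := h) hg.aemeasurable hh.aemeasurable]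

theorem exp_max_le {x y : ℝ} : Real.exp (max 0 x + y) ≤ Real.exp y + Real.exp (x + y) := by
  rcases le_total 0 x with h | h
  · rw [max_eq_right h]; linarith [Real.exp_pos y]
  · rw [max_eq_left h, zero_add]; linarith [Real.exp_pos (x + y)]

/-- Exponential moments obey an affine drift inequality over a cycle. A workload either hits zero,
contributing at most `c / (c - θ * lam)`, or keeps its initial value plus a net drift, which
multiplies its moment by `c / (c - θ * lam) * (c / (c + θ * (mu - lam)))`. By `hB` the bound `B` is
preserved. -/
theorem ExpBounded.cycleLaw (hc : 0 < c) (h0 : 0 ≤ lam) (h1 : lam ≤ mu) {θ B : ℝ} (hθ : 0 < θ)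
    (hθc : θ * lam < c) (hB0 : 0 ≤ B)
    (hB : c / (c - θ * lam) * (1 + c / (c + θ * (mu - lam)) * B) ≤ B) {N : Measure (ℝ × ℝ)}
    (h : ExpBounded θ B N) : ExpBounded θ B (cycleLaw lam mu c N) := by
  have := h.prob
  have := isProbabilityMeasure_expMeasure hc
  have hml : 0 ≤ mu - lam := sub_nonneg.2 h1
  have hθm : 0 ≤ θ * (mu - lam) := mul_nonneg hθ.le hml
  have hpos : ∀ᵐ p ∂(N.prod ((expMeasure c).prod (expMeasure c))),
      (0 ≤ p.1.1 ∧ 0 ≤ p.1.2) ∧ 0 ≤ p.2.1 ∧ 0 ≤ p.2.2 := by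
    filter_upwards [Measure.quasiMeasurePreserving_fst.ae h.nonneg,
      Measure.quasiMeasurePreserving_snd.ae
        (Measure.quasiMeasurePreserving_fst (ν := expMeasure c) |>.ae (ae_pos_expMeasure hc)),
      Measure.quasiMeasurePreserving_snd.ae
        (Measure.quasiMeasurePreserving_snd (μ := expMeasure c) |>.ae (ae_pos_expMeasure hc))]
      with p a b d using ⟨a, b.le, d.le⟩
  set a : ENNReal := ENNReal.ofReal (c / (c + θ * (mu - lam))) with ha
  set b : ENNReal := ENNReal.ofReal (c / (c - θ * lam)) with hb
  have hint1 : ∫⁻ t, ENNReal.ofReal (Real.exp (-(θ * (mu - lam)) * t)) ∂(expMeasure c) = a := by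
    rw [lintegral_exp_expMeasure hc (by linarith), sub_neg_eq_add]
  have hint2 : ∫⁻ t, ENNReal.ofReal (Real.exp (θ * lam * t)) ∂(expMeasure c) = b :=
    lintegral_exp_expMeasure hc hθc
  have hfin : b + ENNReal.ofReal B * (a * b) ≤ ENNReal.ofReal B := by
    have hcs : 0 < c - θ * lam := sub_pos.2 hθc
    have ha0 : 0 ≤ c / (c + θ * (mu - lam)) := by positivity
    have hb0 : 0 ≤ c / (c - θ * lam) := by positivity
    rw [ha, hb, ← ENNReal.ofReal_mul ha0, ← ENNReal.ofReal_mul hB0, ← ENNReal.ofReal_add hb0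
      (by positivity)]
    refine ENNReal.ofReal_le_ofReal (le_trans (le_of_eq ?_) hB)
    ring
  refine ⟨isProbabilityMeasure_cycleLaw hc, ?_, ?_, ?_⟩
  · rw [FluidPolling.cycleLaw, ae_map_iff continuous_cycleMap.measurable.aemeasurable
      measurableSet_quadrant]
    filter_upwards [hpos] with p hp
    exact serveSecond_nonneg h0 hp.2.2 (serveFirst_nonneg h0 hp.2.1 hp.1)
  · rw [FluidPolling.cycleLaw, lintegral_map (by fun_prop) continuous_cycleMap.measurable]
    calc _ ≤ ∫⁻ p : (ℝ × ℝ) × ℝ × ℝ, (1 * (1 * ENNReal.ofReal (Real.exp (θ * lam * p.2.2))) +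
          ENNReal.ofReal (Real.exp (θ * p.1.1)) *
          (ENNReal.ofReal (Real.exp (-(θ * (mu - lam)) * p.2.1)) *
            ENNReal.ofReal (Real.exp (θ * lam * p.2.2))))
          ∂(N.prod ((expMeasure c).prod (expMeasure c))) := by
          refine lintegral_mono fun p => ?_
          rw [one_mul, one_mul, ← ENNReal.ofReal_mul (Real.exp_pos _).le,
            ← ENNReal.ofReal_mul (Real.exp_pos _).le, ← Real.exp_add, ← Real.exp_add,
            ← ENNReal.ofReal_add (Real.exp_pos _).le (Real.exp_pos _).le]
          refine ENNReal.ofReal_le_ofReal ?_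
          have e1 : θ * (cycleMap lam mu p).1 =
              max 0 (θ * (p.1.1 + (lam - mu) * p.2.1)) + θ * lam * p.2.2 := by
            simp only [cycleMap, serveSecond, serveFirst, fill, drain]
            rw [mul_add, mul_max_of_nonneg _ _ hθ.le, mul_zero, mul_assoc]
          rw [e1]
          refine exp_max_le.trans (le_of_eq ?_)
          congr 2
          ring
      _ = b + (∫⁻ v, ENNReal.ofReal (Real.exp (θ * v.1)) ∂N) * (a * b) := by
          rw [lintegral_add_left (by fun_prop),
            lintegral_three (f := fun _ => 1) (g := fun _ => 1)
              (h := fun t => ENNReal.ofReal (Real.exp (θ * lam * t))) (by fun_prop) (by fun_prop)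
              (by fun_prop),
            lintegral_three (f := fun v : ℝ × ℝ => ENNReal.ofReal (Real.exp (θ * v.1)))
              (g := fun t => ENNReal.ofReal (Real.exp (-(θ * (mu - lam)) * t)))
              (h := fun t => ENNReal.ofReal (Real.exp (θ * lam * t))) (by fun_prop) (by fun_prop)
              (by fun_prop), hint1, hint2]
          simp
      _ ≤ _ := by
          refine le_trans ?_ hfin
          gcongr
          exact h.fst
  · rw [FluidPolling.cycleLaw, lintegral_map (by fun_prop) continuous_cycleMap.measurable]
    calc _ ≤ ∫⁻ p : (ℝ × ℝ) × ℝ × ℝ, (1 * (ENNReal.ofReal (Real.exp (θ * lam * p.2.1)) * 1) +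
          ENNReal.ofReal (Real.exp (θ * p.1.2)) *
          (ENNReal.ofReal (Real.exp (θ * lam * p.2.1)) *
            ENNReal.ofReal (Real.exp (-(θ * (mu - lam)) * p.2.2))))
          ∂(N.prod ((expMeasure c).prod (expMeasure c))) := by
          refine lintegral_mono_ae ?_
          filter_upwards [hpos] with p hp
          rw [one_mul, mul_one, ← ENNReal.ofReal_mul (Real.exp_pos _).le,
            ← ENNReal.ofReal_mul (Real.exp_pos _).le, ← Real.exp_add, ← Real.exp_add,
            ← ENNReal.ofReal_add (Real.exp_pos _).le (Real.exp_pos _).le]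
          refine ENNReal.ofReal_le_ofReal ?_
          have e1 : θ * (cycleMap lam mu p).2 =
              max 0 (θ * (p.1.2 + lam * p.2.1 + (lam - mu) * p.2.2)) + 0 := by
            simp only [cycleMap, serveSecond, serveFirst, fill, drain]
            rw [mul_max_of_nonneg _ _ hθ.le, mul_zero, add_zero]
          rw [e1]
          -- Queue 2 is served last, so the term for an emptied queue is just `1`; it is enlarged to
          -- `exp (θ * lam * t)` to reach the same constant as for queue 1.
          refine exp_max_le.trans (add_le_add ?_ (le_of_eq ?_))
          · exact Real.exp_le_exp.2 (mul_nonneg (mul_nonneg hθ.le h0) hp.2.1)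
          · congr 1
            ring
      _ = b + (∫⁻ v, ENNReal.ofReal (Real.exp (θ * v.2)) ∂N) * (b * a) := by
          rw [lintegral_add_left (by fun_prop),
            lintegral_three (f := fun _ => 1) (h := fun _ => 1)
              (g := fun t => ENNReal.ofReal (Real.exp (θ * lam * t))) (by fun_prop) (by fun_prop)
              (by fun_prop),
            lintegral_three (f := fun v : ℝ × ℝ => ENNReal.ofReal (Real.exp (θ * v.2)))
              (h := fun t => ENNReal.ofReal (Real.exp (-(θ * (mu - lam)) * t)))
              (g := fun t => ENNReal.ofReal (Real.exp (θ * lam * t))) (by fun_prop) (by fun_prop)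
              (by fun_prop), hint1, hint2]
          simp
      _ ≤ _ := by
          refine le_trans ?_ hfin
          rw [mul_comm b a]
          gcongr
          exact h.snd

theorem integral_cycleLaw (hc : 0 < c) {N : Measure (ℝ × ℝ)} [IsProbabilityMeasure N]
    (f : BoundedContinuousFunction (ℝ × ℝ) ℝ) :
    ∫ v, f v ∂(cycleLaw lam mu c N) =
      ∫ v, ∫ y, f (cycleMap lam mu (v, y)) ∂((expMeasure c).prod (expMeasure c)) ∂N := by
  have := isProbabilityMeasure_expMeasure hc
  rw [cycleLaw, integral_map continuous_cycleMap.measurable.aemeasurable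
    f.continuous.aestronglyMeasurable]
  refine integral_prod (fun p => f (cycleMap lam mu p)) ?_
  refine Integrable.mono' (integrable_const ‖f‖)
    (f.continuous.comp continuous_cycleMap).aestronglyMeasurable ?_
  exact Eventually.of_forall fun p => f.norm_coe_le_norm _

/-- The Feller property of the cycle chain: the flow is continuous in the starting point, so the
transition operator preserves bounded continuous functions. -/
theorem exists_boundedContinuous_cycle (hc : 0 < c) (f : BoundedContinuousFunction (ℝ × ℝ) ℝ) :
    ∃ g : BoundedContinuousFunction (ℝ × ℝ) ℝ, ∀ N : Measure (ℝ × ℝ), IsProbabilityMeasure N →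
      ∫ v, f v ∂(cycleLaw lam mu c N) = ∫ v, g v ∂N := by
  have := isProbabilityMeasure_expMeasure hc
  refine ⟨BoundedContinuousFunction.ofNormedAddCommGroup
    (fun v => ∫ y, f (cycleMap lam mu (v, y)) ∂((expMeasure c).prod (expMeasure c))) ?_ ‖f‖ ?_,
    fun N hN => integral_cycleLaw hc f⟩
  · refine continuous_of_dominated (bound := fun _ => ‖f‖) (fun v => ?_) (fun v => ?_)
      (integrable_const _) ?_
    · exact (f.continuous.comp (continuous_cycleMap.comp
        (by fun_prop : Continuous fun y : ℝ × ℝ => (v, y)))).aestronglyMeasurable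
    · exact Eventually.of_forall fun y => f.norm_coe_le_norm _
    · exact Eventually.of_forall fun y => f.continuous.comp (continuous_cycleMap.comp
        (by fun_prop : Continuous fun v : ℝ × ℝ => (v, y)))
  · intro v
    refine (norm_integral_le_of_norm_le (integrable_const ‖f‖)
      (Eventually.of_forall fun y => f.norm_coe_le_norm _)).trans ?_
    simp

/-- The Cesàro means of a sequence of measures. -/
noncomputable def average (M : ℕ → Measure (ℝ × ℝ)) (n : ℕ) : Measure (ℝ × ℝ) :=
  ((n + 1 : ℕ) : ENNReal)⁻¹ • ∑ k ∈ Finset.range (n + 1), M k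

theorem lintegral_average_le {M : ℕ → Measure (ℝ × ℝ)} {f : ℝ × ℝ → ENNReal} {b : ENNReal}
    (h : ∀ k, ∫⁻ v, f v ∂(M k) ≤ b) (n : ℕ) : ∫⁻ v, f v ∂(average M n) ≤ b := by
  rw [average, lintegral_smul_measure, lintegral_finsetSum_measure, smul_eq_mul]
  calc _ ≤ ((n + 1 : ℕ) : ENNReal)⁻¹ * ∑ k ∈ Finset.range (n + 1), b := by
        gcongr
        exact h _
    _ = b := by
        rw [Finset.sum_const, Finset.card_range, nsmul_eq_mul, ← mul_assoc,
          ENNReal.inv_mul_cancel (by simp) (ENNReal.natCast_ne_top _), one_mul]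

theorem ExpBounded.average {θ B : ℝ} {M : ℕ → Measure (ℝ × ℝ)} (h : ∀ k, ExpBounded θ B (M k))
    (n : ℕ) : ExpBounded θ B (average M n) where
  prob := by
    refine ⟨?_⟩
    have := fun k => (h k).prob
    rw [FluidPolling.average, Measure.smul_apply, Measure.finsetSum_apply]
    simp only [measure_univ, Finset.sum_const, Finset.card_range, nsmul_eq_mul, mul_one,
      smul_eq_mul]
    exact ENNReal.inv_mul_cancel (by simp) (ENNReal.natCast_ne_top _)
  nonneg := by
    rw [ae_iff, FluidPolling.average, Measure.smul_apply, Measure.finsetSum_apply,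
      Finset.sum_eq_zero fun k _ => ae_iff.1 (h k).nonneg, smul_zero]
  fst := lintegral_average_le (fun k => (h k).fst) n
  snd := lintegral_average_le (fun k => (h k).snd) n

theorem integral_average {M : ℕ → Measure (ℝ × ℝ)} (hM : ∀ k, IsProbabilityMeasure (M k))
    (f : BoundedContinuousFunction (ℝ × ℝ) ℝ) (n : ℕ) :
    ∫ v, f v ∂(average M n) =
      ((n : ℝ) + 1)⁻¹ * ∑ k ∈ Finset.range (n + 1), ∫ v, f v ∂(M k) := by
  rw [average, integral_smul_measure, integral_finsetSum_measure fun k _ => f.integrable _]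
  rw [ENNReal.toReal_inv, ENNReal.toReal_natCast, Nat.cast_add_one, smul_eq_mul]

theorem exists_expBounded_param (hlam : 0 < lam) (hstab : 2 * lam < mu) (hc : 0 < c) :
    ∃ θ B : ℝ, 0 < θ ∧ θ * lam < c ∧ 1 ≤ B ∧
      c / (c - θ * lam) * (1 + c / (c + θ * (mu - lam)) * B) ≤ B := by
  have hmu : 0 < mu := by linarith
  obtain ⟨θ, hθ, h1, h2⟩ : ∃ θ : ℝ, 0 < θ ∧ θ * mu < c ∧ θ * mu ^ 2 ≤ c * (mu - 2 * lam) := by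
    -- Stability is used here: the first-order term `θ * c * (mu - 2 * lam)` of `D` dominates the
    -- second-order term `θ² * lam * (mu - lam)` for this `θ`.
    refine ⟨c * (mu - 2 * lam) / mu ^ 2, by have := sub_pos.2 hstab; positivity, ?_, ?_⟩
    · rw [div_mul_eq_mul_div, div_lt_iff₀ (by positivity)]
      nlinarith [mul_pos (mul_pos hc hmu) hlam]
    · rw [div_mul_cancel₀ _ (by positivity)]
  have hcl : 0 < c - θ * lam := by nlinarith
  have hcm : 0 < c + θ * (mu - lam) := by nlinarith
  set D := (c - θ * lam) * (c + θ * (mu - lam)) - c ^ 2 with hD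
  have hDpos : 0 < D := by
    have h3 : lam * (mu - lam) < mu ^ 2 := by nlinarith
    have : D = θ * (c * (mu - 2 * lam) - θ * (lam * (mu - lam))) := by rw [hD]; ring
    rw [this]
    refine mul_pos hθ ?_
    nlinarith
  -- This `B` is the fixed point of the affine map in the required inequality, which therefore holds
  -- with equality.
  refine ⟨θ, c * (c + θ * (mu - lam)) / D, hθ, by linarith, ?_, le_of_eq ?_⟩
  · rw [le_div_iff₀ hDpos, hD]
    nlinarith [mul_pos (mul_pos hθ hlam) hcm]
  · field_simp
    rw [hD]
    ring

/-- Krylov–Bogoliubov: the Cesàro means of the chain started from empty queues are tight by the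
preserved moment bound, and any weak limit is invariant by the Feller property. -/
theorem exists_isCycleStationary (hlam : 0 < lam) (hstab : 2 * lam < mu) (hc : 0 < c) :
    ∃ ν : ProbabilityMeasure (ℝ × ℝ), IsCycleStationary lam mu c (ν : Measure (ℝ × ℝ)) := by
  obtain ⟨θ, B, hθ, hθc, hB1, hB⟩ := exists_expBounded_param hlam hstab hc
  have hB0 : 0 ≤ B := zero_le_one.trans hB1
  let M : ℕ → Measure (ℝ × ℝ) := fun k => (cycleLaw lam mu c)^[k] (Measure.dirac (0, 0))
  have hMsucc : ∀ k, M (k + 1) = cycleLaw lam mu c (M k) := fun k =>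
    Function.iterate_succ_apply' _ _ _
  have hM : ∀ k, ExpBounded θ B (M k) := by
    intro k
    induction k with
    | zero =>
      have hdirac : M 0 = Measure.dirac (0, 0) := rfl
      rw [hdirac]
      refine ⟨inferInstance, ?_, ?_, ?_⟩
      · rw [ae_dirac_iff measurableSet_quadrant]; simp
      · rw [lintegral_dirac' _ (by fun_prop)]; simpa using hB1
      · rw [lintegral_dirac' _ (by fun_prop)]; simpa using hB1
    | succ k ih =>
      rw [hMsucc]
      exact ih.cycleLaw hc hlam.le (by linarith) hθ hθc hB0 hB
  have hprob := fun k => (hM k).prob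
  have hA := fun n => ExpBounded.average hM n
  let A : ℕ → ProbabilityMeasure (ℝ × ℝ) := fun n => ⟨average M n, (hA n).prob⟩
  have htight : IsTightMeasureSet {((μ : ProbabilityMeasure (ℝ × ℝ)) : Measure (ℝ × ℝ)) |
      μ ∈ Set.range A} := by
    refine (isTightMeasureSet_expBounded hθ hB0).subset ?_
    rintro _ ⟨_, ⟨n, rfl⟩, rfl⟩
    exact hA n
  obtain ⟨ν, -, ψ, hψ, hlim⟩ := (isCompact_closure_of_isTightMeasureSet htight).tendsto_subseq
    (x := A) fun n => subset_closure ⟨n, rfl⟩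
  refine ⟨ν, nonneg_of_tendsto hlim fun n => (hA (ψ n)).nonneg, ?_⟩
  have hprob' : IsProbabilityMeasure (cycleLaw lam mu c (ν : Measure (ℝ × ℝ))) :=
    isProbabilityMeasure_cycleLaw hc
  change cycleLaw lam mu c (ν : Measure (ℝ × ℝ)) = ν
  refine ext_of_forall_integral_eq_of_IsFiniteMeasure fun f => ?_
  obtain ⟨g, hg⟩ := exists_boundedContinuous_cycle (lam := lam) (mu := mu) hc f
  rw [hg _ inferInstance]
  have hweak := ProbabilityMeasure.tendsto_iff_forall_integral_tendsto.1 hlim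
  have hdiff : Tendsto (fun n => ∫ v, g v ∂(average M n) - ∫ v, f v ∂(average M n)) atTop
      (𝓝 0) := by
    have hz : Tendsto (fun n : ℕ => 2 * ‖f‖ * (1 / ((n : ℝ) + 1))) atTop (𝓝 0) := by
      simpa using tendsto_one_div_add_atTop_nhds_zero_nat.const_mul (2 * ‖f‖)
    refine squeeze_zero_norm (fun n => ?_) hz
    have hb : ∀ k, ‖∫ v, f v ∂(M k)‖ ≤ ‖f‖ := fun k => f.norm_integral_le_norm (M k)
    rw [integral_average hprob, integral_average hprob, ← mul_sub, ← Finset.sum_sub_distrib]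
    -- Integrating `g` against `M k` is integrating `f` against `M (k + 1)`, so the sum telescopes.
    have e : ∑ k ∈ Finset.range (n + 1), (∫ v, g v ∂(M k) - ∫ v, f v ∂(M k)) =
        ∫ v, f v ∂(M (n + 1)) - ∫ v, f v ∂(M 0) := by
      rw [← Finset.sum_range_sub fun k => ∫ v, f v ∂(M k)]
      exact Finset.sum_congr rfl fun k _ => by rw [hMsucc, hg _ (hprob k)]
    rw [e, norm_mul, norm_inv, Real.norm_of_nonneg (by positivity : (0 : ℝ) ≤ n + 1), one_div,
      mul_comm]
    gcongr
    exact (norm_sub_le _ _).trans (by linarith [hb (n + 1), hb 0])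
  have h1 : Tendsto (fun n => ∫ v, g v ∂(average M (ψ n)) - ∫ v, f v ∂(average M (ψ n))) atTop
      (𝓝 (∫ v, g v ∂(ν : Measure (ℝ × ℝ)) - ∫ v, f v ∂(ν : Measure (ℝ × ℝ)))) :=
    (hweak g).sub (hweak f)
  exact sub_eq_zero.1 (tendsto_nhds_unique h1 (hdiff.comp hψ.tendsto_atTop))

end Existence

end FluidPolling

/-! ### The heavy-traffic theorem -/

theorem corollary4p5 (mu c : ℝ) (hmu : 0 < mu) (hc : 0 < c) :
    -- `P` is the law of the heavy-traffic limit of `((1/2 - ρ) V₁, (1/2 - ρ) V₂)`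
    (∃ P : ProbabilityMeasure (ℝ × ℝ),
      -- convergence in distribution of the scaled stationary workloads at arbitrary epochs
      (∀ π : ℝ → ProbabilityMeasure FluidPolling.State,
        (∀ ρ ∈ Set.Ioo (0 : ℝ) (1 / 2),
          FluidPolling.IsTimeStationary (ρ * mu) mu c (π ρ : Measure FluidPolling.State)) →
        TendstoInDistribution
          (fun (ρ : ℝ) (x : FluidPolling.State) => ((1 / 2 - ρ) * x.1.1, (1 / 2 - ρ) * x.1.2))
          (𝓝[<] (1 / 2 : ℝ)) (id : ℝ × ℝ → ℝ × ℝ)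
          (fun ρ => (π ρ : Measure FluidPolling.State)) (P : Measure (ℝ × ℝ))) ∧
      -- the same for the stationary workloads at the starts of the visits to queue 1
      (∀ ν : ℝ → ProbabilityMeasure (ℝ × ℝ),
        (∀ ρ ∈ Set.Ioo (0 : ℝ) (1 / 2),
          FluidPolling.IsCycleStationary (ρ * mu) mu c (ν ρ : Measure (ℝ × ℝ))) →
        TendstoInDistribution
          (fun (ρ : ℝ) (v : ℝ × ℝ) => ((1 / 2 - ρ) * v.1, (1 / 2 - ρ) * v.2))
          (𝓝[<] (1 / 2 : ℝ)) (id : ℝ × ℝ → ℝ × ℝ)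
          (fun ρ => (ν ρ : Measure (ℝ × ℝ))) (P : Measure (ℝ × ℝ))) ∧
      -- the first two marginal moments, the cross moment and the correlation of the limit
      MemLp (fun z : ℝ × ℝ => z.1) 2 (P : Measure (ℝ × ℝ)) ∧
      MemLp (fun z : ℝ × ℝ => z.2) 2 (P : Measure (ℝ × ℝ)) ∧
      ∫ z, z.1 ∂(P : Measure (ℝ × ℝ)) = mu / (8 * c) ∧
      ∫ z, z.2 ∂(P : Measure (ℝ × ℝ)) = mu / (8 * c) ∧
      ∫ z, z.1 ^ 2 ∂(P : Measure (ℝ × ℝ)) = mu ^ 2 / (32 * c ^ 2) ∧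
      ∫ z, z.2 ^ 2 ∂(P : Measure (ℝ × ℝ)) = mu ^ 2 / (32 * c ^ 2) ∧
      ∫ z, z.1 * z.2 ∂(P : Measure (ℝ × ℝ)) =
        mu ^ 2 / (32 * c ^ 2) * ((Real.pi ^ 2 - 9) / 3) ∧
      FluidPolling.correlation (fun z : ℝ × ℝ => z.1) (fun z : ℝ × ℝ => z.2)
        (P : Measure (ℝ × ℝ)) = 2 / 3 * Real.pi ^ 2 - 7) ∧
    |2 / 3 * Real.pi ^ 2 - 7 - (-0.4203)| < (0.00005 : ℝ) := by
  have hmean : 0 < mu / (8 * c) := by positivity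
  have hrange : ∀ ρ ∈ Set.Ioo (0 : ℝ) (1 / 2), 0 < ρ * mu ∧ ρ * mu ≤ mu ∧ 2 * (ρ * mu) < mu :=
    fun ρ hρ => ⟨mul_pos hρ.1 hmu, by nlinarith [hρ.2], by nlinarith [hρ.2]⟩
  have hε0 : ∀ n : ℕ, (0 : ℝ) < 1 / ((n : ℝ) + 3) := fun n => by positivity
  have hε1 : ∀ n : ℕ, 1 / ((n : ℝ) + 3) < 1 / 2 := fun n =>
    one_div_lt_one_div_of_lt two_pos (by linarith [(Nat.cast_nonneg n : (0 : ℝ) ≤ n)])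
  have hε : Tendsto (fun n : ℕ => 1 / ((n : ℝ) + 3)) atTop (𝓝 0) := by
    have := (tendsto_add_atTop_iff_nat 3).2 (tendsto_one_div_atTop_nhds_zero_nat (𝕜 := ℝ))
    simpa using this
  have hmem : ∀ n : ℕ, 1 / 2 - 1 / ((n : ℝ) + 3) ∈ Set.Ioo (0 : ℝ) (1 / 2) := fun n =>
    ⟨sub_pos.2 (hε1 n), sub_lt_self _ (hε0 n)⟩
  -- The law `P` must be produced independently of the families in the statement: it is a
  -- subsequential limit of stationary laws at `ρ = 1/2 - 1/(n + 3)`, where the shift by three keeps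
  -- every `ρ` in `(0, 1/2)`.
  choose ν hν using fun n : ℕ => FluidPolling.exists_isCycleStationary
    (hrange _ (hmem n)).1 (hrange _ (hmem n)).2.2 hc
  obtain ⟨P, -, g₁, g₂, -, -, hP⟩ := FluidPolling.exists_subseq_limit hmu hc hε0 hε1 hε
    (K := fun n => (ν n : Measure (ℝ × ℝ)))
    (fun n => (hν n).stationaryWorkload hc (hrange _ (hmem n)).1.le (hrange _ (hmem n)).2.1)
    (Qn := fun n => (ν n).map (FluidPolling.measurable_scale _).aemeasurable) fun n => rfl
  have hlimit : (⟨(P : Measure (ℝ × ℝ)).map id,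
      Measure.isProbabilityMeasure_map aemeasurable_id⟩ : ProbabilityMeasure (ℝ × ℝ)) = P :=
    Subtype.ext Measure.map_id
  refine ⟨⟨P, fun π hπ => ?_, fun κ hκ => ?_, hP.memLp_fst hmean, hP.memLp_snd hmean,
    (hP.integral_fst hmean).2, hP.integral_snd hmean, ?_, ?_, ?_, hP.correlation_eq hmean⟩, ?_⟩
  · have hmeas : ∀ ρ : ℝ, Measurable fun x : FluidPolling.State =>
        ((1 / 2 - ρ) * x.1.1, (1 / 2 - ρ) * x.1.2) := fun ρ => by fun_prop
    refine ⟨fun ρ => (hmeas ρ).aemeasurable, aemeasurable_id, ?_⟩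
    rw [hlimit]
    refine FluidPolling.tendsto_of_limitEquation hmu hc hP
      (K := fun ρ => (π ρ : Measure FluidPolling.State).map Prod.fst)
      (fun ρ hρ => (hπ ρ hρ).stationaryWorkload hc (hrange ρ hρ).1.le (hrange ρ hρ).2.1)
      fun ρ => ?_
    rw [Measure.map_map (FluidPolling.measurable_scale _) measurable_fst]
    rfl
  · refine ⟨fun ρ => (FluidPolling.measurable_scale (1 / 2 - ρ)).aemeasurable, aemeasurable_id, ?_⟩
    rw [hlimit]
    exact FluidPolling.tendsto_of_limitEquation hmu hc hP
      (K := fun ρ => (κ ρ : Measure (ℝ × ℝ)))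
      (fun ρ hρ => (hκ ρ hρ).stationaryWorkload hc (hrange ρ hρ).1.le (hrange ρ hρ).2.1)
      fun ρ => rfl
  · rw [(hP.integral_fst_sq hmean).2]
    field_simp
    norm_num
  · rw [(hP.integral_snd_sq hmean).2]
    field_simp
    norm_num
  · rw [(hP.integral_mul hmean).2]
    field_simp
    ring
  · have h1 := Real.pi_gt_d6
    have h2 := Real.pi_lt_d6
    rw [abs_lt]
    constructor <;> nlinarith
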